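/- Setup. Let $k$ be a non-archimedean local field with residue field $\mathbb F_q$, $\breve k$ the completion of a maximal unramified extension of $k$, with residue field $\overline{\mathbb F}_q$, and let $F$ denote the action of the Frobenius of $\breve k/k$. Let $G$ be an unramified reductive group over $k$ (quasi-split over $k$, split over $\breve k$) such that the Dynkin diagram of $G_{\breve k}$ is non-empty and connected. Let $T\subseteq G$ be a $k$-rational, $\breve k$-split maximal torus and $B\supseteq T$ a Borel subgroup, with set of simple roots $\Delta_0\subset\Phi=\Phi(T,G)\subset X^*(T)$. Let $W=N_G(T)/T$. A choice of simple roots $\Delta\subset\Phi$ makes $W$ a Coxeter group with length function $\ell=\ell_\Delta$. For an automorphism $\sigma$ with $\sigma(\Delta)=\Delta$, put $\sigma(w)=\sigma w\sigma^{-1}$; one calls $c\sigma$, with $c\in W$, a twisted Coxeter element of $(W,\sigma)$ if a reduced expression of $c$ contains precisely one simple reflection from each $\sigma$-orbit of simple reflections. In that case the Coxeter number $h$ of $(W,\sigma)$ is the order of $c\sigma$ acting on $\Phi$. Assume that $(T,B)$ is a Coxeter pair: there are a $k$-rational Borel subgroup $B_0$ of $G$, a $k$-rational maximal torus $T_0\subseteq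 B_0$ and $g\in G(\breve k)$ with ${}^g(T_0,B_0)=(T,B)$ such that, with $w$ the image of $g^{-1}F(g)$ in $W_0=N_G(T_0)/T_0$ and $\sigma_0$ the automorphism of $W_0$ induced by $F$, the element $w\sigma_0$ is a twisted Coxeter element of $(W_0,\sigma_0)$ with respect to the simple reflections determined by $B_0$. Let $T_1$ be the torus over $\overline{\mathbb F}_q$ obtained by reduction from the standard integral model of $T$. Thus $X^*(T_1)=X^*(T)$, $X_*(T_1)=X_*(T)$, and $T_1$ has a geometric Frobenius $F\colon T_1\to T_1$. This acts on $X^*(T_1)=X^*(T)$ by $\chi\mapsto\chi\circ F$. For $\nu\in X_*(T_1)$ put $$H_\nu=\{t\in T_1 : t^{-1}F(t)\in \operatorname{im}(\nu\colon\mathbb G_m\to T_1)\},$$ and let $H_\nu^\circ$ be its identity component. For $\alpha$ in a set of simple roots $\Delta$, let $\alpha^*\in X_*(T^{\rm ad})_{\mathbb Q}$ be the corresponding fundamental coweight, i.e. $\langle\beta,\alpha^*\rangle=\delta_{\alpha\beta}$ for $\beta\in\Delta$, and let $H^\circ_{\alpha^*}$ denote $H_\nu^\circ$ for any $\nu\in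 X_*(T_1)$ that is a non-zero integral multiple of a lift of $\alpha^*$ to $X_*(T)_{\mathbb Q}$. Let $\alpha_0$ be the highest root with respect to $\Delta_0$, and $M=\max_{\alpha\in\Delta_0}\langle\alpha_0,\alpha^*\rangle$. Proposition 6.2. Assume $q>M$. Then there exists a set of simple roots $\Delta\subset\Phi(T,G)$ such that: (i) $F$ acts on $X^*(T)$ as $q\,c\sigma$, where $\sigma(\Delta)=\Delta$, $c\in W$, and $c\sigma$ is a twisted Coxeter element of $(W,\sigma)$ such that $$\ell\bigl(c\,\sigma(c)\cdots\sigma^{i-1}(c)\bigr)=i\,\ell(c)\qquad\text{for all integers } 0\le i\le h/2,$$ where $h$ is the Coxeter number of $(W,\sigma)$; (ii) for all $\alpha\in\Delta$ and all $\gamma\in\Phi(T,G)$ one has $H_{\alpha^*}^\circ\not\subseteq\ker(\gamma)$; this holds for every choice of $\nu$ as above. -/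

import Mathlib

noncomputable section

namespace CoxeterTorus

open scoped Matrix

/-! ## Linear algebraic groups over an algebraically closed field `Ω`

A linear algebraic group is a Zariski closed subgroup of some `GL_n(Ω)`; the ambient field `Ω`
is an algebraic closure of the complete field over which the groups split. -/

section AlgebraicGroups

variable {n : ℕ} {Ω : Type*} [Field Ω]

/-- The ideal of all polynomials in the matrix entries that vanish on `H`. -/
def vanishing (H : Subgroup (GL (Fin n) Ω)) : Ideal (MvPolynomial (Fin n × Fin n) Ω) where
  carrier := {f | ∀ g ∈ H, MvPolynomial.eval (fun p => (g : Matrix (Fin n) (Fin n) Ω) p.1 p.2) f = 0}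
  add_mem' := fun ha hb g hg => by rw [map_add, ha g hg, hb g hg, add_zero]
  zero_mem' := fun _ _ => map_zero _
  smul_mem' := fun c f hf g hg => by rw [smul_eq_mul, map_mul, hf g hg, mul_zero]

/-- `H` is the zero set in `GL_n(Ω)` of the polynomials vanishing on it. -/
def IsClosedSubgroup (H : Subgroup (GL (Fin n) Ω)) : Prop :=
  ∀ g : GL (Fin n) Ω,
    (∀ f ∈ vanishing H,
      MvPolynomial.eval (fun p => (g : Matrix (Fin n) (Fin n) Ω) p.1 p.2) f = 0) → g ∈ H

/-- A closed subgroup is connected if it has no proper closed subgroup of finite index. -/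
def IsConnectedSubgroup (H : Subgroup (GL (Fin n) Ω)) : Prop :=
  ∀ H' : Subgroup (GL (Fin n) Ω), IsClosedSubgroup H' → H' ≤ H → H'.relIndex H ≠ 0 → H' = H

/-- The algebraic group `H` is defined over the subfield `k`: it is closed and its vanishing ideal
is generated by polynomials with coefficients in `k`. -/
def IsDefinedOver (k : Type*) [Field k] [Algebra k Ω] (H : Subgroup (GL (Fin n) Ω)) : Prop :=
  IsClosedSubgroup H ∧
    Ideal.map (MvPolynomial.map (σ := Fin n × Fin n) (algebraMap k Ω))
      (Ideal.comap (MvPolynomial.map (algebraMap k Ω)) (vanishing H)) = vanishing H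

/-- Every element of `U` is a unipotent matrix. -/
def IsUnipotentSubgroup (U : Subgroup (GL (Fin n) Ω)) : Prop :=
  ∀ u ∈ U, IsNilpotent ((u : Matrix (Fin n) (Fin n) Ω) - 1)

/-- Connected reductive groups: connected, with trivial unipotent radical. -/
structure IsReductive (G : Subgroup (GL (Fin n) Ω)) : Prop where
  closed : IsClosedSubgroup G
  connected : IsConnectedSubgroup G
  unipotentRadical : ∀ U : Subgroup (GL (Fin n) Ω), U ≤ G → (∀ g ∈ G, ∀ u ∈ U, g * u * g⁻¹ ∈ U) →
    IsClosedSubgroup U → IsConnectedSubgroup U → IsUnipotentSubgroup U → U = ⊥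

/-- A torus: a closed connected group that can be conjugated into the diagonal matrices. -/
structure IsTorus (T : Subgroup (GL (Fin n) Ω)) : Prop where
  closed : IsClosedSubgroup T
  connected : IsConnectedSubgroup T
  diagonalizable : ∃ g : GL (Fin n) Ω, ∀ t ∈ T,
    ((g * t * g⁻¹ : GL (Fin n) Ω) : Matrix (Fin n) (Fin n) Ω).IsDiag

/-- A torus is split over a subfield `K` if it can be diagonalized by a matrix over `K`. -/
def IsSplitOver (K : Type*) [Field K] [Algebra K Ω] (T : Subgroup (GL (Fin n) Ω)) : Prop :=
  ∃ g : GL (Fin n) K, ∀ t ∈ T,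
    ((Matrix.GeneralLinearGroup.map (algebraMap K Ω) g * t *
      (Matrix.GeneralLinearGroup.map (algebraMap K Ω) g)⁻¹ : GL (Fin n) Ω) :
        Matrix (Fin n) (Fin n) Ω).IsDiag

/-- `T` is a maximal torus of `G`. -/
structure IsMaximalTorus (T G : Subgroup (GL (Fin n) Ω)) : Prop where
  torus : IsTorus T
  le : T ≤ G
  maximal : ∀ T' : Subgroup (GL (Fin n) Ω), IsTorus T' → T ≤ T' → T' ≤ G → T' = T

/-- `B` is a Borel subgroup of `G`: maximal among the closed connected solvable subgroups. -/
structure IsBorel (B G : Subgroup (GL (Fin n) Ω)) : Prop where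
  closed : IsClosedSubgroup B
  connected : IsConnectedSubgroup B
  solvable : Group.IsSolvable B
  le : B ≤ G
  maximal : ∀ B' : Subgroup (GL (Fin n) Ω), IsClosedSubgroup B' → IsConnectedSubgroup B' →
    Group.IsSolvable B' → B ≤ B' → B' ≤ G → B' = B

/-- The Lie algebra of `H`: the matrices `N` such that `1 + εN` satisfies, in the dual numbers
`Ω[ε]`, all polynomial equations of `H`. -/
def lieAlg (H : Subgroup (GL (Fin n) Ω)) : Set (Matrix (Fin n) (Fin n) Ω) :=
  {N | ∀ f ∈ vanishing H,
    MvPolynomial.aeval (fun p : Fin n × Fin n =>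
      (TrivSqZeroExt.inl ((1 : Matrix (Fin n) (Fin n) Ω) p.1 p.2) + TrivSqZeroExt.inr (N p.1 p.2) :
        DualNumber Ω)) f = 0}

/-- `χ : T → Ωˣ` is algebraic: it is given by a polynomial in the matrix entries divided by a power
of the determinant. -/
def IsAlgebraicCharacter {T : Subgroup (GL (Fin n) Ω)} (χ : T →* Ωˣ) : Prop :=
  ∃ (f : MvPolynomial (Fin n × Fin n) Ω) (m : ℕ), ∀ t : T,
    (χ t : Ω) * ((t : GL (Fin n) Ω) : Matrix (Fin n) (Fin n) Ω).det ^ m =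
      MvPolynomial.eval (fun p => ((t : GL (Fin n) Ω) : Matrix (Fin n) (Fin n) Ω) p.1 p.2) f

/-- `χ` belongs to `Φ(T, H)`: it is a non-trivial weight of `T` on the Lie algebra of `H`. -/
def IsWeight (H : Subgroup (GL (Fin n) Ω)) {T : Subgroup (GL (Fin n) Ω)} (χ : T →* Ωˣ) : Prop :=
  χ ≠ 1 ∧ ∃ N ∈ lieAlg H, N ≠ 0 ∧ ∀ t : T,
    ((t : GL (Fin n) Ω) : Matrix (Fin n) (Fin n) Ω) * N *
      (((t : GL (Fin n) Ω)⁻¹ : GL (Fin n) Ω) : Matrix (Fin n) (Fin n) Ω) = (χ t : Ω) • N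

end AlgebraicGroups

/-! ## Weyl groups, length and twisted Coxeter elements of a root datum -/

section RootData

variable {ι X Y : Type*} [AddCommGroup X] [AddCommGroup Y] {P : RootPairing ι ℤ X Y}

/-- The Weyl group, as a group of automorphisms of `X`. -/
def weyl (P : RootPairing ι ℤ X Y) : Subgroup (X ≃ₗ[ℤ] X) :=
  Subgroup.closure (Set.range P.reflection)

/-- `l` is a word in the simple reflections of `Δ`, with product `w`. -/
def IsWord (Δ : P.Base) (l : List ι) (w : X ≃ₗ[ℤ] X) : Prop :=
  (∀ i ∈ l, i ∈ Δ.support) ∧ (l.map P.reflection).prod = w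

/-- The length of `w ∈ W` with respect to the simple reflections of `Δ`. -/
def len (Δ : P.Base) (w : X ≃ₗ[ℤ] X) : ℕ :=
  sInf {m | ∃ l : List ι, IsWord Δ l w ∧ l.length = m}

/-- `c ∈ W` is a twisted Coxeter element for the permutation `σ` of `Δ`: it has a reduced expression
that contains, counted with multiplicity, precisely one simple reflection from each `σ`-orbit. -/
def IsTwistedCoxeter (Δ : P.Base) (σ c : X ≃ₗ[ℤ] X) : Prop :=
  ∃ l : List ι, IsWord Δ l c ∧ l.length = len Δ c ∧ l.Nodup ∧
    ∀ j ∈ Δ.support, ∃! i, i ∈ l ∧ ∃ m : ℤ, (σ ^ m) (P.root j) = P.root i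

/-- The partial product `c σ(c) ⋯ σ^{i-1}(c)`, where `σ` acts on the Weyl group by conjugation. -/
def partialProd (σ c : X ≃ₗ[ℤ] X) (i : ℕ) : X ≃ₗ[ℤ] X :=
  ((List.range i).map fun j => σ ^ j * c * (σ ^ j)⁻¹).prod

/-- The order of an automorphism of the root datum, acting on the roots. For `τ = wσ` with `W`
irreducible and `w` twisted Coxeter, this is the Coxeter number of `(W, σ)`. -/
def orderOnRoots (P : RootPairing ι ℤ X Y) (τ : X ≃ₗ[ℤ] X) : ℕ :=
  sInf {m | 0 < m ∧ ∀ i, (τ ^ m) (P.root i) = P.root i}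

/-- The Dynkin diagram of `Δ` is non-empty and connected. -/
def IsConnectedDynkin (Δ : P.Base) : Prop :=
  Δ.support.Nonempty ∧ ∀ S ⊆ Δ.support, S.Nonempty → S ≠ Δ.support →
    ∃ i ∈ S, ∃ j ∈ Δ.support, j ∉ S ∧ P.pairing i j ≠ 0

/-- The fundamental coweight `α*`, for `α ∈ Δ`. It is an element of the cocharacter group
`Hom(ℤΦ, ℤ)` of the adjoint torus; these elements form the basis dual to `Δ`. -/
def fundCoweight (Δ : P.Base) (α : Δ.support) : P.rootSpan ℤ →ₗ[ℤ] ℤ :=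
  Δ.toWeightBasisInt.coord α

/-- `i₀` is the highest root: its difference with any root is a sum of simple roots. -/
def IsHighestRoot (Δ : P.Base) (i₀ : ι) : Prop :=
  ∀ j, P.root i₀ - P.root j ∈ AddSubmonoid.closure (P.root '' Δ.support)

/-- `M = max_{α ∈ Δ} ⟨α₀, α*⟩`, where `α₀` is the root with index `i₀`. -/
def maxMark (Δ : P.Base) (i₀ : ι) : ℤ :=
  ⨆ α : Δ.support, fundCoweight Δ α (P.rootSpanMem ℤ i₀)

/-- `ν ∈ Y = X_*(T)` is a non-zero integral multiple `m` of a lift to `X_*(T)_ℚ` of the fundamental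
coweight `α*`. -/
def IsCoweightLift (Δ : P.Base) (α : Δ.support) (ν : Y) : Prop :=
  ∃ m : ℤ, m ≠ 0 ∧ ∀ x : P.rootSpan ℤ, P.toLinearMap (x : X) ν = m * fundCoweight Δ α x

end RootData

/-! ## The torus `T₁` over the residue field -/

section SpecialFibre

variable (X : Type*) [AddCommGroup X] (κ : Type*) [Field κ]

/-- The (points of the) torus over the algebraically closed field `κ` with character group `X`. -/
abbrev TorusPts : Type _ := Multiplicative X →* κˣ

variable {X κ}

/-- The Zariski topology: the basic open sets are the non-vanishing loci of the regular functions
`∑ₓ fₓ·x`, the linear combinations of characters `x ∈ X`. -/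
abbrev zariski (X : Type*) [AddCommGroup X] (κ : Type*) [Field κ] : TopologicalSpace (TorusPts X κ) :=
  TopologicalSpace.generateFrom
    {U | ∃ f : X →₀ κ,
      U = {t | (f.sum fun x a => a * (t (Multiplicative.ofAdd x) : κ)) ≠ 0}}

/-- The identity component, for the Zariski topology, of a subset `H` that contains `1`. -/
def idComponent (H : Set (TorusPts X κ)) : Set (TorusPts X κ) :=
  @connectedComponentIn _ (zariski X κ) H 1

/-- The kernel of the character `x`. -/
def kerChar (x : X) : Set (TorusPts X κ) := {t | t (Multiplicative.ofAdd x) = 1}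

/-- The geometric Frobenius of the torus, for the `𝔽_q`-structure on which the Frobenius acts on
characters through `τ`: the character `x` takes at `frob q τ t` the value `((τ x)(t))^q`. -/
def frob (q : ℕ) (τ : X ≃ₗ[ℤ] X) (t : TorusPts X κ) : TorusPts X κ :=
  (t ^ q).comp (AddMonoidHom.toMultiplicative (τ : X →ₗ[ℤ] X).toAddMonoidHom)

variable {ι Y : Type*} [AddCommGroup Y]

/-- The image of the cocharacter `ν ∈ Y`: the points `x ↦ z^⟨x,ν⟩` with `z ∈ κˣ`. -/
def cocharImage (P : RootPairing ι ℤ X Y) (ν : Y) : Set (TorusPts X κ) :=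
  {t | ∃ z : κˣ, ∀ x : X, t (Multiplicative.ofAdd x) = z ^ (P.toLinearMap x ν)}

/-- `H_ν`, the preimage of the image of the cocharacter `ν` under the Lang map `t ↦ t⁻¹F(t)`. -/
def langPreimage (P : RootPairing ι ℤ X Y) (q : ℕ) (τ : X ≃ₗ[ℤ] X) (ν : Y) : Set (TorusPts X κ) :=
  {t | t⁻¹ * frob q τ t ∈ cocharImage P ν}

end SpecialFibre

/-! ## The root datum of a group with a torus, Frobenius, Coxeter pairs -/

section CoxeterPairs

variable {n : ℕ} {Ω : Type*} [Field Ω] {ι X Y : Type*} [AddCommGroup X] [AddCommGroup Y]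

/-- The element `g`, assumed to normalize `T`, acts on `X = X^*(T)` as `w`:
`(w x)(t) = x(g⁻¹ t g)`. -/
def ActsAs {T : Subgroup (GL (Fin n) Ω)} (ch : Multiplicative X →* (T →* Ωˣ)) (g : GL (Fin n) Ω)
    (w : X ≃ₗ[ℤ] X) : Prop :=
  ∀ (x : X) (t t' : T), (t' : GL (Fin n) Ω) = g⁻¹ * t * g →
    ch (Multiplicative.ofAdd (w x)) t = ch (Multiplicative.ofAdd x) t'

/-- `P` is the root datum of `(G, T)`. The map `ch` identifies `X` with the character group `X^*(T)`
(so that `Y`, being in perfect duality with `X`, is `X_*(T)`), the roots are the non-trivial weights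
of `T` on the Lie algebra of `G`, and the Weyl group is `N_G(T)/T` acting on `X^*(T)`; the last
condition determines the coroots. -/
structure IsRootDatumOf (G T : Subgroup (GL (Fin n) Ω)) (P : RootPairing ι ℤ X Y)
    (ch : Multiplicative X →* (T →* Ωˣ)) : Prop where
  reduced : P.IsReduced
  injective : Function.Injective ch
  range : ∀ χ : T →* Ωˣ, IsAlgebraicCharacter χ ↔ ∃ x, ch x = χ
  roots : ∀ x : X, x ∈ Set.range P.root ↔ IsWeight G (ch (Multiplicative.ofAdd x))
  weyl_of_normalizer : ∀ g ∈ G, T.map (MulAut.conj g).toMonoidHom = T →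
    ∃ w ∈ weyl P, ActsAs ch g w
  normalizer_of_weyl : ∀ w ∈ weyl P, ∃ g ∈ G, T.map (MulAut.conj g).toMonoidHom = T ∧ ActsAs ch g w

/-- The base `Δ` is the set of simple roots determined by the Borel subgroup `B ⊇ T`: the
`Δ`-positive roots are the roots of `T` in `B`. -/
def IsBaseOf (B : Subgroup (GL (Fin n) Ω)) {T : Subgroup (GL (Fin n) Ω)} {P : RootPairing ι ℤ X Y}
    (ch : Multiplicative X →* (T →* Ωˣ)) (Δ : P.Base) : Prop :=
  ∀ i, Δ.IsPos i ↔ IsWeight B (ch (Multiplicative.ofAdd (P.root i)))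

/-- The Frobenius `F` on `GL_n`, applying the field automorphism `Fr` to the matrix entries. -/
def frobGL {k : Type*} [Field k] [Algebra k Ω] (Fr : Ω ≃ₐ[k] Ω) : GL (Fin n) Ω →* GL (Fin n) Ω :=
  Matrix.GeneralLinearGroup.map (Fr : Ω →+* Ω)

/-- `τ` is the automorphism of `X = X^*(T)` induced by the Frobenius `F` on the torus `T`:
`x(F(t)) = Fr((τ x)(t))`. -/
def IsFrobAction {k : Type*} [Field k] [Algebra k Ω] (Fr : Ω ≃ₐ[k] Ω)
    {T : Subgroup (GL (Fin n) Ω)} (ch : Multiplicative X →* (T →* Ωˣ)) (τ : X ≃ₗ[ℤ] X) : Prop :=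
  ∀ (x : X) (t t' : T), (t' : GL (Fin n) Ω) = frobGL Fr t →
    (ch (Multiplicative.ofAdd x) t' : Ω) = Fr (ch (Multiplicative.ofAdd (τ x)) t : Ω)

/-- `(T, B)` is a Coxeter pair in `G`. There are a `k`-rational maximal torus `T₀` and a `k`-rational
Borel subgroup `B₀ ⊇ T₀` of `G`, and a `K`-rational `g ∈ G` with `ᵍ(T₀, B₀) = (T, B)`, such that the
image of `g⁻¹F(g)` in the Weyl group of `T₀` is a twisted Coxeter element. Everything is transported
from `T₀` to `T` by `g`: the element `g⁻¹F(g)` becomes `F(g)g⁻¹`, which acts on `X^*(T)` as some `w`,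
and the action of `F` on `X^*(T₀)` becomes `τw`, where `τ` is the action of `F` on `X^*(T)`. -/
def IsCoxeterPair (k K : Type*) [Field k] [Field K] [Algebra k Ω] [Algebra K Ω] (Fr : Ω ≃ₐ[k] Ω)
    (G T B : Subgroup (GL (Fin n) Ω)) {P : RootPairing ι ℤ X Y}
    (ch : Multiplicative X →* (T →* Ωˣ)) (τ : X ≃ₗ[ℤ] X) (Δ : P.Base) : Prop :=
  ∃ (T₀ B₀ : Subgroup (GL (Fin n) Ω)) (gK : GL (Fin n) K) (g : GL (Fin n) Ω) (w : X ≃ₗ[ℤ] X),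
    IsMaximalTorus T₀ G ∧ IsDefinedOver k T₀ ∧
    IsBorel B₀ G ∧ IsDefinedOver k B₀ ∧ T₀ ≤ B₀ ∧
    g = Matrix.GeneralLinearGroup.map (algebraMap K Ω) gK ∧ g ∈ G ∧
    T₀.map (MulAut.conj g).toMonoidHom = T ∧ B₀.map (MulAut.conj g).toMonoidHom = B ∧
    ActsAs ch (frobGL Fr g * g⁻¹) w ∧ IsTwistedCoxeter Δ (τ * w) w

end CoxeterPairs

end CoxeterTorus

end

/-!
The Frobenius acts on `X` as `τ = w σ` with `w σ` a twisted Coxeter element, up to the factor `q`.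

For (i), let `h` be the order of `τ` on the roots. Two facts hold for a twisted Coxeter element: the
`τ`-orbit of every root involves every simple root, and along a `τ`-orbit the roots turn from
positive to negative only once per period. By the second fact the height form has a non-zero first
Fourier coefficient along each orbit, so projecting it to the eigenvalues `exp (± 2πi/h)` of `τ`
gives a form that, after a generic rotation, vanishes on no root. Its values along each orbit sample
a sinusoid of period `h`. Its positive roots are those of a new base `Δ`, for which `τ = c σ` is
again twisted Coxeter, and since a sinusoid is negative on half of each period, no root is made
negative twice within the first `h/2` steps: the lengths of the partial products add up.

For (ii), given `ν` over `m α*`, solve `q ψ(τ x) - ψ(x) = e ⟨x, ν⟩` for a linear form `ψ` on `X` and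
some `e ≠ 0`. The curve `z ↦ (x ↦ z ^ ψ(x))` lies in the identity component of `H_ν`, so it suffices
that `ψ(γ) ≠ 0` for all roots `γ`. If `ψ(γ) = 0`, then the equation along the `τ`-orbit of `γ`, read
modulo powers of `q`, and the bound `|⟨τᵏ γ, α*⟩| ≤ M < q` force `⟨τᵏ γ, α*⟩ = 0` for all `k`,
contrary to the fact that the orbit of `γ` involves `α`.
-/

noncomputable section

namespace CoxeterTorus

open RootPairing

/-! ### Automorphisms of a root datum and words in the reflections -/

section Automorphisms

variable {ι X Y : Type*} [AddCommGroup X] [AddCommGroup Y] {P : RootPairing ι ℤ X Y}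

lemma root_smul (g : P.Aut) (i : ι) : P.root (g • i) = g • P.root i :=
  Equiv.root_indexEquiv_eq_smul P i g

lemma coroot'_smul (g : P.Aut) (i : ι) (x : X) : P.coroot' (g • i) (g • x) = P.coroot' i x := by
  have htranspose := Hom.weight_coweight_transpose_apply P P (P.coroot (g • i)) g.toHom
  have hcoroot := Hom.coroot_coweightMap_apply P P (g • i) g.toHom
  rw [show g.toHom.indexEquiv.symm (g • i) = i from g.toHom.indexEquiv.symm_apply_apply i]
    at hcoroot
  rw [hcoroot] at htranspose
  exact LinearMap.congr_fun htranspose x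

lemma pairing_smul (g : P.Aut) (i j : ι) : P.pairing (g • i) (g • j) = P.pairing i j := by
  rw [← root_coroot'_eq_pairing, ← root_coroot'_eq_pairing, root_smul, coroot'_smul]

lemma reflection_smul_eq_sub (i : ι) (x : X) :
    Equiv.reflection P i • x = x - P.coroot' i x • P.root i := rfl

lemma reflection_mul_self (i : ι) : Equiv.reflection P i * Equiv.reflection P i = 1 := by
  rw [mul_eq_one_iff_eq_inv, Equiv.reflection_inv]

lemma reflection_smul_smul (i j : ι) : Equiv.reflection P i • Equiv.reflection P i • j = j := by
  rw [smul_smul, reflection_mul_self, one_smul]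

lemma aut_ext {g h : P.Aut} (hgh : ∀ x : X, g • x = h • x) : g = h :=
  Equiv.weightHom_injective P (LinearEquiv.ext hgh)

lemma reflection_smul_index (g : P.Aut) (i : ι) :
    Equiv.reflection P (g • i) = g * Equiv.reflection P i * g⁻¹ := by
  apply aut_ext
  intro x
  have hcoroot : P.coroot' (g • i) x = P.coroot' i (g⁻¹ • x) := by
    rw [← coroot'_smul g i, smul_inv_smul]
  rw [mul_smul, mul_smul, reflection_smul_eq_sub, reflection_smul_eq_sub, smul_sub, smul_inv_smul,
    root_smul, hcoroot, smul_comm]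

lemma mul_reflection (g : P.Aut) (i : ι) :
    g * Equiv.reflection P i = Equiv.reflection P (g • i) * g := by
  rw [reflection_smul_index, inv_mul_cancel_right]

lemma weightHom_root (g : P.Aut) (i : ι) : Equiv.weightHom P g (P.root i) = P.root (g • i) :=
  (root_smul g i).symm

lemma weightHom_mem_weyl {w : P.Aut} (hw : w ∈ P.weylGroup) : Equiv.weightHom P w ∈ weyl P := by
  rw [weyl, ← range_weylGroup_weightHom]
  exact ⟨⟨w, hw⟩, rfl⟩

lemma conj_mem_weylGroup (g : P.Aut) {w : P.Aut} (hw : w ∈ P.weylGroup) :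
    g * w * g⁻¹ ∈ P.weylGroup := by
  induction hw using weylGroup.induction with
  | mem i => exact reflection_smul_index g i ▸ P.reflection_mem_weylGroup (g • i)
  | one => simp
  | mul x y _ _ hx hy => simpa only [conj_mul] using mul_mem hx hy

end Automorphisms

section RootLattice

variable {ι X Y : Type*} [AddCommGroup X] [AddCommGroup Y] {P : RootPairing ι ℤ X Y}

lemma smul_mem_rootSpan (g : P.Aut) {x : X} (hx : x ∈ P.rootSpan ℤ) : g • x ∈ P.rootSpan ℤ := by
  induction hx using Submodule.span_induction with
  | mem x hx =>
    obtain ⟨i, rfl⟩ := hx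
    exact root_smul g i ▸ Submodule.subset_span ⟨_, rfl⟩
  | zero => rw [smul_zero]; exact zero_mem _
  | add x y _ _ hx hy => rw [smul_add]; exact add_mem hx hy
  | smul a x _ hx => rw [smul_comm]; exact Submodule.smul_mem _ a hx

/-- The action of the automorphism group of a root datum on its root lattice. -/
instance rootSpanAction : DistribMulAction P.Aut (P.rootSpan ℤ) where
  smul g x := ⟨g • (x : X), smul_mem_rootSpan g x.2⟩
  one_smul _ := Subtype.ext (one_smul _ _)
  mul_smul _ _ _ := Subtype.ext (mul_smul _ _ _)
  smul_zero _ := Subtype.ext (smul_zero _)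
  smul_add _ _ _ := Subtype.ext (smul_add _ _ _)

lemma coe_smul (g : P.Aut) (x : P.rootSpan ℤ) : ((g • x : P.rootSpan ℤ) : X) = g • (x : X) := rfl

/-- The root with index `i`, as an element of the root lattice. -/
abbrev spanRoot (P : RootPairing ι ℤ X Y) (i : ι) : P.rootSpan ℤ := P.rootSpanMem ℤ i

lemma spanRoot_smul (g : P.Aut) (i : ι) : spanRoot P (g • i) = g • spanRoot P i :=
  Subtype.ext (root_smul g i)

lemma spanRoot_ne_zero (i : ι) : spanRoot P i ≠ 0 :=
  fun h ↦ P.ne_zero i (congrArg Subtype.val h)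

lemma reflection_smul_span (i : ι) (x : P.rootSpan ℤ) :
    Equiv.reflection P i • x = x - P.coroot' i x • spanRoot P i := Subtype.ext rfl

lemma spanRoot_reflection_self (i : ι) :
    spanRoot P (Equiv.reflection P i • i) = -spanRoot P i :=
  P.rootSpanMem_reflectionPerm_self ℤ i

/-- The action of an automorphism of a root datum on the root lattice, as a linear map. -/
abbrev spanMap (g : P.Aut) : P.rootSpan ℤ →ₗ[ℤ] P.rootSpan ℤ :=
  DistribSMul.toLinearMap ℤ (P.rootSpan ℤ) g

lemma hom_ext_spanRoot {A : Type*} [AddCommGroup A] {φ ψ : P.rootSpan ℤ →ₗ[ℤ] A}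
    (h : ∀ i, φ (spanRoot P i) = ψ (spanRoot P i)) : φ = ψ := by
  refine LinearMap.ext_on (Submodule.span_span_coe_preimage (s := Set.range P.root)) ?_
  rintro x ⟨i, hi⟩
  rw [show x = spanRoot P i from Subtype.ext hi.symm, h i]

lemma eq_zero_of_coroot'_eq_zero [Finite ι] (Δ : P.Base) {x : P.rootSpan ℤ}
    (h : ∀ i ∈ Δ.support, P.coroot' i x = 0) : x = 0 := by
  cases nonempty_fintype ι
  have hspan : Submodule.span ℤ (P.coroot '' Δ.support) ≤
      LinearMap.ker (P.toLinearMap.flip.flip (x : X)) := by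
    rw [Submodule.span_le]
    rintro _ ⟨i, hi, rfl⟩
    exact h i hi
  have hcoroot (i : ι) : P.coroot' i (x : X) = 0 := hspan (Δ.coroot_mem_span_int i)
  apply Subtype.ext
  apply P.eq_zero_of_mem_rootSpan_of_rootForm_self_eq_zero x.2
  rw [rootForm_apply_apply]
  exact Finset.sum_eq_zero fun i _ ↦ by rw [hcoroot i, zero_mul]

end RootLattice

section SimpleRoots

variable {ι X Y : Type*} [AddCommGroup X] [AddCommGroup Y] {P : RootPairing ι ℤ X Y} (Δ : P.Base)

lemma toWeightBasisInt_eq_spanRoot (α : Δ.support) : Δ.toWeightBasisInt α = spanRoot P α :=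
  Subtype.ext (Δ.coe_toWeightBasisInt_apply α)

lemma fundCoweight_self (α : Δ.support) : fundCoweight Δ α (spanRoot P α) = 1 := by
  rw [← toWeightBasisInt_eq_spanRoot, fundCoweight, Module.Basis.coord_apply,
    Module.Basis.repr_self, Finsupp.single_eq_same]

lemma fundCoweight_ne {α β : Δ.support} (h : α ≠ β) : fundCoweight Δ α (spanRoot P β) = 0 := by
  rw [← toWeightBasisInt_eq_spanRoot, fundCoweight, Module.Basis.coord_apply,
    Module.Basis.repr_self, Finsupp.single_eq_of_ne h]

open Classical in
lemma fundCoweight_simple (α β : Δ.support) :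
    fundCoweight Δ α (spanRoot P β) = if α = β then 1 else 0 := by
  split_ifs with h
  · exact h ▸ fundCoweight_self Δ α
  · exact fundCoweight_ne Δ h

lemma sum_fundCoweight (x : P.rootSpan ℤ) :
    ∑ α : Δ.support, fundCoweight Δ α x • spanRoot P α = x := by
  simp_rw [← toWeightBasisInt_eq_spanRoot]
  exact Δ.toWeightBasisInt.sum_repr x

lemma eq_of_fundCoweight {x y : P.rootSpan ℤ} (h : ∀ α, fundCoweight Δ α x = fundCoweight Δ α y) :
    x = y := by
  rw [← sum_fundCoweight Δ x, ← sum_fundCoweight Δ y]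
  simp_rw [h]

lemma hom_ext_simple {A : Type*} [AddCommGroup A] {φ ψ : P.rootSpan ℤ →ₗ[ℤ] A}
    (h : ∀ i ∈ Δ.support, φ (spanRoot P i) = ψ (spanRoot P i)) : φ = ψ :=
  Δ.toWeightBasisInt.ext fun α ↦ by rw [toWeightBasisInt_eq_spanRoot]; exact h α α.2

/-- The height, as a linear form on the root lattice: the sum of the coefficients with respect to
the simple roots. -/
def heightForm : P.rootSpan ℤ →ₗ[ℤ] ℤ := ∑ α : Δ.support, fundCoweight Δ α

lemma heightForm_apply (x : P.rootSpan ℤ) :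
    heightForm Δ x = ∑ α : Δ.support, fundCoweight Δ α x := by
  rw [heightForm, LinearMap.sum_apply]

lemma heightForm_spanRoot (i : ι) : heightForm Δ (spanRoot P i) = Δ.height i := by
  classical
  let f (j : ι) : ℤ := if hj : j ∈ Δ.support then fundCoweight Δ ⟨j, hj⟩ (spanRoot P i) else 0
  have hf (α : Δ.support) : f α = fundCoweight Δ α (spanRoot P i) := by simp [f]
  have hroot : P.root i = ∑ j ∈ Δ.support, f j • P.root j := by
    have h := congrArg Subtype.val (sum_fundCoweight Δ (spanRoot P i))
    rw [Submodule.coe_sum] at h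
    rw [← Finset.sum_coe_sort Δ.support (fun j ↦ f j • P.root j)]
    exact h.symm.trans (Finset.sum_congr rfl fun α _ ↦ by rw [hf α]; rfl)
  rw [Base.height_eq_sum hroot, heightForm_apply, ← Finset.sum_coe_sort Δ.support f]
  exact Finset.sum_congr rfl fun α _ ↦ (hf α).symm

lemma isPos_iff_heightForm {i : ι} : Δ.IsPos i ↔ 0 < heightForm Δ (spanRoot P i) := by
  rw [heightForm_spanRoot, Base.isPos_iff]

lemma not_isPos_iff_heightForm {i : ι} : ¬ Δ.IsPos i ↔ heightForm Δ (spanRoot P i) < 0 := by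
  rw [isPos_iff_heightForm, heightForm_spanRoot]
  have := Δ.height_ne_zero i
  lia

lemma mem_closure_root_iff {x : P.rootSpan ℤ} :
    (x : X) ∈ AddSubmonoid.closure (P.root '' Δ.support) ↔ ∀ α, 0 ≤ fundCoweight Δ α x := by
  constructor
  · intro hx α
    have himage : P.root '' Δ.support =
        (P.rootSpan ℤ).subtype.toAddMonoidHom '' (spanRoot P '' Δ.support) := by
      rw [Set.image_image]
      rfl
    rw [himage, ← AddMonoidHom.map_mclosure] at hx
    obtain ⟨y, hy, hyx⟩ := hx
    obtain rfl : y = x := Subtype.ext hyx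
    suffices AddSubmonoid.closure (spanRoot P '' Δ.support) ≤
        (AddSubmonoid.nonneg ℤ).comap (fundCoweight Δ α).toAddMonoidHom from this hy
    rw [AddSubmonoid.closure_le]
    rintro _ ⟨β, hβ, rfl⟩
    change 0 ≤ fundCoweight Δ α (spanRoot P (⟨β, hβ⟩ : Δ.support))
    rw [fundCoweight_simple]
    split_ifs <;> simp
  · intro hx
    rw [← sum_fundCoweight Δ x, Submodule.coe_sum]
    refine sum_mem fun α _ ↦ ?_
    lift fundCoweight Δ α x to ℕ using hx α with m
    rw [natCast_zsmul]
    exact nsmul_mem (AddSubmonoid.subset_closure (Set.mem_image_of_mem _ α.2)) m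

lemma fundCoweight_sign (i : ι) : (∀ α, 0 ≤ fundCoweight Δ α (spanRoot P i)) ∨
    (∀ α, fundCoweight Δ α (spanRoot P i) ≤ 0) := by
  refine (Δ.root_mem_or_neg_mem i).imp (mem_closure_root_iff Δ (x := spanRoot P i)).mp fun h α ↦ ?_
  have := (mem_closure_root_iff Δ (x := -spanRoot P i)).mp h α
  rwa [map_neg, Left.nonneg_neg_iff] at this

lemma exists_fundCoweight_ne_zero (i : ι) : ∃ α, fundCoweight Δ α (spanRoot P i) ≠ 0 := by
  by_contra! h
  exact spanRoot_ne_zero i (eq_of_fundCoweight Δ fun α ↦ by rw [h α, map_zero])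

lemma isPos_iff_exists_fundCoweight_pos {i : ι} :
    Δ.IsPos i ↔ ∃ α, 0 < fundCoweight Δ α (spanRoot P i) := by
  rw [isPos_iff_heightForm, heightForm_apply]
  constructor
  · intro h
    by_contra! hle
    exact absurd h (not_lt.mpr (Finset.sum_nonpos fun α _ ↦ hle α))
  · rintro ⟨α, hα⟩
    rcases fundCoweight_sign Δ i with h | h
    · exact Finset.sum_pos' (fun β _ ↦ h β) ⟨α, Finset.mem_univ _, hα⟩
    · exact absurd hα (not_lt.mpr (h α))

variable {Δ} in
lemma fundCoweight_nonneg_of_isPos {i : ι} (h : Δ.IsPos i) (α : Δ.support) :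
    0 ≤ fundCoweight Δ α (spanRoot P i) := by
  rcases fundCoweight_sign Δ i with hsign | hsign
  · exact hsign α
  · obtain ⟨β, hβ⟩ := (isPos_iff_exists_fundCoweight_pos Δ).mp h
    exact absurd hβ (not_lt.mpr (hsign β))

lemma isPos_reflection_self (i : ι) : Δ.IsPos (Equiv.reflection P i • i) ↔ ¬ Δ.IsPos i :=
  Base.IsPos.neg_iff_not Δ i

section Positivity

variable {Δ} {A : Type*} [AddCommGroup A]

lemma apply_nonneg_of_isPos [PartialOrder A] [IsOrderedAddMonoid A] {φ : P.rootSpan ℤ →ₗ[ℤ] A}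
    (hφ : ∀ j ∈ Δ.support, 0 ≤ φ (spanRoot P j)) {i : ι} (hi : Δ.IsPos i) :
    0 ≤ φ (spanRoot P i) := by
  rw [← sum_fundCoweight Δ (spanRoot P i), map_sum]
  refine Finset.sum_nonneg fun α _ ↦ ?_
  rw [map_zsmul]
  exact zsmul_nonneg (hφ α α.2) (fundCoweight_nonneg_of_isPos hi α)

variable [LinearOrder A] [IsOrderedAddMonoid A]

lemma apply_pos_of_isPos {φ : P.rootSpan ℤ →ₗ[ℤ] A}
    (hφ : ∀ j ∈ Δ.support, 0 < φ (spanRoot P j)) {i : ι} (hi : Δ.IsPos i) :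
    0 < φ (spanRoot P i) := by
  obtain ⟨α, hα⟩ := (isPos_iff_exists_fundCoweight_pos Δ).mp hi
  rw [← sum_fundCoweight Δ (spanRoot P i), map_sum]
  refine Finset.sum_pos' (fun β _ ↦ ?_) ⟨α, Finset.mem_univ α, ?_⟩
  · rw [map_zsmul]
    exact zsmul_nonneg (hφ β β.2).le (fundCoweight_nonneg_of_isPos hi β)
  · rw [map_zsmul]
    exact zsmul_pos (hφ α α.2) hα

lemma isPos_iff_apply_pos {φ : P.rootSpan ℤ →ₗ[ℤ] A}
    (hφ : ∀ j ∈ Δ.support, 0 < φ (spanRoot P j)) {i : ι} : Δ.IsPos i ↔ 0 < φ (spanRoot P i) := by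
  refine ⟨apply_pos_of_isPos hφ, fun hi ↦ ?_⟩
  by_contra hneg
  have := apply_pos_of_isPos hφ ((isPos_reflection_self Δ i).mpr hneg)
  rw [spanRoot_reflection_self, map_neg, Left.neg_pos_iff] at this
  exact this.not_gt hi

lemma isPos_smul_iff {Δ' : P.Base} {g : P.Aut} (hg : ∀ j ∈ Δ.support, Δ'.IsPos (g • j)) {i : ι} :
    Δ'.IsPos (g • i) ↔ Δ.IsPos i := by
  rw [isPos_iff_heightForm, spanRoot_smul,
    isPos_iff_apply_pos (Δ := Δ) (φ := heightForm Δ' ∘ₗ spanMap g) fun j hj ↦ ?_]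
  · rfl
  · have := (isPos_iff_heightForm Δ').mp (hg j hj)
    rwa [spanRoot_smul] at this

end Positivity

lemma fundCoweight_smul {Δ Δ' : P.Base} {g : P.Aut}
    (hg : ∀ i, g • i ∈ Δ'.support ↔ i ∈ Δ.support) (α : Δ.support) (x : P.rootSpan ℤ) :
    fundCoweight Δ' ⟨g • (α : ι), (hg α).mpr α.2⟩ (g • x) = fundCoweight Δ α x := by
  classical
  suffices fundCoweight Δ' ⟨g • (α : ι), (hg α).mpr α.2⟩ ∘ₗ spanMap g = fundCoweight Δ α from
    LinearMap.congr_fun this x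
  refine hom_ext_simple Δ fun i hi ↦ ?_
  have hgi := fundCoweight_simple Δ' ⟨g • (α : ι), (hg α).mpr α.2⟩ ⟨g • i, (hg i).mpr hi⟩
  rw [LinearMap.comp_apply, DistribSMul.toLinearMap_apply, ← spanRoot_smul, hgi,
    fundCoweight_simple Δ α ⟨i, hi⟩]
  simp only [Subtype.ext_iff, smul_left_cancel_iff]

end SimpleRoots

section Words

variable {ι X Y : Type*} [AddCommGroup X] [AddCommGroup Y] {P : RootPairing ι ℤ X Y}

/-- The product of the reflections in the letters of a word, as an automorphism of the root
datum. -/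
def wordProd (P : RootPairing ι ℤ X Y) (l : List ι) : P.Aut := (l.map (Equiv.reflection P)).prod

@[simp] lemma wordProd_nil : wordProd P [] = 1 := rfl

@[simp] lemma wordProd_cons (i : ι) (l : List ι) :
    wordProd P (i :: l) = Equiv.reflection P i * wordProd P l := by
  simp [wordProd]

@[simp] lemma wordProd_append (l m : List ι) :
    wordProd P (l ++ m) = wordProd P l * wordProd P m := by
  simp [wordProd]

lemma wordProd_reverse (l : List ι) : wordProd P l.reverse = (wordProd P l)⁻¹ := by
  induction l with
  | nil => simp
  | cons i l ih =>
    rw [List.reverse_cons, wordProd_append, ih, wordProd_cons, wordProd_cons, wordProd_nil,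
      mul_one, mul_inv_rev, Equiv.reflection_inv]

lemma wordProd_map_smul (g : P.Aut) (l : List ι) :
    wordProd P (l.map (g • ·)) = g * wordProd P l * g⁻¹ := by
  induction l with
  | nil => simp
  | cons i l ih => rw [List.map_cons, wordProd_cons, wordProd_cons, ih, reflection_smul_index,
      conj_mul]

lemma wordProd_mem (l : List ι) : wordProd P l ∈ P.weylGroup :=
  Subgroup.list_prod_mem _ <| List.forall_mem_map.mpr fun i _ ↦ P.reflection_mem_weylGroup i

lemma weightHom_wordProd (l : List ι) :
    Equiv.weightHom P (wordProd P l) = (l.map P.reflection).prod := by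
  rw [wordProd, map_list_prod, List.map_map]
  congr 2
  exact funext (Equiv.reflection_weightEquiv P)

variable [Finite ι] [P.IsReduced]

lemma closure_simple_reflections (Δ : P.Base) :
    Subgroup.closure (Equiv.reflection P '' Δ.support) = P.weylGroup := by
  refine le_antisymm ((Subgroup.closure_le _).mpr ?_) ((Subgroup.closure_le _).mpr ?_)
  · rintro _ ⟨i, _, rfl⟩
    exact P.reflection_mem_weylGroup i
  · rintro _ ⟨i, rfl⟩
    set S := Subgroup.closure (Equiv.reflection P '' Δ.support)
    have hsimple (j : ι) (hj : j ∈ Δ.support) : Equiv.reflection P j ∈ S :=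
      Subgroup.subset_closure (Set.mem_image_of_mem _ hj)
    have hconj (i j : ι) : Equiv.reflection P (P.reflectionPerm j i) =
        Equiv.reflection P j * Equiv.reflection P i * (Equiv.reflection P j)⁻¹ :=
      reflection_smul_index (Equiv.reflection P j) i
    refine Δ.induction_reflect i (fun i hi ↦ ?_) hsimple (fun i j hi hj ↦ ?_)
    · rw [hconj]
      exact mul_mem (mul_mem hi hi) (inv_mem hi)
    · rw [hconj]
      exact mul_mem (mul_mem (hsimple j hj) hi) (inv_mem (hsimple j hj))

lemma exists_word (Δ : P.Base) {w : P.Aut} (hw : w ∈ P.weylGroup) :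
    ∃ l : List ι, (∀ i ∈ l, i ∈ Δ.support) ∧ wordProd P l = w := by
  rw [← closure_simple_reflections Δ] at hw
  induction hw using Subgroup.closure_induction with
  | mem w hw =>
    obtain ⟨i, hi, rfl⟩ := hw
    exact ⟨[i], by simpa using hi, by simp⟩
  | one => exact ⟨[], by simp, wordProd_nil⟩
  | mul v w _ _ hv hw =>
    obtain ⟨l, hl, rfl⟩ := hv
    obtain ⟨m, hm, rfl⟩ := hw
    exact ⟨l ++ m, List.forall_mem_append.mpr ⟨hl, hm⟩, wordProd_append l m⟩
  | inv w _ hw =>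
    obtain ⟨l, hl, rfl⟩ := hw
    exact ⟨l.reverse, fun i hi ↦ hl i (List.mem_reverse.mp hi), wordProd_reverse l⟩

end Words

section Inversions

variable {ι X Y : Type*} [AddCommGroup X] [AddCommGroup Y] {P : RootPairing ι ℤ X Y} (Δ : P.Base)

/-- The inversion set of `g`: the positive roots that `g` makes negative. -/
def inversions (g : P.Aut) : Set ι := {i | Δ.IsPos i ∧ ¬ Δ.IsPos (g • i)}

lemma mem_inversions {g : P.Aut} {i : ι} :
    i ∈ inversions Δ g ↔ Δ.IsPos i ∧ ¬ Δ.IsPos (g • i) := Iff.rfl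

lemma inversions_one : inversions Δ (1 : P.Aut) = ∅ := by
  ext i
  simp [mem_inversions]

lemma exists_simple_mem_inversions {g : P.Aut} (hg : (inversions Δ g).Nonempty) :
    ∃ j ∈ Δ.support, ¬ Δ.IsPos (g • j) := by
  obtain ⟨i, hi, hgi⟩ := hg
  by_contra! h
  exact hgi ((isPos_smul_iff h).mpr hi)

variable [Finite ι] [P.IsReduced]

lemma inversions_mul_reflection {g : P.Aut} {j : ι} (hj : j ∈ Δ.support) (h : Δ.IsPos (g • j)) :
    inversions Δ (g * Equiv.reflection P j) =
      insert j ((Equiv.reflection P j • ·) '' inversions Δ g) := by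
  have hjpos : Δ.IsPos j := Base.isPos_of_mem_support hj
  ext i
  simp only [mem_inversions, Set.mem_insert_iff, Set.mem_image, mul_smul]
  constructor
  · rintro ⟨hi, hgi⟩
    refine or_iff_not_imp_left.mpr fun hij ↦ ?_
    exact ⟨Equiv.reflection P j • i, ⟨hi.reflectionPerm hj hij, hgi⟩, reflection_smul_smul _ _⟩
  · rintro (rfl | ⟨k, ⟨hk, hgk⟩, rfl⟩)
    · refine ⟨hjpos, ?_⟩
      rwa [← mul_smul, mul_reflection, mul_smul, isPos_reflection_self, not_not]
    · have hkj : k ≠ j := fun hkj ↦ hgk (hkj ▸ h)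
      exact ⟨hk.reflectionPerm hj hkj, by rwa [reflection_smul_smul]⟩

lemma ncard_inversions_mul_reflection_of_isPos {g : P.Aut} {j : ι} (hj : j ∈ Δ.support)
    (h : Δ.IsPos (g • j)) :
    (inversions Δ (g * Equiv.reflection P j)).ncard = (inversions Δ g).ncard + 1 := by
  rw [inversions_mul_reflection Δ hj h, Set.ncard_insert_of_notMem,
    Set.ncard_image_of_injective _ (MulAction.injective _)]
  rintro ⟨k, ⟨hk, -⟩, hkj⟩
  obtain rfl : k = Equiv.reflection P j • j := by
    rw [← reflection_smul_smul (P := P) j k]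
    exact congrArg (Equiv.reflection P j • ·) hkj
  exact (isPos_reflection_self Δ j).mp hk (Base.isPos_of_mem_support hj)

lemma ncard_inversions_mul_reflection_of_not_isPos {g : P.Aut} {j : ι} (hj : j ∈ Δ.support)
    (h : ¬ Δ.IsPos (g • j)) :
    (inversions Δ (g * Equiv.reflection P j)).ncard + 1 = (inversions Δ g).ncard := by
  have hpos : Δ.IsPos ((g * Equiv.reflection P j) • j) := by
    rwa [mul_reflection, mul_smul, isPos_reflection_self]
  rw [← ncard_inversions_mul_reflection_of_isPos Δ hj hpos, mul_assoc, reflection_mul_self,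
    mul_one]

lemma ncard_inversions_wordProd_le (l : List ι) (hl : ∀ i ∈ l, i ∈ Δ.support) :
    (inversions Δ (wordProd P l)).ncard ≤ l.length := by
  induction l using List.reverseRecOn with
  | nil => simp [inversions_one]
  | append_singleton l j ih =>
    have hj : j ∈ Δ.support := hl j (by simp)
    have := ih fun i hi ↦ hl i (by simp [hi])
    simp only [wordProd_append, wordProd_cons, wordProd_nil, mul_one, List.length_append,
      List.length_singleton]
    by_cases h : Δ.IsPos (wordProd P l • j)
    · rw [ncard_inversions_mul_reflection_of_isPos Δ hj h]
      lia
    · have := ncard_inversions_mul_reflection_of_not_isPos Δ hj h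
      lia

lemma exists_word_exchange (l : List ι) (hl : ∀ i ∈ l, i ∈ Δ.support) {j : ι} (hj : j ∈ Δ.support)
    (h : ¬ Δ.IsPos (wordProd P l • j)) :
    ∃ m : List ι, (∀ i ∈ m, i ∈ Δ.support) ∧ m.length + 1 = l.length ∧
      wordProd P m = wordProd P l * Equiv.reflection P j := by
  induction l with
  | nil => exact absurd (Base.isPos_of_mem_support hj) (by simpa using h)
  | cons i l ih =>
    obtain ⟨hi, hl⟩ := List.forall_mem_cons.mp hl
    by_cases hpos : Δ.IsPos (wordProd P l • j)
    · have hji : wordProd P l • j = i := by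
        by_contra hne
        rw [wordProd_cons, mul_smul] at h
        exact h (hpos.reflectionPerm hi hne)
      refine ⟨l, hl, rfl, ?_⟩
      rw [wordProd_cons, mul_assoc, mul_reflection, hji, ← mul_assoc, reflection_mul_self, one_mul]
    · obtain ⟨m, hm, hlen, hprod⟩ := ih hl hpos
      exact ⟨i :: m, List.forall_mem_cons.mpr ⟨hi, hm⟩, by simp [hlen],
        by rw [wordProd_cons, wordProd_cons, hprod, mul_assoc]⟩

lemma exists_reduced_word (l : List ι) (hl : ∀ i ∈ l, i ∈ Δ.support) :
    ∃ m : List ι, (∀ i ∈ m, i ∈ Δ.support) ∧ m.length = (inversions Δ (wordProd P l)).ncard ∧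
      wordProd P m = wordProd P l := by
  induction l using List.reverseRecOn with
  | nil => exact ⟨[], by simp, by simp [inversions_one], rfl⟩
  | append_singleton l j ih =>
    have hj : j ∈ Δ.support := hl j (by simp)
    obtain ⟨m, hm, hlen, hprod⟩ := ih fun i hi ↦ hl i (by simp [hi])
    simp only [wordProd_append, wordProd_cons, wordProd_nil, mul_one]
    rw [← hprod] at hlen ⊢
    by_cases h : Δ.IsPos (wordProd P m • j)
    · refine ⟨m ++ [j], List.forall_mem_append.mpr ⟨hm, by simpa using hj⟩, ?_, by simp⟩
      rw [ncard_inversions_mul_reflection_of_isPos Δ hj h, List.length_append, hlen,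
        List.length_singleton]
    · obtain ⟨m', hm', hlen', hprod'⟩ := exists_word_exchange Δ m hm hj h
      have := ncard_inversions_mul_reflection_of_not_isPos Δ hj h
      exact ⟨m', hm', by lia, hprod'⟩

lemma len_weightHom {w : P.Aut} (hw : w ∈ P.weylGroup) :
    len Δ (Equiv.weightHom P w) = (inversions Δ w).ncard := by
  obtain ⟨l, hl, rfl⟩ := exists_word Δ hw
  apply le_antisymm
  · obtain ⟨m, hm, hlen, hprod⟩ := exists_reduced_word Δ l hl
    exact Nat.sInf_le ⟨m, ⟨hm, by rw [← hprod, weightHom_wordProd]⟩, hlen⟩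
  · refine le_csInf ⟨_, l, ⟨hl, (weightHom_wordProd l).symm⟩, rfl⟩ ?_
    rintro _ ⟨m, ⟨hm, h⟩, rfl⟩
    rw [← weightHom_wordProd] at h
    rw [← Equiv.weightHom_injective P h]
    exact ncard_inversions_wordProd_le Δ m hm

end Inversions

section BaseTransport

variable {ι X Y : Type*} [AddCommGroup X] [AddCommGroup Y] {P : RootPairing ι ℤ X Y}

lemma coroot_smul (g : P.Aut) (i : ι) :
    P.coroot (g • i) = Equiv.coweightEquiv P P g⁻¹ (P.coroot i) :=
  (Hom.coroot_coweightMap_apply P P i (g⁻¹).toHom).symm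

lemma map_mem_closure_image {κ M : Type*} [AddCommMonoid M] (f : M →+ M) (r : κ → M) (e : κ → κ)
    (he : ∀ i, f (r i) = r (e i)) (s : Set κ) {x : M} (hx : x ∈ AddSubmonoid.closure (r '' s)) :
    f x ∈ AddSubmonoid.closure (r '' (e '' s)) := by
  have himage : f '' (r '' s) = r '' (e '' s) := by simp only [Set.image_image, he]
  rw [← himage, ← AddMonoidHom.map_mclosure]
  exact AddSubmonoid.mem_map_of_mem f hx

open Classical in
/-- The transport of a base along an automorphism of the root datum. -/
def smulBase (g : P.Aut) (Δ : P.Base) : P.Base where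
  support := Δ.support.image (g • ·)
  linearIndepOn_root := by
    rw [Finset.coe_image]
    refine LinearIndepOn.image_of_comp _ _ ?_
    rw [show P.root ∘ (g • ·) = (Equiv.weightEquiv P P g).toLinearMap ∘ P.root from
      funext (root_smul g)]
    exact Δ.linearIndepOn_root.map_injOn _ (LinearEquiv.injective _).injOn
  linearIndepOn_coroot := by
    rw [Finset.coe_image]
    refine LinearIndepOn.image_of_comp _ _ ?_
    rw [show P.coroot ∘ (g • ·) = (Equiv.coweightEquiv P P g⁻¹).toLinearMap ∘ P.coroot from
      funext (coroot_smul g)]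
    exact Δ.linearIndepOn_coroot.map_injOn _ (LinearEquiv.injective _).injOn
  root_mem_or_neg_mem i := by
    have hmap (x : X) := map_mem_closure_image (x := x) (DistribSMul.toAddMonoidHom X g) P.root
      (g • ·) (fun i ↦ (root_smul g i).symm) Δ.support
    rw [← smul_inv_smul g i, root_smul, ← smul_neg, Finset.coe_image]
    exact (Δ.root_mem_or_neg_mem (g⁻¹ • i)).imp (hmap _) (hmap _)
  coroot_mem_or_neg_mem i := by
    have hmap (y : Y) := map_mem_closure_image (x := y)
      (Equiv.coweightEquiv P P g⁻¹).toLinearMap.toAddMonoidHom P.coroot (g • ·)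
      (fun i ↦ (coroot_smul g i).symm) Δ.support
    rw [← smul_inv_smul g i, coroot_smul, ← map_neg, Finset.coe_image]
    exact (Δ.coroot_mem_or_neg_mem (g⁻¹ • i)).imp (hmap _) (hmap _)

variable (g : P.Aut) (Δ : P.Base)

lemma smul_mem_smulBase (i : ι) : g • i ∈ (smulBase g Δ).support ↔ i ∈ Δ.support := by
  simp only [smulBase, Finset.mem_image, smul_left_cancel_iff, exists_eq_right]

lemma mem_smulBase {i : ι} : i ∈ (smulBase g Δ).support ↔ g⁻¹ • i ∈ Δ.support := by
  rw [← smul_mem_smulBase g Δ, smul_inv_smul]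

lemma fundCoweight_smulBase (α : (smulBase g Δ).support) (x : P.rootSpan ℤ) :
    fundCoweight (smulBase g Δ) α x =
      fundCoweight Δ ⟨g⁻¹ • (α : ι), (mem_smulBase g Δ).mp α.2⟩ (g⁻¹ • x) := by
  rw [← fundCoweight_smul (smul_mem_smulBase g Δ)]
  simp only [smul_inv_smul, Subtype.coe_eta]

lemma isConnectedDynkin_smulBase (h : IsConnectedDynkin Δ) : IsConnectedDynkin (smulBase g Δ) := by
  classical
  refine ⟨?_, fun S hS hne hproper ↦ ?_⟩
  · obtain ⟨i, hi⟩ := h.1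
    exact ⟨g • i, (smul_mem_smulBase g Δ i).mpr hi⟩
  obtain ⟨i, hi, j, hj, hjS, hij⟩ := h.2 (Δ.support.filter (g • · ∈ S)) (Finset.filter_subset _ _)
    (by
      obtain ⟨i, hi⟩ := hne
      exact ⟨g⁻¹ • i, by simpa using ⟨(mem_smulBase g Δ).mp (hS hi), hi⟩⟩)
    (by
      refine fun heq ↦ hproper (hS.antisymm fun i hi ↦ ?_)
      rw [← smul_inv_smul g i]
      exact Finset.filter_eq_self.mp heq _ ((mem_smulBase g Δ).mp hi))
  rw [Finset.mem_filter] at hi hjS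
  exact ⟨g • i, hi.2, g • j, (smul_mem_smulBase g Δ j).mpr hj, fun hgj ↦ hjS ⟨hj, hgj⟩,
    by rwa [pairing_smul]⟩

variable [Finite ι] [P.IsReduced]

lemma exists_base_of_regular (φ : P.rootSpan ℤ →ₗ[ℤ] ℝ) (hφ : ∀ i, φ (spanRoot P i) ≠ 0) :
    ∃ u ∈ P.weylGroup, ∀ i, (smulBase u Δ).IsPos i ↔ 0 < φ (spanRoot P i) := by
  let wrong (u : P.weylGroup) : Set ι := {i | Δ.IsPos i ∧ φ (spanRoot P (u.1 • i)) < 0}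
  obtain ⟨u, hmin⟩ : ∃ u, ∀ v, (wrong u).ncard ≤ (wrong v).ncard :=
    ⟨Function.argmin fun u ↦ (wrong u).ncard,
      fun v ↦ Function.argmin_le (fun u ↦ (wrong u).ncard) v⟩
  have hsimple (j : ι) (hj : j ∈ Δ.support) : 0 < φ (spanRoot P (u.1 • j)) := by
    refine (hφ _).lt_or_gt.resolve_left fun hneg ↦ ?_
    let v : P.weylGroup := u * ⟨Equiv.reflection P j, P.reflection_mem_weylGroup j⟩
    have hsub : wrong v ⊆ (Equiv.reflection P j • ·) '' (wrong u \ {j}) := by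
      rintro i ⟨hi, hvi⟩
      change φ (spanRoot P ((u.1 * Equiv.reflection P j) • i)) < 0 at hvi
      rw [mul_smul] at hvi
      refine ⟨Equiv.reflection P j • i, ⟨⟨hi.reflectionPerm hj ?_, hvi⟩, ?_⟩,
        reflection_smul_smul j i⟩
      · rintro rfl
        rw [spanRoot_smul, spanRoot_reflection_self, smul_neg, map_neg, ← spanRoot_smul] at hvi
        linarith
      · rintro (hij : _ = j)
        rw [← reflection_smul_smul (P := P) j i, hij, isPos_reflection_self] at hi
        exact hi (Base.isPos_of_mem_support hj)
    refine (hmin v).not_gt ?_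
    calc (wrong v).ncard ≤ (wrong u \ {j}).ncard :=
          (Set.ncard_le_ncard hsub).trans (Set.ncard_image_le)
      _ < (wrong u).ncard :=
          Set.ncard_sdiff_singleton_lt_of_mem ⟨Base.isPos_of_mem_support hj, hneg⟩
  refine ⟨u, u.2, fun i ↦ isPos_iff_apply_pos fun j hj ↦ ?_⟩
  rw [← smul_inv_smul u.1 j]
  exact hsimple _ ((mem_smulBase u.1 Δ).mp hj)

end BaseTransport

/-! ### Twisted Coxeter words -/

section CoxeterWords

variable {ι X Y : Type*} [AddCommGroup X] [AddCommGroup Y] {P : RootPairing ι ℤ X Y}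

/-- Twisted Coxeter elements, presented by words: `σ` permutes the simple roots and the word `l` in
the simple reflections contains precisely one letter from each `σ`-orbit. The twisted Coxeter
element itself is `wordProd P l * σ`. -/
structure IsCoxeterWord (Δ : P.Base) (σ : P.Aut) (l : List ι) : Prop where
  stable : ∀ i, σ • i ∈ Δ.support ↔ i ∈ Δ.support
  mem : ∀ i ∈ l, i ∈ Δ.support
  nodup : l.Nodup
  transversal : ∀ j ∈ Δ.support, ∃! i, i ∈ l ∧ ∃ m : ℤ, σ ^ m • j = i

variable {Δ : P.Base} {σ : P.Aut}

lemma zpow_smul_mem_support (hσ : ∀ i, σ • i ∈ Δ.support ↔ i ∈ Δ.support) (m : ℤ) (i : ι) :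
    σ ^ m • i ∈ Δ.support ↔ i ∈ Δ.support := by
  induction m with
  | zero => simp
  | succ m ih => rw [add_comm, zpow_add, zpow_one, mul_smul, hσ, ih]
  | pred m ih => rw [← hσ, smul_smul, ← zpow_one_add, add_sub_cancel, ih]

lemma isPos_smul_of_stable (hσ : ∀ i, σ • i ∈ Δ.support ↔ i ∈ Δ.support) {i : ι} :
    Δ.IsPos (σ • i) ↔ Δ.IsPos i :=
  isPos_smul_iff fun j hj ↦ Base.isPos_of_mem_support ((hσ j).mpr hj)

section OrbitCoweight

open Classical in
/-- The sum of the fundamental coweights over the `σ`-orbit of the simple root `j`. -/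
def orbitCoweight (Δ : P.Base) (σ : P.Aut) (j : ι) : P.rootSpan ℤ →ₗ[ℤ] ℤ :=
  ∑ α ∈ Finset.univ.filter fun α : Δ.support ↦ ∃ m : ℤ, σ ^ m • j = α, fundCoweight Δ α

open Classical in
lemma orbitCoweight_apply (j : ι) (x : P.rootSpan ℤ) :
    orbitCoweight Δ σ j x =
      ∑ α ∈ Finset.univ.filter fun α : Δ.support ↦ ∃ m : ℤ, σ ^ m • j = α, fundCoweight Δ α x := by
  rw [orbitCoweight, LinearMap.sum_apply]

open Classical in
lemma orbitCoweight_simple {i : ι} (hi : i ∈ Δ.support) (j : ι) :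
    orbitCoweight Δ σ j (spanRoot P i) = if ∃ m : ℤ, σ ^ m • j = i then 1 else 0 := by
  have hsimple (α : Δ.support) := fundCoweight_simple Δ α ⟨i, hi⟩
  simp only [orbitCoweight_apply, hsimple, Finset.sum_ite_eq', Finset.mem_filter,
    Finset.mem_univ, true_and]

lemma orbitCoweight_of_orbit {i j : ι} (hi : i ∈ Δ.support) (h : ∃ m : ℤ, σ ^ m • j = i) :
    orbitCoweight Δ σ j (spanRoot P i) = 1 := by
  rw [orbitCoweight_simple hi, if_pos h]

lemma orbitCoweight_of_not_orbit {i j : ι} (hi : i ∈ Δ.support) (h : ¬ ∃ m : ℤ, σ ^ m • j = i) :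
    orbitCoweight Δ σ j (spanRoot P i) = 0 := by
  rw [orbitCoweight_simple hi, if_neg h]

lemma exists_zpow_smul_eq_smul_iff {i j : ι} :
    (∃ m : ℤ, σ ^ m • j = σ • i) ↔ ∃ m : ℤ, σ ^ m • j = i := by
  constructor
  · rintro ⟨m, h⟩
    exact ⟨-1 + m, by rw [zpow_add, zpow_neg_one, mul_smul, h, inv_smul_smul]⟩
  · rintro ⟨m, h⟩
    exact ⟨1 + m, by rw [zpow_add, zpow_one, mul_smul, h]⟩

lemma orbitCoweight_smul (hσ : ∀ i, σ • i ∈ Δ.support ↔ i ∈ Δ.support) (j : ι)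
    (x : P.rootSpan ℤ) : orbitCoweight Δ σ j (σ • x) = orbitCoweight Δ σ j x := by
  classical
  suffices orbitCoweight Δ σ j ∘ₗ spanMap σ = orbitCoweight Δ σ j from LinearMap.congr_fun this x
  refine hom_ext_simple Δ fun i hi ↦ ?_
  rw [LinearMap.comp_apply, DistribSMul.toLinearMap_apply, ← spanRoot_smul,
    orbitCoweight_simple ((hσ i).mpr hi), orbitCoweight_simple hi]
  simp only [exists_zpow_smul_eq_smul_iff]

lemma orbitCoweight_nonneg {i : ι} (h : Δ.IsPos i) (j : ι) :
    0 ≤ orbitCoweight Δ σ j (spanRoot P i) := by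
  rw [orbitCoweight_apply]
  exact Finset.sum_nonneg fun α _ ↦ fundCoweight_nonneg_of_isPos h α

lemma fundCoweight_le_orbitCoweight {i : ι} (h : Δ.IsPos i) (α : Δ.support) :
    fundCoweight Δ α (spanRoot P i) ≤ orbitCoweight Δ σ α (spanRoot P i) := by
  classical
  rw [orbitCoweight_apply]
  exact Finset.single_le_sum (f := fun β ↦ fundCoweight Δ β (spanRoot P i))
    (fun β _ ↦ fundCoweight_nonneg_of_isPos h β) (by simpa using ⟨0, one_smul _ _⟩)

end OrbitCoweight

lemma apply_wordProd_smul {m : List ι} {x : P.rootSpan ℤ} (φ : P.rootSpan ℤ →ₗ[ℤ] ℤ)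
    (hm : ∀ i ∈ m, φ (spanRoot P i) = 0) : φ (wordProd P m • x) = φ x := by
  induction m with
  | nil => rw [wordProd_nil, one_smul]
  | cons i m ih =>
    obtain ⟨hi, hm⟩ := List.forall_mem_cons.mp hm
    rw [wordProd_cons, mul_smul, reflection_smul_span, map_sub, map_zsmul, hi, smul_zero, sub_zero,
      ih hm]

lemma fundCoweight_wordProd_smul {m : List ι} (hm : ∀ i ∈ m, i ∈ Δ.support) {α : Δ.support}
    (hα : (α : ι) ∉ m) (x : P.rootSpan ℤ) :
    fundCoweight Δ α (wordProd P m • x) = fundCoweight Δ α x := by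
  refine apply_wordProd_smul _ fun i hi ↦ ?_
  exact fundCoweight_ne Δ (β := ⟨i, hm i hi⟩) fun hαi ↦ hα (hαi ▸ hi)

namespace IsCoxeterWord

variable {l : List ι} (H : IsCoxeterWord Δ σ l)
include H

lemma eq_of_orbit {i j : ι} (hi : i ∈ l) (hj : j ∈ l) (h : ∃ m : ℤ, σ ^ m • j = i) : i = j :=
  (H.transversal j (H.mem j hj)).unique ⟨hi, h⟩ ⟨hj, 0, one_smul _ _⟩

lemma orbitCoweight_coxeter_smul {a b : List ι} {j : ι} (hl : l = a ++ j :: b)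
    (x : P.rootSpan ℤ) :
    orbitCoweight Δ σ j ((wordProd P l * σ) • x) =
      orbitCoweight Δ σ j x - P.coroot' j (wordProd P b • σ • x : P.rootSpan ℤ) := by
  have hj : j ∈ l := by simp [hl]
  have hother : ∀ i ∈ a ++ b, orbitCoweight Δ σ j (spanRoot P i) = 0 := by
    intro i hi
    have hnodup := H.nodup
    rw [hl, List.nodup_middle, List.nodup_cons] at hnodup
    have hil : i ∈ l := by
      rw [hl, List.mem_append, List.mem_cons]
      have := List.mem_append.mp hi
      tauto
    exact orbitCoweight_of_not_orbit (H.mem i hil) fun horbit ↦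
      hnodup.1 (H.eq_of_orbit hil hj horbit ▸ hi)
  obtain ⟨ha, hb⟩ := List.forall_mem_append.mp hother
  rw [hl, mul_smul, wordProd_append, wordProd_cons, mul_smul, mul_smul, apply_wordProd_smul _ ha,
    reflection_smul_span, map_sub, map_zsmul, apply_wordProd_smul _ hb,
    orbitCoweight_smul H.stable, orbitCoweight_of_orbit (H.mem j hj) ⟨0, one_smul _ _⟩,
    smul_eq_mul, mul_one]

lemma coroot'_suffix_smul_eq_zero {x : P.rootSpan ℤ} (hx : (wordProd P l * σ) • x = x)
    {a b : List ι} {j : ι} (hl : l = a ++ j :: b) :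
    P.coroot' j (wordProd P b • σ • x : P.rootSpan ℤ) = 0 := by
  have := H.orbitCoweight_coxeter_smul hl x
  rw [hx] at this
  linarith

lemma suffix_smul_eq {x : P.rootSpan ℤ} (hx : (wordProd P l * σ) • x = x) (a b : List ι)
    (hl : l = a ++ b) : wordProd P b • σ • x = σ • x := by
  induction b generalizing a with
  | nil => rw [wordProd_nil, one_smul]
  | cons j b ih =>
    rw [wordProd_cons, mul_smul, reflection_smul_span, H.coroot'_suffix_smul_eq_zero hx hl,
      zero_smul, sub_zero, ih (a ++ [j]) (by simp [hl])]

lemma eq_zero_of_coxeter_smul_eq_self [Finite ι] {x : P.rootSpan ℤ}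
    (hx : (wordProd P l * σ) • x = x) : x = 0 := by
  have hσ : σ • x = x := by rw [← H.suffix_smul_eq hx [] l rfl, ← mul_smul, hx]
  have hσpow (m : ℤ) : σ ^ m • x = x :=
    zpow_mem (show σ ∈ MulAction.stabilizer P.Aut x from hσ) m
  refine eq_zero_of_coroot'_eq_zero Δ fun i hi ↦ ?_
  obtain ⟨j, ⟨hj, m, rfl⟩, -⟩ := H.transversal i hi
  obtain ⟨a, b, hl⟩ := List.append_of_mem hj
  have hcoroot := H.coroot'_suffix_smul_eq_zero hx hl
  rw [H.suffix_smul_eq hx (a ++ [σ ^ m • i]) b (by simp [hl]), hσ] at hcoroot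
  rw [← coroot'_smul (σ ^ m) i, ← coe_smul, hσpow m, hcoroot]

lemma ncard_inversions_wordProd [Finite ι] [P.IsReduced] :
    (inversions Δ (wordProd P l)).ncard = l.length := by
  suffices ∀ a b : List ι, l = a ++ b → (inversions Δ (wordProd P a)).ncard = a.length from
    this l [] (List.append_nil l).symm
  intro a
  induction a using List.reverseRecOn with
  | nil => simp [inversions_one]
  | append_singleton a j ih =>
    intro b hl
    have hj : j ∈ Δ.support := H.mem j (by simp [hl])
    have hja : j ∉ a := by
      have hnodup := H.nodup
      rw [hl, List.append_assoc, List.singleton_append, List.nodup_middle] at hnodup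
      exact fun h ↦ (List.nodup_cons.mp hnodup).1 (List.mem_append_left _ h)
    have hpos : Δ.IsPos (wordProd P a • j) := by
      refine (isPos_iff_exists_fundCoweight_pos Δ).mpr ⟨⟨j, hj⟩, ?_⟩
      rw [spanRoot_smul, fundCoweight_wordProd_smul (fun i hi ↦ H.mem i (by simp [hl, hi])) hja,
        fundCoweight_self Δ ⟨j, hj⟩]
      exact one_pos
    rw [wordProd_append, wordProd_cons, wordProd_nil, mul_one,
      ncard_inversions_mul_reflection_of_isPos Δ hj hpos, ih ([j] ++ b) (by simp [hl]),
      List.length_append, List.length_singleton]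

end IsCoxeterWord

end CoxeterWords

section Orbits

variable {ι X Y : Type*} [AddCommGroup X] [AddCommGroup Y] {P : RootPairing ι ℤ X Y}

lemma sum_pow_smul_eq_zero {τ : P.Aut} (hτ : ∀ x : P.rootSpan ℤ, τ • x = x → x = 0)
    {p : ℕ} {x : P.rootSpan ℤ} (hx : τ ^ p • x = x) :
    ∑ k ∈ Finset.range p, τ ^ k • x = 0 := by
  refine hτ _ ?_
  have hshift := Finset.sum_range_succ' (fun k ↦ τ ^ k • x) p
  rw [Finset.sum_range_succ, pow_zero, one_smul, hx] at hshift
  simp_rw [pow_succ', mul_smul, ← Finset.smul_sum] at hshift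
  exact (add_right_cancel hshift).symm

/-- The order of the permutation of the roots induced by an automorphism. -/
def rootOrder (τ : P.Aut) : ℕ := orderOf (MulAction.toPermHom P.Aut ι τ)

lemma pow_rootOrder_smul (τ : P.Aut) (i : ι) : τ ^ rootOrder τ • i = i := by
  have horder := pow_orderOf_eq_one (MulAction.toPermHom P.Aut ι τ)
  rw [← map_pow] at horder
  exact Equiv.Perm.congr_fun horder i

lemma pow_rootOrder_smul_span (τ : P.Aut) (x : P.rootSpan ℤ) : τ ^ rootOrder τ • x = x := by
  suffices spanMap (τ ^ rootOrder τ) = LinearMap.id from LinearMap.congr_fun this x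
  refine hom_ext_spanRoot fun i ↦ ?_
  rw [DistribSMul.toLinearMap_apply, ← spanRoot_smul, pow_rootOrder_smul, LinearMap.id_apply]

lemma rootOrder_dvd {τ : P.Aut} {m : ℕ} (h : ∀ i : ι, τ ^ m • i = i) : rootOrder τ ∣ m := by
  refine orderOf_dvd_of_pow_eq_one ?_
  rw [← map_pow]
  exact Equiv.Perm.ext h

lemma pow_add_mul_smul (τ : P.Aut) (k n : ℕ) (i : ι) :
    τ ^ (k + n * rootOrder τ) • i = τ ^ k • i := by
  induction n with
  | zero => rw [zero_mul, add_zero]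
  | succ n ih => rw [add_mul, one_mul, ← add_assoc, pow_add, mul_smul, pow_rootOrder_smul, ih]

variable [Finite ι]

lemma rootOrder_pos (τ : P.Aut) : 0 < rootOrder τ := orderOf_pos _

lemma exists_pow_smul_eq_zpow_smul (τ : P.Aut) (m : ℤ) :
    ∃ n : ℕ, ∀ i : ι, τ ^ m • i = τ ^ n • i := by
  obtain ⟨n, hn⟩ : ∃ n : ℕ, (n : ℤ) = m + |m| * rootOrder τ := by
    refine ⟨(m + |m| * rootOrder τ).toNat, Int.toNat_of_nonneg ?_⟩
    have : (1 : ℤ) ≤ rootOrder τ := by exact_mod_cast rootOrder_pos τ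
    nlinarith [neg_abs_le m, abs_nonneg m]
  refine ⟨n, fun i ↦ ?_⟩
  have hperiod := pow_add_mul_smul τ 0 m.natAbs i
  rw [zero_add, pow_zero, one_smul, ← zpow_natCast, Nat.cast_mul, Int.natCast_natAbs] at hperiod
  rw [← zpow_natCast τ n, hn, zpow_add, mul_smul, hperiod]

lemma eq_zero_of_invariant {A : Type*} [AddCommGroup A] [IsAddTorsionFree A] {τ : P.Aut}
    (hτ : ∀ x : P.rootSpan ℤ, τ • x = x → x = 0) {φ : P.rootSpan ℤ →ₗ[ℤ] A}
    (hφ : ∀ x, φ (τ • x) = φ x) : φ = 0 := by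
  ext x
  have hpow (k : ℕ) : φ (τ ^ k • x) = φ x := by
    induction k with
    | zero => rw [pow_zero, one_smul]
    | succ k ih => rw [pow_succ', mul_smul, hφ, ih]
  have hsum := congrArg φ (sum_pow_smul_eq_zero hτ (pow_rootOrder_smul_span τ x))
  simp only [map_sum, hpow, Finset.sum_const, Finset.card_range, map_zero] at hsum
  exact (nsmul_eq_zero_iff.mp hsum).resolve_right (rootOrder_pos τ).ne'

section SignChange

variable {A : Type*} [AddCommGroup A] [LinearOrder A] [IsOrderedAddMonoid A] {τ : P.Aut}
  {φ : P.rootSpan ℤ →ₗ[ℤ] A}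

lemma exists_neg_of_orbit (hτ : ∀ x : P.rootSpan ℤ, τ • x = x → x = 0)
    (hφ : ∀ i, φ (spanRoot P i) ≠ 0) (i : ι) : ∃ k : ℕ, φ (spanRoot P (τ ^ k • i)) < 0 := by
  by_contra! hnonneg
  have hsum := congrArg φ (sum_pow_smul_eq_zero hτ (pow_rootOrder_smul_span τ (spanRoot P i)))
  simp only [map_sum, map_zero, ← spanRoot_smul] at hsum
  exact hφ _ ((Finset.sum_eq_zero_iff_of_nonneg fun k _ ↦ hnonneg k).mp hsum 0
    (Finset.mem_range.mpr (rootOrder_pos τ)))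

lemma exists_pos_neg (hτ : ∀ x : P.rootSpan ℤ, τ • x = x → x = 0)
    (hφ : ∀ i, φ (spanRoot P i) ≠ 0) (i : ι) :
    ∃ k : ℕ, 0 < φ (spanRoot P (τ ^ k • i)) ∧ φ (spanRoot P (τ ^ (k + 1) • i)) < 0 := by
  obtain ⟨a, ha⟩ : ∃ a : ℕ, 0 < φ (spanRoot P (τ ^ a • i)) := by
    simpa using exists_neg_of_orbit (φ := -φ) hτ (by simpa using hφ) i
  by_contra! hstep
  have hpos (n : ℕ) : 0 < φ (spanRoot P (τ ^ n • τ ^ a • i)) := by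
    induction n with
    | zero => rwa [pow_zero, one_smul]
    | succ n ih =>
      rw [smul_smul, ← pow_add] at ih ⊢
      rw [add_right_comm]
      exact lt_of_le_of_ne (hstep _ ih) (hφ _).symm
  obtain ⟨n, hn⟩ := exists_neg_of_orbit hτ hφ (τ ^ a • i)
  exact (hpos n).not_gt hn

end SignChange

end Orbits

section OrbitSupport

variable {ι X Y : Type*} [AddCommGroup X] [AddCommGroup Y] {P : RootPairing ι ℤ X Y}
  {Δ : P.Base}

lemma IsConnectedDynkin.induction (hconn : IsConnectedDynkin Δ) {p : ι → Prop} {α : ι}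
    (hα : α ∈ Δ.support) (hpα : p α)
    (hadj : ∀ i ∈ Δ.support, ∀ j ∈ Δ.support, P.pairing i j ≠ 0 → p i → p j) :
    ∀ i ∈ Δ.support, p i := by
  classical
  by_contra! hne
  obtain ⟨k, hk, hpk⟩ := hne
  obtain ⟨i, hi, j, hj, hjS, hij⟩ := hconn.2 {i ∈ Δ.support | p i} (Finset.filter_subset _ _)
    ⟨α, Finset.mem_filter.mpr ⟨hα, hpα⟩⟩ fun h ↦ hpk (Finset.filter_eq_self.mp h k hk)
  obtain ⟨hi, hpi⟩ := Finset.mem_filter.mp hi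
  exact hjS (Finset.mem_filter.mpr ⟨hj, hadj i hi j hj hij hpi⟩)

/-- Off the diagonal the entries of the Cartan matrix are nonpositive, and the coefficients of a
root all have the same sign. -/
lemma fundCoweight_eq_zero_of_coroot'_eq_zero [Finite ι] {i : ι} {α β : Δ.support}
    (hcoroot : P.coroot' α (spanRoot P i : P.rootSpan ℤ) = 0)
    (hα : fundCoweight Δ α (spanRoot P i) = 0) (hβ : P.pairing β α ≠ 0) :
    fundCoweight Δ β (spanRoot P i) = 0 := by
  let c (γ : Δ.support) : ℤ := fundCoweight Δ γ (spanRoot P i)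
  have hsum : ∑ γ : Δ.support, c γ * P.pairing γ α = 0 := by
    rw [← hcoroot, ← sum_fundCoweight Δ (spanRoot P i), Submodule.coe_sum, map_sum]
    refine Finset.sum_congr rfl fun γ _ ↦ ?_
    rw [Submodule.coe_smul, map_smul, smul_eq_mul]
    exact congrArg _ (root_coroot'_eq_pairing P α γ).symm
  obtain ⟨s, hs, hsc⟩ : ∃ s : ℤ, s ≠ 0 ∧ ∀ γ, 0 ≤ s * c γ := by
    rcases fundCoweight_sign Δ i with hsign | hsign
    · exact ⟨1, one_ne_zero, fun γ ↦ by simpa using hsign γ⟩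
    · exact ⟨-1, by simp, fun γ ↦ by simpa using hsign γ⟩
  have hnonpos (γ : Δ.support) : s * (c γ * P.pairing γ α) ≤ 0 := by
    rw [← mul_assoc]
    obtain rfl | hγ := eq_or_ne γ α
    · simp [c, hα]
    · refine mul_nonpos_of_nonneg_of_nonpos (hsc γ) ?_
      rw [← P.algebraMap_pairingIn ℤ]
      exact Δ.pairingIn_le_zero_of_ne (fun h ↦ hγ (Subtype.ext h)) γ.2 α.2
  have hzero := (Finset.sum_eq_zero_iff_of_nonpos fun γ _ ↦ hnonpos γ).mp
    (by rw [← Finset.mul_sum, hsum, mul_zero]) β (Finset.mem_univ β)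
  exact (mul_eq_zero.mp ((mul_eq_zero.mp hzero).resolve_left hs)).resolve_right hβ

/-- The simple root `j` occurs in some root of the `τ`-orbit of `i`. -/
def OccursInOrbit (Δ : P.Base) (τ : P.Aut) (i j : ι) : Prop :=
  ∃ (hj : j ∈ Δ.support) (k : ℤ), fundCoweight Δ ⟨j, hj⟩ (spanRoot P (τ ^ k • i)) ≠ 0

lemma occursInOrbit_iff {τ : P.Aut} {i : ι} {α : Δ.support} :
    OccursInOrbit Δ τ i α ↔ ∃ k : ℤ, fundCoweight Δ α (spanRoot P (τ ^ k • i)) ≠ 0 :=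
  ⟨fun ⟨_, h⟩ ↦ h, fun h ↦ ⟨α.2, h⟩⟩

lemma occursInOrbit_iff_succ {τ : P.Aut} {i : ι} {α : Δ.support} :
    OccursInOrbit Δ τ i α ↔ ∃ k : ℤ, fundCoweight Δ α (spanRoot P (τ ^ (1 + k) • i)) ≠ 0 :=
  occursInOrbit_iff.trans
    ⟨fun ⟨k, hk⟩ ↦ ⟨k - 1, by rwa [add_sub_cancel]⟩, fun ⟨k, hk⟩ ↦ ⟨1 + k, hk⟩⟩

namespace IsCoxeterWord

variable {σ : P.Aut} {l : List ι} (H : IsCoxeterWord Δ σ l)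

lemma spanRoot_coxeter_zpow_smul (k : ℤ) (i : ι) :
    spanRoot P ((wordProd P l * σ) ^ (1 + k) • i) =
      wordProd P l • spanRoot P (σ • (wordProd P l * σ) ^ k • i) := by
  rw [zpow_one_add, mul_smul, mul_smul, spanRoot_smul]

lemma spanRoot_coxeter_smul {a b : List ι} {r : ι} (hl : l = a ++ r :: b) (j : ι) :
    spanRoot P ((wordProd P l * σ) • j) =
      wordProd P a • (spanRoot P (wordProd P b • σ • j) -
        P.coroot' r (spanRoot P (wordProd P b • σ • j) : P.rootSpan ℤ) • spanRoot P r) := by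
  rw [hl, wordProd_append, wordProd_cons, mul_assoc, mul_assoc, mul_smul, mul_smul, mul_smul,
    spanRoot_smul, spanRoot_smul, reflection_smul_span]

include H

lemma fundCoweight_stable_smul {α : Δ.support} (hα : σ • (α : ι) ∈ Δ.support) (i : ι) :
    fundCoweight Δ ⟨σ • α, hα⟩ (spanRoot P (σ • i)) = fundCoweight Δ α (spanRoot P i) := by
  rw [spanRoot_smul, fundCoweight_smul H.stable]

lemma occursInOrbit_smul_iff_of_notMem {i j : ι} (hj : j ∈ Δ.support) (hjl : σ • j ∉ l) :
    OccursInOrbit Δ (wordProd P l * σ) i (σ • j) ↔ OccursInOrbit Δ (wordProd P l * σ) i j := by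
  have hσj := (H.stable j).mpr hj
  rw [occursInOrbit_iff_succ (α := ⟨σ • j, hσj⟩), occursInOrbit_iff (α := ⟨j, hj⟩)]
  simp only [spanRoot_coxeter_zpow_smul,
    fundCoweight_wordProd_smul H.mem (α := ⟨σ • j, hσj⟩) hjl,
    H.fundCoweight_stable_smul (α := ⟨j, hj⟩) hσj]

lemma occursInOrbit_pow_smul_iff {i r : ι} (hr : r ∈ l) (m : ℕ) :
    OccursInOrbit Δ (wordProd P l * σ) i (σ ^ m • r) ↔
      OccursInOrbit Δ (wordProd P l * σ) i r := by
  induction m with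
  | zero => rw [pow_zero, one_smul]
  | succ m ih =>
    by_cases hperiod : σ ^ (m + 1) • r = r
    · rw [hperiod]
    · rw [← ih, pow_succ', mul_smul]
      refine H.occursInOrbit_smul_iff_of_notMem ?_ fun hmem ↦ hperiod ?_
      · rw [← zpow_natCast]
        exact (zpow_smul_mem_support H.stable _ _).mpr (H.mem r hr)
      · rw [← mul_smul, ← pow_succ'] at hmem
        exact H.eq_of_orbit hmem hr ⟨(m + 1 : ℕ), by rw [zpow_natCast]⟩

lemma occursInOrbit_zpow_smul_iff [Finite ι] {i j : ι} (hj : j ∈ Δ.support) (m : ℤ) :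
    OccursInOrbit Δ (wordProd P l * σ) i (σ ^ m • j) ↔
      OccursInOrbit Δ (wordProd P l * σ) i j := by
  obtain ⟨r, ⟨hr, n, hn⟩, -⟩ := H.transversal j hj
  have hrep (n : ℤ) : OccursInOrbit Δ (wordProd P l * σ) i (σ ^ n • r) ↔
      OccursInOrbit Δ (wordProd P l * σ) i r := by
    obtain ⟨n, hn⟩ := exists_pow_smul_eq_zpow_smul σ n
    rw [hn, H.occursInOrbit_pow_smul_iff hr]
  obtain rfl : j = σ ^ (-n) • r := by rw [← hn, zpow_neg, inv_smul_smul]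
  rw [smul_smul, ← zpow_add, hrep, hrep]

lemma occursInOrbit_iff_stable_smul [Finite ι] {i : ι} {α : Δ.support} :
    OccursInOrbit Δ (wordProd P l * σ) i α ↔
      ∃ k : ℤ, fundCoweight Δ α (spanRoot P (σ • (wordProd P l * σ) ^ k • i)) ≠ 0 := by
  obtain ⟨γ, hγ, rfl⟩ : ∃ γ : Δ.support, ∃ h, α = ⟨σ • γ, h⟩ :=
    ⟨⟨σ⁻¹ • α, by rw [← H.stable, smul_inv_smul]; exact α.2⟩,
      by rw [smul_inv_smul]; exact α.2, Subtype.ext (smul_inv_smul _ _).symm⟩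
  simp only [H.fundCoweight_stable_smul, ← occursInOrbit_iff]
  simpa using H.occursInOrbit_zpow_smul_iff (i := i) γ.2 1

/-- If `r` does not occur in the orbit, then the roots `s_b σ τ ^ k • i`, where `τ = s_a s_r s_b σ`,
do not involve `r` before or after `s_r` is applied. Hence they are orthogonal to `r` and do not
involve its neighbours. -/
lemma fundCoweight_suffix_smul_eq_zero [Finite ι] {i : ι} {α β : Δ.support} {a b : List ι}
    (hl : l = a ++ (α : ι) :: b) (hα : ¬ OccursInOrbit Δ (wordProd P l * σ) i α)
    (hβ : P.pairing β α ≠ 0) (k : ℤ) :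
    fundCoweight Δ β (spanRoot P (wordProd P b • σ • (wordProd P l * σ) ^ k • i)) = 0 := by
  have hnodup := H.nodup
  rw [hl, List.nodup_middle, List.nodup_cons, List.mem_append, not_or] at hnodup
  have hbefore : fundCoweight Δ α
      (spanRoot P (wordProd P b • σ • (wordProd P l * σ) ^ k • i)) = 0 := by
    rw [spanRoot_smul, fundCoweight_wordProd_smul (fun m hm ↦ H.mem m (by simp [hl, hm]))
      hnodup.1.2]
    exact not_not.mp (not_exists.mp (H.occursInOrbit_iff_stable_smul.not.mp hα) k)
  have hafter := not_not.mp (not_exists.mp (occursInOrbit_iff_succ.not.mp hα) k)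
  rw [zpow_one_add, mul_smul, spanRoot_coxeter_smul hl,
    fundCoweight_wordProd_smul (fun m hm ↦ H.mem m (by simp [hl, hm])) hnodup.1.1, map_sub,
    map_zsmul, fundCoweight_self, hbefore, zero_sub, neg_eq_zero, smul_eq_mul, mul_one] at hafter
  exact fundCoweight_eq_zero_of_coroot'_eq_zero hafter hbefore hβ

lemma not_occursInOrbit_of_pairing_ne_zero [Finite ι] {i : ι} {α β : Δ.support}
    (hαl : (α : ι) ∈ l) (hα : ¬ OccursInOrbit Δ (wordProd P l * σ) i α)
    (hβ : P.pairing β α ≠ 0) : ¬ OccursInOrbit Δ (wordProd P l * σ) i β := by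
  intro hoccurs
  obtain ⟨a, b, hl⟩ := List.append_of_mem hαl
  have hsuffix := H.fundCoweight_suffix_smul_eq_zero hl hα hβ
  by_cases hβb : (β : ι) ∈ b
  · obtain ⟨k, hk⟩ := occursInOrbit_iff_succ.mp hoccurs
    have hβa : (β : ι) ∉ a := fun hβa ↦ by
      have hnodup := H.nodup
      rw [hl, List.nodup_append] at hnodup
      exact hnodup.2.2 β hβa β (List.mem_cons_of_mem _ hβb) rfl
    have hβα : β ≠ α := by
      rintro rfl
      exact hα hoccurs
    refine hk ?_
    rw [zpow_one_add, mul_smul, spanRoot_coxeter_smul hl,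
      fundCoweight_wordProd_smul (fun m hm ↦ H.mem m (by simp [hl, hm])) hβa, map_sub, map_zsmul,
      fundCoweight_ne Δ hβα, hsuffix, smul_zero, sub_zero]
  · obtain ⟨k, hk⟩ := H.occursInOrbit_iff_stable_smul.mp hoccurs
    refine hk ?_
    rw [← hsuffix k, spanRoot_smul (wordProd P b),
      fundCoweight_wordProd_smul (fun m hm ↦ H.mem m (by simp [hl, hm])) hβb]

lemma exists_fundCoweight_ne_zero [Finite ι] (hconn : IsConnectedDynkin Δ) (i : ι)
    (α : Δ.support) :
    ∃ k : ℕ, fundCoweight Δ α (spanRoot P ((wordProd P l * σ) ^ k • i)) ≠ 0 := by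
  obtain ⟨β, hβ⟩ := CoxeterTorus.exists_fundCoweight_ne_zero Δ i
  have hoccurs : OccursInOrbit Δ (wordProd P l * σ) i α := by
    refine hconn.induction β.2 (occursInOrbit_iff.mpr ⟨0, by rwa [zpow_zero, one_smul]⟩)
      (fun j hj r hr hjr hoccurs ↦ ?_) α α.2
    obtain ⟨s, ⟨hs, m, rfl⟩, -⟩ := H.transversal r hr
    rw [← H.occursInOrbit_zpow_smul_iff hr m]
    rw [← H.occursInOrbit_zpow_smul_iff hj m] at hoccurs
    by_contra hnot
    exact H.not_occursInOrbit_of_pairing_ne_zero (α := ⟨σ ^ m • r, H.mem _ hs⟩)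
      (β := ⟨σ ^ m • j, (zpow_smul_mem_support H.stable m j).mpr hj⟩) hs hnot
      (by rwa [pairing_smul]) hoccurs
  obtain ⟨k, hk⟩ := occursInOrbit_iff.mp hoccurs
  obtain ⟨n, hn⟩ := exists_pow_smul_eq_zpow_smul (wordProd P l * σ) k
  exact ⟨n, by rwa [← hn]⟩

end IsCoxeterWord

end OrbitSupport

/-! ### Inversions and Fourier coefficients -/

section FirstFourierCoefficient

open Real

lemma cos_sub_cos_pos {p a k : ℕ} (hka : k < a) (hap : a ≤ p) :
    0 < cos (2 * π * k / p + π * (1 - a) / p) - cos (π * a / p) := by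
  have hka' : (k : ℝ) + 1 ≤ a := by exact_mod_cast hka
  have hap' : (a : ℝ) ≤ p := by exact_mod_cast hap
  have hp : (0 : ℝ) < p := by exact_mod_cast (Nat.zero_le k).trans_lt (hka.trans_le hap)
  have hprod := two_mul_sin_mul_sin (π * (2 * k + 1) / (2 * p)) (π * (2 * a - 2 * k - 1) / (2 * p))
  rw [show π * (2 * k + 1) / (2 * p) - π * (2 * a - 2 * k - 1) / (2 * p) =
      2 * π * k / p + π * (1 - a) / p by field_simp; ring,
    show π * (2 * k + 1) / (2 * p) + π * (2 * a - 2 * k - 1) / (2 * p) = π * a / p by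
      field_simp; ring] at hprod
  rw [← hprod]
  refine mul_pos (mul_pos two_pos (sin_pos_of_pos_of_lt_pi (by positivity) ?_))
    (sin_pos_of_pos_of_lt_pi ?_ ?_)
  · rw [div_lt_iff₀ (by positivity)]
    nlinarith [pi_pos]
  · exact div_pos (mul_pos pi_pos (by linarith)) (by positivity)
  · rw [div_lt_iff₀ (by positivity)]
    nlinarith [pi_pos, (Nat.cast_nonneg k : (0 : ℝ) ≤ k)]

lemma cos_sub_cos_neg {p a k : ℕ} (hak : a ≤ k) (hkp : k < p) :
    cos (2 * π * k / p + π * (1 - a) / p) - cos (π * a / p) < 0 := by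
  have hp : (p : ℝ) ≠ 0 := by exact_mod_cast ((Nat.zero_le k).trans_lt hkp).ne'
  have hpos := cos_sub_cos_pos (p := p) (a := p - a) (k := k - a) (by lia) (Nat.sub_le p a)
  push_cast [hak, (hak.trans hkp.le)] at hpos
  rw [show π * (p - a) / p = π - π * a / p by field_simp, cos_pi_sub,
    show 2 * π * (k - a) / p + π * (1 - (p - a)) / p =
      2 * π * k / p + π * (1 - a) / p - π by field_simp; ring, cos_sub_pi] at hpos
  linarith

lemma sum_mul_cos_eq_zero {p : ℕ} {g : ℕ → ℝ}
    (h : ∑ k ∈ Finset.range p, Complex.exp (2 * π * Complex.I / p) ^ k * (g k : ℂ) = 0) (θ : ℝ) :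
    ∑ k ∈ Finset.range p, g k * cos (2 * π * k / p + θ) = 0 := by
  have hterm (k : ℕ) : (Complex.exp (θ * Complex.I) *
      (Complex.exp (2 * π * Complex.I / p) ^ k * (g k : ℂ))).re =
        g k * cos (2 * π * k / p + θ) := by
    rw [← mul_assoc, Complex.re_mul_ofReal, ← Complex.exp_nat_mul, ← Complex.exp_add, mul_comm,
      show θ * Complex.I + k * (2 * π * Complex.I / p) = (2 * π * k / p + θ : ℝ) * Complex.I by
        push_cast; ring, Complex.exp_ofReal_mul_I_re]
  simp_rw [← hterm]
  rw [← Complex.re_sum, ← Finset.mul_sum, h, mul_zero, Complex.zero_re]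

/-- The cosine wave `cos (2πk/p + π(1-a)/p) - cos (πa/p)`, whose sum against `g` is the real part of
a multiple of the Fourier coefficient, has the same sign pattern as `g`. -/
lemma fourier_ne_zero {p a : ℕ} (hap : a ≤ p) {g : ℕ → ℝ} (hpos : ∀ k < a, 0 ≤ g k)
    (hneg : ∀ k, a ≤ k → k < p → g k ≤ 0) (hne : ∃ k < p, g k ≠ 0)
    (hsum : ∑ k ∈ Finset.range p, g k = 0) :
    ∑ k ∈ Finset.range p, Complex.exp (2 * π * Complex.I / p) ^ k * (g k : ℂ) ≠ 0 := by
  intro hfourier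
  let c (k : ℕ) : ℝ := cos (2 * π * k / p + π * (1 - a) / p) - cos (π * a / p)
  have hzero : ∑ k ∈ Finset.range p, g k * c k = 0 := by
    simp only [c, mul_sub, Finset.sum_sub_distrib, ← Finset.sum_mul, hsum,
      sum_mul_cos_eq_zero hfourier, zero_mul, sub_zero]
  have hnonneg : ∀ k ∈ Finset.range p, 0 ≤ g k * c k := by
    intro k hk
    obtain hka | hak := lt_or_ge k a
    · exact mul_nonneg (hpos k hka) (cos_sub_cos_pos hka hap).le
    · have hkp := Finset.mem_range.mp hk
      exact mul_nonneg_of_nonpos_of_nonpos (hneg k hak hkp) (cos_sub_cos_neg hak hkp).le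
  obtain ⟨k, hkp, hgk⟩ := hne
  have hck : c k ≠ 0 := by
    obtain hka | hak := lt_or_ge k a
    · exact (cos_sub_cos_pos hka hap).ne'
    · exact (cos_sub_cos_neg hak hkp).ne
  exact mul_ne_zero hgk hck
    ((Finset.sum_eq_zero_iff_of_nonneg hnonneg).mp hzero k (Finset.mem_range.mpr hkp))

end FirstFourierCoefficient

section CoxeterInversions

variable {ι X Y : Type*} [AddCommGroup X] [AddCommGroup Y] {P : RootPairing ι ℤ X Y}
  {Δ : P.Base} {σ : P.Aut} {l : List ι}

lemma orbitCoweight_pow_smul (hσ : ∀ i, σ • i ∈ Δ.support ↔ i ∈ Δ.support) (k : ℕ) (j : ι)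
    (x : P.rootSpan ℤ) : orbitCoweight Δ σ j (σ ^ k • x) = orbitCoweight Δ σ j x := by
  induction k with
  | zero => rw [pow_zero, one_smul]
  | succ k ih => rw [pow_succ', mul_smul, orbitCoweight_smul hσ, ih]

lemma coxeter_pow_mul_mem (l : List ι) (σ : P.Aut) (k : ℕ) :
    (wordProd P l * σ) ^ k * (σ ^ k)⁻¹ ∈ P.weylGroup := by
  induction k with
  | zero => simp
  | succ k ih =>
    convert mul_mem (wordProd_mem l) (conj_mem_weylGroup σ ih) using 1
    rw [pow_succ', pow_succ']
    group

lemma IsCoxeterWord.orbitCoweight_coxeter_smul_of_suffix (H : IsCoxeterWord Δ σ l)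
    {a b : List ι} {i j : ι} (hl : l = a ++ j :: b) (hj : wordProd P b • σ • i = j)
    (x : P.rootSpan ℤ) :
    orbitCoweight Δ σ j ((wordProd P l * σ) • x) =
      orbitCoweight Δ σ j x - P.coroot' i (x : X) := by
  rw [H.orbitCoweight_coxeter_smul hl, coe_smul, coe_smul, sub_right_inj]
  conv_lhs => rw [← hj]
  rw [coroot'_smul, coroot'_smul]

variable [Finite ι]

section Reduced

variable [P.IsReduced]

lemma eq_one_of_ncard_inversions_eq_zero {w : P.Aut} (hw : w ∈ P.weylGroup)
    (h : (inversions Δ w).ncard = 0) : w = 1 := by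
  obtain ⟨l, hl, rfl⟩ := exists_word Δ hw
  obtain ⟨m, -, hlen, hprod⟩ := exists_reduced_word Δ l hl
  rw [h, List.length_eq_zero_iff] at hlen
  rw [← hprod, hlen, wordProd_nil]

lemma dominant_unique {φ : P.rootSpan ℤ →ₗ[ℤ] ℤ} (hφ : ∀ i, Δ.IsPos i → 0 ≤ φ (spanRoot P i))
    {w : P.Aut} (hw : w ∈ P.weylGroup) (hφw : ∀ i, Δ.IsPos i → 0 ≤ φ (w • spanRoot P i))
    (x : P.rootSpan ℤ) : φ (w • x) = φ x := by
  induction hn : (inversions Δ w).ncard generalizing w x with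
  | zero => rw [eq_one_of_ncard_inversions_eq_zero hw hn, one_smul]
  | succ n ih =>
    obtain ⟨j, hj, hneg⟩ := exists_simple_mem_inversions Δ (g := w)
      ((Set.ncard_pos (Set.toFinite _)).mp (by lia))
    have hzero : φ (w • spanRoot P j) = 0 := by
      refine le_antisymm ?_ (hφw j (Base.isPos_of_mem_support hj))
      have := hφ _ ((isPos_reflection_self Δ (w • j)).mpr hneg)
      rwa [spanRoot_reflection_self, map_neg, spanRoot_smul, neg_nonneg] at this
    have hreflection (x) : φ ((w * Equiv.reflection P j) • x) = φ (w • x) := by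
      rw [mul_smul, reflection_smul_span, smul_sub, map_sub, smul_comm w, map_zsmul, hzero,
        smul_zero, sub_zero]
    rw [← hreflection]
    refine ih (mul_mem hw (P.reflection_mem_weylGroup j)) (fun i hi ↦ ?_) x ?_
    · exact (hφw i hi).trans_eq (hreflection _).symm
    · have := ncard_inversions_mul_reflection_of_not_isPos Δ hj hneg
      lia

lemma exists_suffix_smul_eq {l : List ι} (hl : ∀ i ∈ l, i ∈ Δ.support) {i : ι}
    (hi : i ∈ inversions Δ (wordProd P l)) : ∃ a j b, l = a ++ j :: b ∧ wordProd P b • i = j := by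
  obtain ⟨hpos, hneg⟩ := hi
  induction l with
  | nil => exact absurd hpos (by simpa using hneg)
  | cons j t ih =>
    obtain ⟨hj, ht⟩ := List.forall_mem_cons.mp hl
    by_cases hposi : Δ.IsPos (wordProd P t • i)
    · refine ⟨[], j, t, rfl, ?_⟩
      by_contra hne
      rw [wordProd_cons, mul_smul] at hneg
      exact hneg (hposi.reflectionPerm hj hne)
    · obtain ⟨a, k, b, rfl, hk⟩ := ih ht hposi
      exact ⟨j :: a, k, b, rfl, hk⟩

end Reduced

namespace IsCoxeterWord

variable (H : IsCoxeterWord Δ σ l)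
include H

lemma orbitCoweight_coxeter_pow_smul {a b a' b' : List ι} {i j j' : ι} {k : ℕ}
    (hl : l = a ++ j :: b) (hj : wordProd P b • σ • i = j) (hl' : l = a' ++ j' :: b')
    (hj' : wordProd P b' • σ • (wordProd P l * σ) ^ k • i = j') (x : P.rootSpan ℤ) :
    orbitCoweight Δ σ j' ((wordProd P l * σ) ^ k • x) = orbitCoweight Δ σ j x := by
  set τ := wordProd P l * σ
  let ψ : P.rootSpan ℤ →ₗ[ℤ] ℤ :=
    orbitCoweight Δ σ j' ∘ₗ spanMap (τ ^ k) - orbitCoweight Δ σ j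
  have hψ (x) : ψ x = orbitCoweight Δ σ j' (τ ^ k • x) - orbitCoweight Δ σ j x := rfl
  have hinvariant (x) : ψ (τ • x) = ψ x := by
    rw [hψ, hψ, smul_smul, ← pow_succ, pow_succ', mul_smul,
      H.orbitCoweight_coxeter_smul_of_suffix hl hj,
      H.orbitCoweight_coxeter_smul_of_suffix hl' hj', coe_smul, coroot'_smul]
    ring
  have hzero : ψ = 0 :=
    eq_zero_of_invariant (fun x ↦ H.eq_zero_of_coxeter_smul_eq_self) hinvariant
  exact sub_eq_zero.mp ((hψ x).symm.trans (LinearMap.congr_fun hzero x))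

variable [P.IsReduced]

lemma exists_suffix_coxeter_smul_eq {i : ι} (hi : i ∈ inversions Δ (wordProd P l * σ)) :
    ∃ a j b, l = a ++ j :: b ∧ wordProd P b • σ • i = j :=
  exists_suffix_smul_eq H.mem
    ⟨(isPos_smul_of_stable H.stable).mpr hi.1, by rw [← mul_smul]; exact hi.2⟩

/-- Each of the two inversions is detected by a letter of the word. The orbit coweights of the two
letters are dominant and conjugate under the Weyl group, hence equal. -/
lemma eq_of_mem_inversions {i : ι} {k : ℕ} (hi : i ∈ inversions Δ (wordProd P l * σ))
    (hk : (wordProd P l * σ) ^ k • i ∈ inversions Δ (wordProd P l * σ)) :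
    i = (wordProd P l * σ) ^ k • i := by
  obtain ⟨a, j, b, hl, hj⟩ := H.exists_suffix_coxeter_smul_eq hi
  obtain ⟨a', j', b', hl', hj'⟩ := H.exists_suffix_coxeter_smul_eq hk
  have hconj (x) : orbitCoweight Δ σ j' (((wordProd P l * σ) ^ k * (σ ^ k)⁻¹) • x) =
      orbitCoweight Δ σ j x := by
    rw [mul_smul, H.orbitCoweight_coxeter_pow_smul hl hj hl' hj',
      ← orbitCoweight_pow_smul H.stable k, smul_inv_smul]
  have heq (x) : orbitCoweight Δ σ j' x = orbitCoweight Δ σ j x := by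
    rw [← hconj]
    refine (dominant_unique (fun i hi ↦ orbitCoweight_nonneg hi j') (coxeter_pow_mul_mem l σ k)
      (fun i hi ↦ ?_) x).symm
    exact (orbitCoweight_nonneg hi j).trans_eq (hconj _).symm
  have hjl : j ∈ l := by simp [hl]
  have hjl' : j' ∈ l := by simp [hl']
  obtain rfl : j' = j := by
    refine H.eq_of_orbit hjl' hjl ?_
    by_contra horbit
    have := heq (spanRoot P j')
    rw [orbitCoweight_of_not_orbit (H.mem j' hjl') horbit,
      orbitCoweight_of_orbit (H.mem j' hjl') ⟨0, one_smul _ _⟩] at this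
    exact one_ne_zero this
  have hnodup := H.nodup
  rw [hl, List.nodup_middle, List.nodup_cons, List.mem_append, not_or] at hnodup
  obtain ⟨-, -, rfl⟩ :=
    (List.append_cons_inj_of_notMem hnodup.1.1 hnodup.1.2).mp (hl.symm.trans hl')
  exact MulAction.injective _ (MulAction.injective _ (hj.trans hj'.symm))

end IsCoxeterWord

end CoxeterInversions

/-! ### Eigenforms of a twisted Coxeter element -/

section Eigenforms

open MulAction

variable {ι X Y : Type*} [AddCommGroup X] [AddCommGroup Y] {P : RootPairing ι ℤ X Y}

lemma periodic_pow_smul (τ : P.Aut) (i : ι) :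
    Function.Periodic (fun k : ℕ ↦ τ ^ k • i) (period τ i) := fun k ↦ by
  simp only [pow_add, mul_smul, pow_period_smul]

lemma period_dvd_rootOrder (τ : P.Aut) (i : ι) : period τ i ∣ rootOrder τ :=
  pow_smul_eq_iff_period_dvd.mp (pow_rootOrder_smul τ i)

lemma period_pow_smul (τ : P.Aut) (k : ℕ) (i : ι) : period τ (τ ^ k • i) = period τ i := by
  have hfix (n : ℕ) : τ ^ n • τ ^ k • i = τ ^ k • i ↔ τ ^ n • i = i := by
    rw [smul_smul, ← pow_add, add_comm, pow_add, mul_smul, smul_left_cancel_iff]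
  apply Nat.dvd_antisymm
  · rw [← pow_smul_eq_iff_period_dvd, hfix, pow_smul_eq_iff_period_dvd]
  · rw [← pow_smul_eq_iff_period_dvd, ← hfix, pow_smul_eq_iff_period_dvd]

/-- Up to a scalar, the projection of a linear form on the root lattice to the forms on which the
automorphism `τ` acts by `ζ⁻¹`, for a root of unity `ζ` of order dividing that of `τ`. -/
def eigenForm (τ : P.Aut) (ζ : ℂ) (φ : P.rootSpan ℤ →ₗ[ℤ] ℤ) : P.rootSpan ℤ →ₗ[ℤ] ℂ :=
  AddMonoidHom.toIntLinearMap
    { toFun := fun x ↦ ∑ k ∈ Finset.range (rootOrder τ), ζ ^ k * (φ (τ ^ k • x) : ℂ)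
      map_zero' := by simp
      map_add' := fun x y ↦ by
        simp only [smul_add, map_add, Int.cast_add, mul_add, Finset.sum_add_distrib] }

lemma eigenForm_apply (τ : P.Aut) (ζ : ℂ) (φ : P.rootSpan ℤ →ₗ[ℤ] ℤ) (x) :
    eigenForm τ ζ φ x = ∑ k ∈ Finset.range (rootOrder τ), ζ ^ k * (φ (τ ^ k • x) : ℂ) := rfl

lemma sum_range_mul_of_periodic {A : Type*} [AddCommMonoid A] {f : ℕ → A} {p : ℕ}
    (hf : Function.Periodic f p) (m : ℕ) :
    ∑ k ∈ Finset.range (p * m), f k = m • ∑ k ∈ Finset.range p, f k := by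
  induction m with
  | zero => rw [mul_zero, Finset.sum_range_zero, zero_smul]
  | succ m ih =>
    rw [Nat.mul_succ, Finset.sum_range_add, ih, succ_nsmul]
    refine congrArg _ (Finset.sum_congr rfl fun k _ ↦ ?_)
    rw [add_comm, mul_comm]
    exact hf.nat_mul m k

section RootOfUnity

variable {τ : P.Aut} {ζ : ℂ} {φ : P.rootSpan ℤ →ₗ[ℤ] ℤ}

lemma eigenForm_spanRoot {i : ι} (hζ : ζ ^ period τ i = 1) :
    eigenForm τ ζ φ (spanRoot P i) = (rootOrder τ / period τ i) •
      ∑ k ∈ Finset.range (period τ i), ζ ^ k * (φ (spanRoot P (τ ^ k • i)) : ℂ) := by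
  have hperiodic : Function.Periodic (fun k ↦ ζ ^ k * (φ (spanRoot P (τ ^ k • i)) : ℂ))
      (period τ i) := fun k ↦ by
    have := periodic_pow_smul τ i k
    dsimp only at this ⊢
    rw [this, pow_add, hζ, mul_one]
  rw [← sum_range_mul_of_periodic hperiodic, Nat.mul_div_cancel' (period_dvd_rootOrder τ i),
    eigenForm_apply]
  simp only [spanRoot_smul]

variable (hζ : ζ ^ rootOrder τ = 1)
include hζ

lemma eigenForm_smul (x : P.rootSpan ℤ) :
    ζ * eigenForm τ ζ φ (τ • x) = eigenForm τ ζ φ x := by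
  have hshift := Finset.sum_range_succ' (fun k ↦ ζ ^ k * (φ (τ ^ k • x) : ℂ)) (rootOrder τ)
  rw [Finset.sum_range_succ, pow_rootOrder_smul_span, hζ, pow_zero, pow_zero, one_smul] at hshift
  rw [eigenForm_apply, eigenForm_apply, add_right_cancel hshift, Finset.mul_sum]
  refine Finset.sum_congr rfl fun k _ ↦ ?_
  rw [pow_succ' ζ, pow_succ τ, mul_smul, mul_assoc]

lemma eigenForm_pow_smul (k : ℕ) (x : P.rootSpan ℤ) :
    ζ ^ k * eigenForm τ ζ φ (τ ^ k • x) = eigenForm τ ζ φ x := by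
  induction k with
  | zero => simp
  | succ k ih => rw [← ih, pow_succ, pow_succ', mul_smul, mul_assoc, eigenForm_smul hζ]

lemma pow_eq_one_of_eigenForm_ne_zero {d : ℕ} (hφ : ∀ x, φ (τ ^ d • x) = φ x)
    {x : P.rootSpan ℤ} (hx : eigenForm τ ζ φ x ≠ 0) : ζ ^ d = 1 := by
  have hinvariant : eigenForm τ ζ φ (τ ^ d • x) = eigenForm τ ζ φ x := by
    simp only [eigenForm_apply, smul_smul, ← pow_add]
    simp only [add_comm _ d, pow_add, mul_smul, hφ]
  have hscale := eigenForm_pow_smul (φ := φ) hζ d x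
  rw [hinvariant] at hscale
  exact mul_right_cancel₀ hx (hscale.trans (one_mul _).symm)

end RootOfUnity

lemma apply_nonpos_of_not_isPos {Δ : P.Base} {A : Type*} [AddCommGroup A] [PartialOrder A]
    [IsOrderedAddMonoid A] {φ : P.rootSpan ℤ →ₗ[ℤ] A}
    (hφ : ∀ i, Δ.IsPos i → 0 ≤ φ (spanRoot P i)) {i : ι} (hi : ¬ Δ.IsPos i) :
    φ (spanRoot P i) ≤ 0 := by
  have := hφ _ ((isPos_reflection_self Δ i).mpr hi)
  rwa [spanRoot_reflection_self, map_neg, Left.nonneg_neg_iff] at this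

variable [Finite ι]

lemma period_pos (τ : P.Aut) (i : ι) : 0 < period τ i :=
  Nat.pos_of_dvd_of_pos (period_dvd_rootOrder τ i) (rootOrder_pos τ)

lemma eigenForm_ne_zero_of_run {Δ : P.Base} {τ : P.Aut}
    (hτ : ∀ x : P.rootSpan ℤ, τ • x = x → x = 0) {φ : P.rootSpan ℤ →ₗ[ℤ] ℤ}
    (hφ : ∀ i, Δ.IsPos i → 0 ≤ φ (spanRoot P i)) {i : ι} {a : ℕ} (ha : a ≤ period τ i)
    (hpos : ∀ k < a, Δ.IsPos (τ ^ k • i))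
    (hneg : ∀ k, a ≤ k → k < period τ i → ¬ Δ.IsPos (τ ^ k • i))
    (hne : ∃ k : ℕ, φ (spanRoot P (τ ^ k • i)) ≠ 0) :
    eigenForm τ (Complex.exp (2 * Real.pi * Complex.I / period τ i)) φ (spanRoot P i) ≠ 0 := by
  have hprim := Complex.isPrimitiveRoot_exp (period τ i) (period_pos τ i).ne'
  rw [eigenForm_spanRoot hprim.pow_eq_one]
  refine smul_ne_zero (Nat.div_pos (Nat.le_of_dvd (rootOrder_pos τ) (period_dvd_rootOrder τ i))
    (period_pos τ i)).ne' ?_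
  have hfourier := fourier_ne_zero ha (g := fun k ↦ (φ (spanRoot P (τ ^ k • i)) : ℝ))
    (fun k hk ↦ by exact_mod_cast hφ _ (hpos k hk))
    (fun k hk hkp ↦ by exact_mod_cast apply_nonpos_of_not_isPos hφ (hneg k hk hkp)) ?_ ?_
  · simpa using hfourier
  · obtain ⟨k, hk⟩ := hne
    refine ⟨k % period τ i, Nat.mod_lt _ (period_pos τ i), ?_⟩
    have hmod := (periodic_pow_smul τ i).map_mod_nat k
    rw [hmod]
    exact_mod_cast hk
  · have hsum := congrArg φ (sum_pow_smul_eq_zero (p := period τ i) hτ (x := spanRoot P i)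
      (by rw [← spanRoot_smul, pow_period_smul]))
    simp only [map_sum, map_zero, ← spanRoot_smul] at hsum
    exact_mod_cast hsum

end Eigenforms

lemma exists_threshold {p : ℕ → Prop} {N : ℕ} (h0 : p 0) (hN : ¬ p N)
    (hunique : ∀ m n, m ≤ n → n < N → p m → ¬ p (m + 1) → p n → ¬ p (n + 1) → m = n) :
    ∃ a ≤ N, (∀ k < a, p k) ∧ ∀ k, a ≤ k → k ≤ N → ¬ p k := by
  classical
  have hex : ∃ n, ¬ p n := ⟨N, hN⟩
  have ha : 0 < Nat.find hex := (Nat.find_pos hex).mpr (not_not.mpr h0)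
  refine ⟨Nat.find hex, Nat.find_min' hex hN, fun k hk ↦ not_not.mp (Nat.find_min hex hk),
    fun n hn hnN hpn ↦ ?_⟩
  have hex' : ∃ m, ¬ p (n + m) := ⟨N - n, by rwa [Nat.add_sub_cancel' hnN]⟩
  have hb : 0 < Nat.find hex' := (Nat.find_pos hex').mpr (not_not.mpr hpn)
  have hbN : Nat.find hex' ≤ N - n := Nat.find_min' hex' (by rwa [Nat.add_sub_cancel' hnN])
  have := hunique (Nat.find hex - 1) (n + (Nat.find hex' - 1)) (by omega) (by omega)
    (not_not.mp (Nat.find_min hex (by omega)))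
    (by rw [Nat.sub_add_cancel ha]; exact Nat.find_spec hex)
    (not_not.mp (Nat.find_min hex' (by omega)))
    (by rw [add_assoc, Nat.sub_add_cancel hb]; exact Nat.find_spec hex')
  omega

section CoxeterNumber

open MulAction

variable {ι X Y : Type*} [AddCommGroup X] [AddCommGroup Y] {P : RootPairing ι ℤ X Y} [Finite ι]
  {Δ : P.Base} {σ : P.Aut} {l : List ι}

lemma exists_pow_smul_mem_inversions (Δ : P.Base) {τ : P.Aut}
    (hτ : ∀ x : P.rootSpan ℤ, τ • x = x → x = 0) (i : ι) : ∃ k : ℕ, τ ^ k • i ∈ inversions Δ τ := by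
  obtain ⟨k, hpos, hneg⟩ := exists_pos_neg (φ := heightForm Δ) hτ
    (fun i ↦ by simpa [heightForm_spanRoot] using Δ.height_ne_zero i) i
  refine ⟨k, (isPos_iff_heightForm Δ).mpr hpos, (not_isPos_iff_heightForm Δ).mpr ?_⟩
  rwa [smul_smul, ← pow_succ']

namespace IsCoxeterWord

variable (H : IsCoxeterWord Δ σ l)
include H

lemma exists_not_isPos_isPos (i : ι) : ∃ k : ℕ, ¬ Δ.IsPos ((wordProd P l * σ) ^ k • i) ∧
    Δ.IsPos ((wordProd P l * σ) ^ (k + 1) • i) := by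
  obtain ⟨k, hneg, hpos⟩ := exists_pos_neg (τ := wordProd P l * σ) (φ := -heightForm Δ)
    (fun x ↦ H.eq_zero_of_coxeter_smul_eq_self)
    (fun i ↦ by simpa [heightForm_spanRoot] using Δ.height_ne_zero i) i
  rw [LinearMap.neg_apply, neg_pos] at hneg
  rw [LinearMap.neg_apply, neg_lt_zero] at hpos
  exact ⟨k, (not_isPos_iff_heightForm Δ).mpr hneg, (isPos_iff_heightForm Δ).mpr hpos⟩

lemma period_ne_one (i : ι) : period (wordProd P l * σ) i ≠ 1 := by
  intro hperiod
  refine spanRoot_ne_zero i (H.eq_zero_of_coxeter_smul_eq_self ?_)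
  rw [← spanRoot_smul, period_eq_one_iff.mp hperiod]

variable [P.IsReduced]

lemma exists_run (i : ι) : ∃ s, ∃ a ≤ period (wordProd P l * σ) i,
    (∀ k < a, Δ.IsPos ((wordProd P l * σ) ^ k • (wordProd P l * σ) ^ s • i)) ∧
    ∀ k, a ≤ k → k < period (wordProd P l * σ) i →
      ¬ Δ.IsPos ((wordProd P l * σ) ^ k • (wordProd P l * σ) ^ s • i) := by
  obtain ⟨s, hneg, hpos⟩ := H.exists_not_isPos_isPos i
  set τ := wordProd P l * σ with hτ
  have hp : 0 < period τ i := period_pos τ i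
  set j := τ ^ (s + 1) • i
  have hperiod : period τ j = period τ i := period_pow_smul τ _ i
  have hlast : ¬ Δ.IsPos (τ ^ (period τ i - 1) • j) := by
    convert hneg using 2
    apply MulAction.injective τ
    dsimp only
    rw [smul_smul, ← pow_succ', Nat.sub_add_cancel hp, ← hperiod, pow_period_smul, smul_smul,
      ← pow_succ']
  obtain ⟨a, ha, hrun, hrun'⟩ := exists_threshold (p := fun n ↦ Δ.IsPos (τ ^ n • j))
    (by simpa using hpos) hlast fun m n hmn hn hm hm' hn₁ hn' ↦ by
      rw [pow_succ', mul_smul] at hm' hn'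
      obtain ⟨d, rfl⟩ := Nat.exists_eq_add_of_le' hmn
      rw [pow_add, mul_smul] at hn₁ hn'
      have heq := H.eq_of_mem_inversions (k := d) ⟨hm, hm'⟩ ⟨hn₁, hn'⟩
      rw [← hτ, eq_comm, pow_smul_eq_iff_period_dvd, period_pow_smul, hperiod] at heq
      have := Nat.eq_zero_of_dvd_of_lt heq (by omega)
      omega
  exact ⟨s + 1, a, by omega, hrun, fun k hk hkp ↦ hrun' k hk (by omega)⟩

lemma eigenForm_ne_zero {φ : P.rootSpan ℤ →ₗ[ℤ] ℤ}
    (hφ : ∀ i, Δ.IsPos i → 0 ≤ φ (spanRoot P i)) {i : ι}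
    (hne : ∃ k : ℕ, φ (spanRoot P ((wordProd P l * σ) ^ k • i)) ≠ 0) :
    eigenForm (wordProd P l * σ)
      (Complex.exp (2 * Real.pi * Complex.I / period (wordProd P l * σ) i)) φ
      (spanRoot P i) ≠ 0 := by
  obtain ⟨s, a, ha, hpos, hneg⟩ := H.exists_run i
  obtain ⟨k, hk⟩ := hne
  set τ := wordProd P l * σ
  have hζ : Complex.exp (2 * Real.pi * Complex.I / period τ i) ^ rootOrder τ = 1 :=
    ((Complex.isPrimitiveRoot_exp _ (period_pos τ i).ne').pow_eq_one_iff_dvd _).mpr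
      (period_dvd_rootOrder τ i)
  rw [← eigenForm_pow_smul hζ s, ← spanRoot_smul]
  rw [← period_pow_smul τ s] at ha hneg ⊢
  refine mul_ne_zero (pow_ne_zero _ (Complex.exp_ne_zero _))
    (eigenForm_ne_zero_of_run (fun x ↦ H.eq_zero_of_coxeter_smul_eq_self) hφ ha hpos hneg
      ⟨k + s * (rootOrder τ - 1), ?_⟩)
  have hsum : k + s * (rootOrder τ - 1) + s = k + s * rootOrder τ := by
    rw [add_assoc, ← Nat.mul_add_one, Nat.sub_add_cancel (rootOrder_pos τ)]
  rwa [smul_smul, ← pow_add, hsum, pow_add_mul_smul]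

lemma eigenForm_orbitCoweight_ne_zero (hconn : IsConnectedDynkin Δ) (i : ι) (α : Δ.support) :
    eigenForm (wordProd P l * σ)
      (Complex.exp (2 * Real.pi * Complex.I / period (wordProd P l * σ) i))
      (orbitCoweight Δ σ α) (spanRoot P i) ≠ 0 := by
  refine H.eigenForm_ne_zero (fun i hi ↦ orbitCoweight_nonneg hi α) ?_
  obtain ⟨k, hk⟩ := H.exists_fundCoweight_ne_zero hconn i α
  refine ⟨k, fun hzero ↦ hk ?_⟩
  set j := (wordProd P l * σ) ^ k • i
  by_cases hj : Δ.IsPos j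
  · exact le_antisymm (hzero ▸ fundCoweight_le_orbitCoweight hj α)
      (fundCoweight_nonneg_of_isPos hj α)
  · rw [← isPos_reflection_self] at hj
    have hle := fundCoweight_le_orbitCoweight (σ := σ) hj α
    have hnonneg := fundCoweight_nonneg_of_isPos hj α
    rw [spanRoot_reflection_self, map_neg] at hle hnonneg
    rw [map_neg, hzero] at hle
    linarith

lemma pow_period_eq_one {i : ι} (hi : i ∈ inversions Δ (wordProd P l * σ)) {ζ : ℂ}
    (hζ : ζ ^ rootOrder (wordProd P l * σ) = 1) (hζ1 : ζ ≠ 1)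
    (hne : ∀ j ∈ l, ∃ x, eigenForm (wordProd P l * σ) ζ (orbitCoweight Δ σ j) x ≠ 0) :
    ζ ^ period (wordProd P l * σ) i = 1 := by
  obtain ⟨a, j, b, hl, hj⟩ := H.exists_suffix_coxeter_smul_eq hi
  obtain ⟨x, hx⟩ := hne j (by simp [hl])
  set τ := wordProd P l * σ
  let ψ : P.rootSpan ℤ →ₗ[ℤ] ℤ := orbitCoweight Δ σ j - orbitCoweight Δ σ j ∘ₗ spanMap τ
  have hψ (x : P.rootSpan ℤ) :
      ψ x = orbitCoweight Δ σ j x - orbitCoweight Δ σ j (τ • x) := rfl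
  have hcoroot (x : P.rootSpan ℤ) : ψ x = P.coroot' i (x : X) := by
    rw [hψ, H.orbitCoweight_coxeter_smul_of_suffix hl hj, sub_sub_cancel]
  have heigen : eigenForm τ ζ ψ x =
      eigenForm τ ζ (orbitCoweight Δ σ j) x - eigenForm τ ζ (orbitCoweight Δ σ j) (τ • x) := by
    simp only [eigenForm_apply, hψ, Int.cast_sub, mul_sub, Finset.sum_sub_distrib, smul_smul,
      ← pow_succ, ← pow_succ']
  refine pow_eq_one_of_eigenForm_ne_zero hζ (φ := ψ) (fun x ↦ ?_) (x := x) ?_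
  · have hperiod := coroot'_smul (τ ^ period τ i) i (x : X)
    rwa [pow_period_smul, ← coe_smul, ← hcoroot, ← hcoroot] at hperiod
  · rw [heigen, sub_ne_zero]
    intro heq
    have hscale := eigenForm_smul (φ := orbitCoweight Δ σ j) hζ x
    rw [← heq] at hscale
    exact hζ1 (mul_right_cancel₀ hx (hscale.trans (one_mul _).symm))

lemma period_dvd_period (hconn : IsConnectedDynkin Δ) (i j : ι) :
    period (wordProd P l * σ) i ∣ period (wordProd P l * σ) j := by
  obtain ⟨k, hk⟩ := exists_pow_smul_mem_inversions Δ
    (fun x ↦ H.eq_zero_of_coxeter_smul_eq_self) j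
  have hprim := Complex.isPrimitiveRoot_exp _ (period_pos (wordProd P l * σ) i).ne'
  rw [← period_pow_smul _ k j]
  refine hprim.dvd_of_pow_eq_one _ (H.pow_period_eq_one hk
    ((hprim.pow_eq_one_iff_dvd _).mpr (period_dvd_rootOrder _ i)) (hprim.ne_one ?_) fun r hr ↦
    ⟨spanRoot P i, H.eigenForm_orbitCoweight_ne_zero hconn i ⟨r, H.mem r hr⟩⟩)
  have := period_pos (wordProd P l * σ) i
  have := H.period_ne_one i
  omega

lemma period_eq_rootOrder (hconn : IsConnectedDynkin Δ) (i : ι) :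
    period (wordProd P l * σ) i = rootOrder (wordProd P l * σ) := by
  refine Nat.dvd_antisymm (period_dvd_rootOrder _ i) (rootOrder_dvd fun j ↦ ?_)
  exact pow_smul_eq_iff_period_dvd.mpr (H.period_dvd_period hconn j i)

end IsCoxeterWord

end CoxeterNumber

/-! ### The Coxeter plane and the adapted base -/

section Sinusoids

open Real

/-- The sinusoid of frequency one with amplitudes `a` and `b`. -/
def sinusoid (a b x : ℝ) : ℝ := a * cos x + b * sin x

variable {a b x y z : ℝ}

lemma sin_sub_mul_sinusoid :
    sin (z - x) * sinusoid a b y = sin (z - y) * sinusoid a b x + sin (y - x) * sinusoid a b z := by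
  simp only [sinusoid, sin_sub]
  ring

lemma sinusoid_pos_of_pos_of_neg (hxy : x < y) (hyz : y < z) (hzx : z ≤ x + π)
    (hy : 0 < sinusoid a b y) (hz : sinusoid a b z < 0) : 0 < sinusoid a b x := by
  have hzy_sin : 0 < sin (z - y) := sin_pos_of_pos_of_lt_pi (by linarith) (by linarith)
  have hyx_sin : 0 < sin (y - x) := sin_pos_of_pos_of_lt_pi (by linarith) (by linarith)
  have hzx_sin : 0 ≤ sin (z - x) := sin_nonneg_of_nonneg_of_le_pi (by linarith) (by linarith)
  have hsin := sin_sub_mul_sinusoid (a := a) (b := b) (x := x) (y := y) (z := z)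
  refine (mul_pos_iff_of_pos_left hzy_sin).mp ?_
  linarith [mul_nonneg hzx_sin hy.le, mul_neg_of_pos_of_neg hyx_sin hz]

lemma sinusoid_neg_of_pos_of_neg (hxy : x < y) (hyz : y < z) (hzx : z ≤ x + π)
    (hx : 0 < sinusoid a b x) (hy : sinusoid a b y < 0) : sinusoid a b z < 0 := by
  have hzy_sin : 0 < sin (z - y) := sin_pos_of_pos_of_lt_pi (by linarith) (by linarith)
  have hyx_sin : 0 < sin (y - x) := sin_pos_of_pos_of_lt_pi (by linarith) (by linarith)
  have hzx_sin : 0 ≤ sin (z - x) := sin_nonneg_of_nonneg_of_le_pi (by linarith) (by linarith)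
  have hsin := sin_sub_mul_sinusoid (a := a) (b := b) (x := x) (y := y) (z := z)
  refine neg_of_mul_neg_right (a := sin (y - x)) ?_ hyx_sin.le
  linarith [mul_nonpos_of_nonneg_of_nonpos hzx_sin hy.le, mul_pos hzy_sin hx]

end Sinusoids

section CoxeterPlane

open Real

variable {ι X Y : Type*} [AddCommGroup X] [AddCommGroup Y] {P : RootPairing ι ℤ X Y}

/-- A linear form whose positive roots are those of `Δ` and whose values along a `τ`-orbit of roots
sample a sinusoid at the angles `2πk/h`. Such a form is a chamber in the Coxeter plane, on which `τ`
acts as the rotation by `2π/h`. -/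
structure IsCoxeterPlaneForm (Δ : P.Base) (τ : P.Aut) (φ : P.rootSpan ℤ →ₗ[ℤ] ℝ) : Prop where
  isPos_iff : ∀ i, Δ.IsPos i ↔ 0 < φ (spanRoot P i)
  not_isPos_iff : ∀ i, ¬ Δ.IsPos i ↔ φ (spanRoot P i) < 0
  exists_sinusoid : ∀ i, ∃ a b, ∀ k : ℕ,
    φ (spanRoot P (τ ^ k • i)) = sinusoid a b (k * (2 * π / rootOrder τ))

lemma exists_re_mul_ne_zero {κ : Type*} [Finite κ] (z : κ → ℂ) (hz : ∀ i, z i ≠ 0) :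
    ∃ c : ℂ, ∀ i, (c * z i).re ≠ 0 := by
  obtain ⟨t, ht⟩ := (Set.finite_range fun i ↦ (z i).re / (z i).im).exists_notMem
  refine ⟨1 + t * Complex.I, fun i hzero ↦ ?_⟩
  simp only [add_mul, one_mul, mul_assoc, Complex.add_re, Complex.re_ofReal_mul, Complex.I_mul_re,
    mul_neg, ← sub_eq_add_neg, sub_eq_zero] at hzero
  by_cases him : (z i).im = 0
  · rw [him, mul_zero] at hzero
    exact hz i (Complex.ext hzero him)
  · exact ht ⟨i, div_eq_of_eq_mul him hzero⟩

lemma ncard_le_of_orbits [Finite ι] {τ : P.Aut} {E E' : Set ι}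
    (hE : ∀ x ∈ E, ∀ k : ℕ, τ ^ k • x ∈ E → x = τ ^ k • x)
    (hE' : ∀ x, ∃ k : ℕ, τ ^ k • x ∈ E') : E.ncard ≤ E'.ncard := by
  choose f hf using hE'
  refine Set.ncard_le_ncard_of_injOn (fun x ↦ τ ^ f x • x) (fun x _ ↦ hf x) (fun x hx y hy hxy ↦ ?_)
    (Set.toFinite _)
  obtain ⟨k, hk⟩ := exists_pow_smul_eq_zpow_smul τ (-(f y : ℤ) + f x)
  obtain rfl : τ ^ k • x = y := by
    rw [← hk, zpow_add, mul_smul, zpow_natCast]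
    change τ ^ f x • x = τ ^ f y • y at hxy
    rw [hxy, zpow_neg, zpow_natCast, inv_smul_smul]
  exact hE x hx k hy

namespace IsCoxeterPlaneForm

variable [Finite ι] {Δ : P.Base} {τ : P.Aut} {φ : P.rootSpan ℤ →ₗ[ℤ] ℝ}
  (h : IsCoxeterPlaneForm Δ τ φ)
include h

lemma exists_angle (i : ι) : ∃ a b θ, 0 < θ ∧ (∀ n : ℕ, 2 * n ≤ rootOrder τ → n * θ ≤ 0 + π) ∧
    (∀ k : ℕ, Δ.IsPos (τ ^ k • i) ↔ 0 < sinusoid a b (k * θ)) ∧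
    ∀ k : ℕ, ¬ Δ.IsPos (τ ^ k • i) ↔ sinusoid a b (k * θ) < 0 := by
  obtain ⟨a, b, hab⟩ := h.exists_sinusoid i
  have hN : (0 : ℝ) < rootOrder τ := by exact_mod_cast rootOrder_pos τ
  refine ⟨a, b, 2 * π / rootOrder τ, by positivity, fun n hn ↦ ?_, fun k ↦ ?_, fun k ↦ ?_⟩
  · have hn : (2 * n : ℝ) ≤ rootOrder τ := by exact_mod_cast hn
    rw [zero_add, mul_div_assoc', div_le_iff₀ hN]
    linarith [mul_le_mul_of_nonneg_right hn pi_pos.le]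
  · rw [h.isPos_iff, hab]
  · rw [h.not_isPos_iff, hab]

lemma not_isPos_pow_smul {i : ι} {m n : ℕ} (hmn : m ≤ n) (hn : 2 * n ≤ rootOrder τ)
    (hi : Δ.IsPos i) (hm : ¬ Δ.IsPos (τ ^ m • i)) : ¬ Δ.IsPos (τ ^ n • i) := by
  obtain rfl | hlt := hmn.eq_or_lt
  · exact hm
  have hm₀ : 0 < m := Nat.pos_of_ne_zero (by rintro rfl; simp [hi] at hm)
  obtain ⟨a, b, θ, hθ, hle, hpos, hneg⟩ := h.exists_angle i
  refine (hneg n).mpr (sinusoid_neg_of_pos_of_neg (y := m * θ) (by positivity) (by gcongr)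
    (hle n hn) ?_ ((hneg m).mp hm))
  simpa [hi] using hpos 0

lemma isPos_of_pow_smul {i : ι} {m n : ℕ} (hmn : m < n) (hn : 2 * n ≤ rootOrder τ)
    (hm : Δ.IsPos (τ ^ m • i)) (hneg : ¬ Δ.IsPos (τ ^ n • i)) : Δ.IsPos i := by
  by_contra hi
  have hm₀ : 0 < m := Nat.pos_of_ne_zero (by rintro rfl; simp [hi] at hm)
  obtain ⟨a, b, θ, hθ, hle, hpos, hneg'⟩ := h.exists_angle i
  have hzero := sinusoid_pos_of_pos_of_neg (x := 0) (by positivity) (by gcongr) (hle n hn)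
    ((hpos m).mp hm) ((hneg' n).mp hneg)
  exact hi (by simpa [hzero] using hpos 0)

lemma eq_of_mem_inversions {i : ι} {k : ℕ} (hi : i ∈ inversions Δ τ)
    (hk : τ ^ k • i ∈ inversions Δ τ) : i = τ ^ k • i := by
  have hneg {j : ι} {m : ℕ} (hj : j ∈ inversions Δ τ) (hm₀ : 1 ≤ m) (hm : 2 * m ≤ rootOrder τ) :
      ¬ Δ.IsPos (τ ^ m • j) :=
    h.not_isPos_pow_smul hm₀ hm hj.1 (by simpa only [pow_one] using hj.2)
  have hmod : τ ^ (k % rootOrder τ) • i = τ ^ k • i := by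
    rw [← pow_add_mul_smul τ _ (k / rootOrder τ), mul_comm, Nat.mod_add_div]
  have hlt := Nat.mod_lt k (rootOrder_pos τ)
  rw [← hmod] at hk ⊢
  set r := k % rootOrder τ
  obtain hr | hr := Nat.eq_zero_or_pos r
  · rw [hr, pow_zero, one_smul]
  obtain hle | hgt := le_or_gt (2 * r) (rootOrder τ)
  · exact absurd hk.1 (hneg hi hr hle)
  · have hback := hneg hk (m := rootOrder τ - r) (by omega) (by omega)
    rw [smul_smul, ← pow_add, Nat.sub_add_cancel hlt.le, pow_rootOrder_smul] at hback
    exact absurd hi.1 hback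

lemma inversions_pow_succ {i : ℕ} (hi : 2 * (i + 1) ≤ rootOrder τ) :
    inversions Δ (τ ^ (i + 1)) =
      inversions Δ (τ ^ i) ∪ (τ ^ i • ·) ⁻¹' inversions Δ τ := by
  ext x
  simp only [Set.mem_union, Set.mem_preimage, mem_inversions, smul_smul, ← pow_succ']
  refine ⟨fun ⟨hx, hneg⟩ ↦ ?_, ?_⟩
  · by_cases hpos : Δ.IsPos (τ ^ i • x)
    exacts [.inr ⟨hpos, hneg⟩, .inl ⟨hx, hpos⟩]
  · rintro (⟨hx, hneg⟩ | ⟨hpos, hneg⟩)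
    exacts [⟨hx, h.not_isPos_pow_smul i.le_succ hi hx hneg⟩,
      ⟨h.isPos_of_pow_smul i.lt_succ_self hi hpos hneg, hneg⟩]

lemma ncard_inversions_pow {i : ℕ} (hi : 2 * i ≤ rootOrder τ) :
    (inversions Δ (τ ^ i)).ncard = i * (inversions Δ τ).ncard := by
  induction i with
  | zero => rw [pow_zero, inversions_one, Set.ncard_empty, zero_mul]
  | succ i ih =>
    have hdisj : Disjoint (inversions Δ (τ ^ i)) ((τ ^ i • ·) ⁻¹' inversions Δ τ) :=
      Set.disjoint_left.mpr fun _ hneg hpos ↦ hneg.2 hpos.1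
    rw [h.inversions_pow_succ hi, Set.ncard_union_eq hdisj (Set.toFinite _) (Set.toFinite _),
      ih (by omega), add_mul, one_mul, Set.ncard_preimage_of_injective_subset_range
        (MulAction.injective (τ ^ i))]
    rw [(MulAction.surjective (τ ^ i)).range_eq]
    exact Set.subset_univ _

end IsCoxeterPlaneForm

lemma exists_isCoxeterPlaneForm [Finite ι] [P.IsReduced] (Δ : P.Base) {τ : P.Aut}
    {F : P.rootSpan ℤ →+ ℂ} (hF : ∀ i, F (spanRoot P i) ≠ 0)
    (hτ : ∀ (k : ℕ) x, Complex.exp (2 * π * Complex.I / rootOrder τ) ^ k * F (τ ^ k • x) = F x) :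
    ∃ u ∈ P.weylGroup, ∃ φ, IsCoxeterPlaneForm (smulBase u Δ) τ φ := by
  obtain ⟨c, hc⟩ := exists_re_mul_ne_zero (fun i ↦ F (spanRoot P i)) hF
  let φ : P.rootSpan ℤ →ₗ[ℤ] ℝ :=
    (Complex.reAddGroupHom.comp ((AddMonoidHom.mulLeft c).comp F)).toIntLinearMap
  have hφ (x : P.rootSpan ℤ) : φ x = (c * F x).re := rfl
  obtain ⟨u, hu, hpos⟩ := exists_base_of_regular Δ φ fun i ↦ hc i
  refine ⟨u, hu, φ, hpos, fun i ↦ ?_, fun i ↦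
    ⟨(c * F (spanRoot P i)).re, (c * F (spanRoot P i)).im, fun k ↦ ?_⟩⟩
  · rw [hpos, not_lt]
    exact ⟨fun hle ↦ lt_of_le_of_ne hle (hc i), le_of_lt⟩
  · set θ : ℝ := k * (2 * π / rootOrder τ) with hθ
    have hexp :
        Complex.exp (2 * π * Complex.I / rootOrder τ) ^ k = Complex.exp (θ * Complex.I) := by
      rw [← Complex.exp_nat_mul, hθ]
      congr 1
      push_cast
      ring
    have hrot : c * F (spanRoot P (τ ^ k • i)) =
        Complex.exp (-θ * Complex.I) * (c * F (spanRoot P i)) := by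
      rw [← hτ k (spanRoot P i), hexp, ← spanRoot_smul, mul_left_comm c,
        ← mul_assoc (Complex.exp (-θ * _)), ← Complex.exp_add, ← add_mul, neg_add_cancel, zero_mul,
        Complex.exp_zero, one_mul]
    rw [hφ, hrot, ← Complex.ofReal_neg, Complex.mul_re, Complex.exp_ofReal_mul_I_re,
      Complex.exp_ofReal_mul_I_im, cos_neg, sin_neg, sinusoid]
    ring

end CoxeterPlane

section AdaptedBase

variable {ι X Y : Type*} [AddCommGroup X] [AddCommGroup Y] {P : RootPairing ι ℤ X Y} {Δ : P.Base}
  {σ : P.Aut} {l : List ι}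

lemma ncard_inversions_mul_of_stable (g : P.Aut)
    (hσ : ∀ i, σ • i ∈ Δ.support ↔ i ∈ Δ.support) :
    (inversions Δ (g * σ)).ncard = (inversions Δ g).ncard := by
  have hpreimage : inversions Δ (g * σ) = (σ • ·) ⁻¹' inversions Δ g := by
    ext i
    simp only [Set.mem_preimage, mem_inversions, mul_smul, isPos_smul_of_stable hσ]
  rw [hpreimage, Set.ncard_preimage_of_injective_subset_range (MulAction.injective σ)]
  rw [(MulAction.surjective σ).range_eq]
  exact Set.subset_univ _

namespace IsCoxeterWord

lemma conj (H : IsCoxeterWord Δ σ l) (u : P.Aut) :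
    IsCoxeterWord (smulBase u Δ) (u * σ * u⁻¹) (l.map (u • ·)) where
  stable i := by
    rw [mem_smulBase, mem_smulBase, ← H.stable (u⁻¹ • i)]
    simp only [mul_smul, inv_smul_smul]
  mem := by
    simp only [List.mem_map, forall_exists_index, and_imp, forall_apply_eq_imp_iff₂]
    exact fun i hi ↦ (smul_mem_smulBase u Δ i).mpr (H.mem i hi)
  nodup := H.nodup.map (MulAction.injective u)
  transversal j hj := by
    obtain ⟨i, ⟨hi, m, hm⟩, huniq⟩ := H.transversal (u⁻¹ • j) ((mem_smulBase u Δ).mp hj)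
    have hconj (m : ℤ) : (u * σ * u⁻¹) ^ m • j = u • σ ^ m • u⁻¹ • j := by
      rw [conj_zpow, mul_smul, mul_smul]
    refine ⟨u • i, ⟨List.mem_map_of_mem hi, m, by rw [hconj, hm]⟩, ?_⟩
    rintro _ ⟨hmem, m', hm'⟩
    obtain ⟨i', hi', rfl⟩ := List.mem_map.mp hmem
    rw [hconj, smul_left_cancel_iff] at hm'
    rw [huniq i' ⟨hi', m', hm'⟩]

variable (H : IsCoxeterWord Δ σ l)
include H

lemma of_length_eq {m : List ι} (hm : ∀ i ∈ m, i ∈ Δ.support) (hlen : m.length = l.length)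
    (hmeet : ∀ j ∈ Δ.support, ∃ i ∈ m, ∃ n : ℤ, σ ^ n • j = i) : IsCoxeterWord Δ σ m := by
  let orbit : ι → MulAction.orbitRel.Quotient (Subgroup.zpowers σ) ι := Quotient.mk _
  have horbit (i j : ι) : orbit i = orbit j ↔ ∃ n : ℤ, σ ^ n • j = i := by
    rw [Quotient.eq, MulAction.orbitRel_apply, MulAction.mem_orbit_iff]
    simp only [Subtype.exists, exists_prop, Subgroup.mk_smul,
      Subgroup.mem_zpowers_iff, exists_exists_eq_and]
  have hnodup_l : (l.map orbit).Nodup :=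
    H.nodup.map_on fun i hi j hj hij ↦ H.eq_of_orbit hi hj ((horbit i j).mp hij)
  have hsubset : l.map orbit ⊆ m.map orbit := by
    rintro _ hx
    obtain ⟨j, hj, rfl⟩ := List.mem_map.mp hx
    obtain ⟨i, hi, hij⟩ := hmeet j (H.mem j hj)
    exact (horbit i j).mpr hij ▸ List.mem_map_of_mem hi
  have hnodup : (m.map orbit).Nodup :=
    ((hnodup_l.subperm hsubset).perm_of_length_le (by simp [hlen])).nodup_iff.mp hnodup_l
  refine ⟨H.stable, hm, hnodup.of_map, fun j hj ↦ ?_⟩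
  obtain ⟨i, hi, hij⟩ := hmeet j hj
  refine ⟨i, ⟨hi, hij⟩, fun i' ⟨hi', hij'⟩ ↦ List.inj_on_of_nodup_map hnodup hi' hi ?_⟩
  rw [(horbit i' j).mpr hij', (horbit i j).mpr hij]

end IsCoxeterWord

variable [Finite ι]

lemma exists_mem_orbit_of_fixedPointFree (hσ : ∀ i, σ • i ∈ Δ.support ↔ i ∈ Δ.support)
    (hl : ∀ i ∈ l, i ∈ Δ.support)
    (hfix : ∀ x : P.rootSpan ℤ, (wordProd P l * σ) • x = x → x = 0) {j : ι}
    (hj : j ∈ Δ.support) : ∃ i ∈ l, ∃ m : ℤ, σ ^ m • j = i := by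
  by_contra! hno
  have hzero : orbitCoweight Δ σ j = 0 := by
    refine eq_zero_of_invariant hfix fun x ↦ ?_
    rw [mul_smul, apply_wordProd_smul, orbitCoweight_smul hσ]
    exact fun i hi ↦ orbitCoweight_of_not_orbit (hl i hi) fun ⟨m, hm⟩ ↦ hno i hi m hm
  have hone := orbitCoweight_of_orbit (Δ := Δ) (σ := σ) (i := j) (j := j) hj ⟨0, by simp⟩
  rw [hzero] at hone
  exact zero_ne_one hone

variable [P.IsReduced]

namespace IsCoxeterWord

variable (H : IsCoxeterWord Δ σ l)
include H

lemma ncard_inversions_coxeter : (inversions Δ (wordProd P l * σ)).ncard = l.length := by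
  rw [ncard_inversions_mul_of_stable _ H.stable, H.ncard_inversions_wordProd]

lemma exists_base_ncard_inversions_pow (hconn : IsConnectedDynkin Δ) : ∃ u ∈ P.weylGroup,
    (inversions (smulBase u Δ) (wordProd P l * σ)).ncard = l.length ∧
    ∀ i, 2 * i ≤ rootOrder (wordProd P l * σ) →
      (inversions (smulBase u Δ) ((wordProd P l * σ) ^ i)).ncard = i * l.length := by
  set τ := wordProd P l * σ with hτ
  have hfix (x : P.rootSpan ℤ) : τ • x = x → x = 0 := H.eq_zero_of_coxeter_smul_eq_self
  have hprim := Complex.isPrimitiveRoot_exp (rootOrder τ) (rootOrder_pos τ).ne'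
  obtain ⟨u, hu, φ, h⟩ := exists_isCoxeterPlaneForm Δ (τ := τ)
    (F := (eigenForm τ (Complex.exp (2 * Real.pi * Complex.I / rootOrder τ))
      (heightForm Δ)).toAddMonoidHom)
    (fun i ↦ by
      rw [hτ, ← H.period_eq_rootOrder hconn i]
      refine H.eigenForm_ne_zero (fun i hi ↦ ((isPos_iff_heightForm Δ).mp hi).le) ⟨0, ?_⟩
      rw [heightForm_spanRoot]
      exact Δ.height_ne_zero _)
    (fun k x ↦ eigenForm_pow_smul hprim.pow_eq_one k x)
  have hcard : (inversions (smulBase u Δ) τ).ncard = l.length := by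
    rw [← H.ncard_inversions_coxeter]
    exact (ncard_le_of_orbits (fun x hx k ↦ h.eq_of_mem_inversions hx)
      (exists_pow_smul_mem_inversions Δ hfix)).antisymm
      (ncard_le_of_orbits (fun x hx k ↦ H.eq_of_mem_inversions hx)
        (exists_pow_smul_mem_inversions _ hfix))
  exact ⟨u, hu, hcard, fun i hi ↦ hcard ▸ h.ncard_inversions_pow hi⟩

lemma exists_isCoxeterWord_smulBase {u : P.Aut} (hu : u ∈ P.weylGroup)
    (hcard : (inversions (smulBase u Δ) (wordProd P l * σ)).ncard = l.length) :
    ∃ m, IsCoxeterWord (smulBase u Δ) (u * σ * u⁻¹) m ∧ m.length = l.length ∧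
      wordProd P m * (u * σ * u⁻¹) = wordProd P l * σ := by
  have hconj := H.conj u
  set τ := wordProd P l * σ with hτ
  set σ' := u * σ * u⁻¹ with hσ'
  have hweyl : τ * σ'⁻¹ ∈ P.weylGroup := by
    have hmem := mul_mem (mul_mem (wordProd_mem (P := P) l) (conj_mem_weylGroup σ hu)) (inv_mem hu)
    convert hmem using 1
    rw [hτ, hσ']
    group
  obtain ⟨m₀, hm₀, hprod₀⟩ := exists_word (smulBase u Δ) hweyl
  obtain ⟨m, hm, hlen, hprod⟩ := exists_reduced_word _ m₀ hm₀
  have hτm : wordProd P m * σ' = τ := by rw [hprod, hprod₀, inv_mul_cancel_right]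
  have hlen' : m.length = l.length := by
    rw [hlen, ← hprod, ← hcard, ← hτm, ncard_inversions_mul_of_stable _ hconj.stable]
  refine ⟨m, hconj.of_length_eq hm (by rw [hlen', List.length_map]) fun j hj ↦ ?_, hlen', hτm⟩
  exact exists_mem_orbit_of_fixedPointFree hconj.stable hm
    (fun x hx ↦ H.eq_zero_of_coxeter_smul_eq_self (by rwa [hτm] at hx)) hj

end IsCoxeterWord

end AdaptedBase

section Translation

variable {ι X Y : Type*} [AddCommGroup X] [AddCommGroup Y] {P : RootPairing ι ℤ X Y}

lemma weightHom_zpow_root_eq_iff (g : P.Aut) (m : ℤ) (i j : ι) :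
    (Equiv.weightHom P g ^ m) (P.root i) = P.root j ↔ g ^ m • i = j := by
  rw [← map_zpow, weightHom_root, P.root.injective.eq_iff]

lemma partialProd_succ (σ c : X ≃ₗ[ℤ] X) (i : ℕ) :
    partialProd σ c (i + 1) = partialProd σ c i * (σ ^ i * c * (σ ^ i)⁻¹) := by
  rw [partialProd, partialProd, List.range_succ, List.map_append, List.prod_append,
    List.map_singleton, List.prod_singleton]

lemma partialProd_eq (σ c : X ≃ₗ[ℤ] X) (i : ℕ) :
    partialProd σ c i = (c * σ) ^ i * (σ ^ i)⁻¹ := by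
  induction i with
  | zero => rw [pow_zero, pow_zero, inv_one, mul_one]; rfl
  | succ i ih =>
    rw [partialProd_succ, ih, pow_succ (c * σ), pow_succ σ]
    group

lemma partialProd_weightHom (σ c : P.Aut) (i : ℕ) :
    partialProd (Equiv.weightHom P σ) (Equiv.weightHom P c) i =
      Equiv.weightHom P ((c * σ) ^ i * (σ ^ i)⁻¹) := by
  rw [partialProd_eq, map_mul, map_inv, map_pow, map_pow, map_mul]

variable {Δ : P.Base} {σ : P.Aut} {l : List ι}

namespace IsCoxeterWord

variable (H : IsCoxeterWord Δ σ l)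
include H

lemma image_support : Equiv.weightHom P σ '' (P.root '' Δ.support) = P.root '' Δ.support := by
  rw [Set.image_image]
  simp only [weightHom_root]
  rw [← Set.image_image P.root (σ • ·)]
  congr 1
  refine Set.Subset.antisymm (Set.image_subset_iff.mpr fun i hi ↦ (H.stable i).mpr hi) fun i hi ↦
    ⟨σ⁻¹ • i, ?_, smul_inv_smul σ i⟩
  exact (H.stable _).mp (by rwa [smul_inv_smul])

end IsCoxeterWord

variable [Finite ι]

lemma orderOnRoots_weightHom_le (τ : P.Aut) :
    orderOnRoots P (Equiv.weightHom P τ) ≤ rootOrder τ := by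
  refine Nat.sInf_le ⟨rootOrder_pos τ, fun i ↦ ?_⟩
  rw [← map_pow, weightHom_root, pow_rootOrder_smul]

namespace IsCoxeterWord

variable [P.IsReduced] (H : IsCoxeterWord Δ σ l)
include H

lemma len_eq_length : len Δ (Equiv.weightHom P (wordProd P l)) = l.length := by
  rw [len_weightHom _ (wordProd_mem l), H.ncard_inversions_wordProd]

lemma isTwistedCoxeter :
    IsTwistedCoxeter Δ (Equiv.weightHom P σ) (Equiv.weightHom P (wordProd P l)) := by
  refine ⟨l, ⟨H.mem, (weightHom_wordProd l).symm⟩, H.len_eq_length.symm, H.nodup, fun j hj ↦ ?_⟩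
  simpa only [weightHom_zpow_root_eq_iff] using H.transversal j hj

lemma len_partialProd (i : ℕ) :
    len Δ (partialProd (Equiv.weightHom P σ) (Equiv.weightHom P (wordProd P l)) i) =
      (inversions Δ ((wordProd P l * σ) ^ i)).ncard := by
  have hσ (j : ι) : σ ^ i • j ∈ Δ.support ↔ j ∈ Δ.support := by
    simpa only [zpow_natCast] using zpow_smul_mem_support H.stable (i : ℤ) j
  rw [partialProd_weightHom, len_weightHom _ (coxeter_pow_mul_mem l σ i),
    ← ncard_inversions_mul_of_stable _ hσ, inv_mul_cancel_right]

theorem exists_reduced_partialProd (hconn : IsConnectedDynkin Δ) :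
    ∃ (u : P.Aut) (σ' : P.Aut) (m : List ι), IsCoxeterWord (smulBase u Δ) σ' m ∧
      wordProd P m * σ' = wordProd P l * σ ∧
      ∀ i, 2 * i ≤ orderOnRoots P (Equiv.weightHom P (wordProd P l * σ)) →
        len (smulBase u Δ)
            (partialProd (Equiv.weightHom P σ') (Equiv.weightHom P (wordProd P m)) i) =
          i * len (smulBase u Δ) (Equiv.weightHom P (wordProd P m)) := by
  obtain ⟨u, hu, hcard, hpow⟩ := H.exists_base_ncard_inversions_pow hconn
  obtain ⟨m, H', hlen, hτ⟩ := H.exists_isCoxeterWord_smulBase hu hcard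
  refine ⟨u, _, m, H', hτ, fun i hi ↦ ?_⟩
  rw [H'.len_partialProd, hτ, hpow i (hi.trans (orderOnRoots_weightHom_le _)), H'.len_eq_length,
    hlen]

end IsCoxeterWord

end Translation

/-! ### Curves in the Lang preimage of a cocharacter -/

section Arithmetic

/-- Running the recursion downwards from the zeros of `b` gives `E ∣ b k` for all `k`; running it
upwards, if `b k = 0` then `q ∣ a k`, so the bound on `a k` gives `a k = b (k + 1) = 0`. -/
lemma eq_zero_of_periodic_recursion {a b : ℕ → ℤ} {q E : ℤ} {N : ℕ} (hE : E ≠ 0)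
    (hN : 0 < N) (ha : ∀ k, |a k| < q) (hab : ∀ k, q * b (k + 1) - b k = E * a k)
    (hper : ∀ m, b (m * N) = 0) (k : ℕ) : a k = 0 := by
  have hq : q ≠ 0 := ((abs_nonneg _).trans_lt (ha 0)).ne'
  have dvd_of_eq_zero (j : ℕ) : ∀ k, b (k + j) = 0 → E ∣ b k := by
    induction j with
    | zero => exact fun k hk ↦ hk ▸ dvd_zero E
    | succ j ih =>
      intro k hk
      rw [← sub_sub_cancel (q * b (k + 1)) (b k), hab]
      exact dvd_sub ((ih (k + 1) (by rwa [add_assoc, add_comm 1 j])).mul_left q) (dvd_mul_right _ _)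
  have hdvd (k : ℕ) : E ∣ b k := by
    refine dvd_of_eq_zero (k * N - k) k ?_
    rw [Nat.add_sub_cancel' (Nat.le_mul_of_pos_right k hN), hper]
  have vanish_step (k : ℕ) (hk : b k = 0) : b (k + 1) = 0 ∧ a k = 0 := by
    obtain ⟨c, hc⟩ := hdvd (k + 1)
    have hqc : q * c = a k := mul_left_cancel₀ hE (by linear_combination hab k - q * hc + hk)
    have hak : a k = 0 := Int.eq_zero_of_abs_lt_dvd ⟨c, hqc.symm⟩ (ha k)
    exact ⟨by rw [hc, (mul_eq_zero.mp (hqc.trans hak)).resolve_left hq, mul_zero], hak⟩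
  have hb (k : ℕ) : b k = 0 := by
    induction k with
    | zero => simpa only [zero_mul] using hper 0
    | succ k ih => exact (vanish_step k ih).1
  exact (vanish_step k (hb k)).2

end Arithmetic

section LangMap

variable {X : Type*} [AddCommGroup X] [Module.Free ℤ X]

lemma ker_smul_sub_one_eq_bot {q : ℕ} (hq : 2 ≤ q) (τ : X ≃ₗ[ℤ] X) :
    LinearMap.ker ((q : ℤ) • (τ : X →ₗ[ℤ] X) - 1) = ⊥ := by
  refine LinearMap.ker_eq_bot'.mpr fun x hx ↦ ?_
  have hτx : (q : ℤ) • τ x = x := sub_eq_zero.mp hx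
  have hpow (n : ℕ) : (q : ℤ) ^ n • (τ ^ n) x = x := by
    induction n with
    | zero => rw [pow_zero, pow_zero, one_smul]; rfl
    | succ n ih =>
      rw [pow_succ', pow_succ', mul_smul, LinearEquiv.mul_apply, ← τ.map_smul, ih, hτx]
  have b := Module.Free.chooseBasis ℤ X
  refine b.ext_elem fun i ↦ ?_
  have hdvd (n : ℕ) : q ^ n ∣ (b.repr x i).natAbs := by
    rw [← Int.natCast_dvd, Nat.cast_pow]
    refine ⟨b.repr ((τ ^ n) x) i, ?_⟩
    conv_lhs => rw [← hpow n]
    rw [map_smul, Finsupp.smul_apply, smul_eq_mul]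
  by_contra h0
  rw [map_zero, Finsupp.zero_apply] at h0
  exact (Nat.lt_pow_self hq).not_ge
    (Nat.le_of_dvd (Int.natAbs_pos.mpr h0) (hdvd (b.repr x i).natAbs))

lemma exists_comp_eq_smul [Module.Finite ℤ X] (A : X →ₗ[ℤ] X) (hA : LinearMap.ker A = ⊥) :
    ∃ e : ℤ, e ≠ 0 ∧ ∀ φ : X →ₗ[ℤ] ℤ, ∃ ψ : X →ₗ[ℤ] ℤ, ∀ x, ψ (A x) = e * φ x := by
  classical
  have b := Module.Free.chooseBasis ℤ X
  let M := LinearMap.toMatrix b b A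
  have hM : (Matrix.toLin b b M.adjugate).comp A = M.det • LinearMap.id := by
    conv_lhs => rw [← Matrix.toLin_toMatrix b b A]
    rw [← Matrix.toLin_mul, Matrix.adjugate_mul, map_smul, Matrix.toLin_one]
  refine ⟨M.det, ?_, fun φ ↦ ⟨φ.comp (Matrix.toLin b b M.adjugate), fun x ↦ ?_⟩⟩
  · rw [LinearMap.det_toMatrix]
    exact fun h ↦ (LinearMap.bot_lt_ker_of_det_eq_zero h).ne' hA
  · rw [LinearMap.comp_apply, ← LinearMap.comp_apply _ A, hM, LinearMap.smul_apply,
      LinearMap.id_apply, map_smul, smul_eq_mul]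

end LangMap

section Curves

variable {X κ : Type*} [AddCommGroup X] [Field κ]

lemma finite_zeros_laurent {A : Type*} (f : A →₀ κ) (d : A → ℤ) {z₀ : κˣ}
    (h0 : (f.sum fun x a ↦ a * ((z₀ ^ d x : κˣ) : κ)) ≠ 0) :
    {z : κˣ | (f.sum fun x a ↦ a * ((z ^ d x : κˣ) : κ)) = 0}.Finite := by
  obtain ⟨N, hN⟩ : ∃ N : ℕ, ∀ x ∈ f.support, 0 ≤ d x + N := by
    refine ⟨∑ x ∈ f.support, (d x).natAbs, fun x hx ↦ ?_⟩
    have := Finset.single_le_sum (f := fun x ↦ (d x).natAbs) (fun _ _ ↦ Nat.zero_le _) hx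
    lia
  let p : Polynomial κ := ∑ x ∈ f.support, Polynomial.monomial (d x + N).toNat (f x)
  have hp (z : κˣ) :
      p.eval (z : κ) = (f.sum fun x a ↦ a * ((z ^ d x : κˣ) : κ)) * (z : κ) ^ N := by
    rw [Polynomial.eval_finsetSum, Finsupp.sum, Finset.sum_mul]
    refine Finset.sum_congr rfl fun x hx ↦ ?_
    rw [Polynomial.eval_monomial, mul_assoc, ← Units.val_pow_eq_pow_val,
      ← Units.val_pow_eq_pow_val, ← Units.val_mul, ← zpow_natCast, ← zpow_natCast, ← zpow_add,
      Int.toNat_of_nonneg (hN x hx)]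
  have hp0 : p ≠ 0 := fun h ↦ by
    refine mul_ne_zero h0 (pow_ne_zero N z₀.ne_zero) ?_
    rw [← hp, h, Polynomial.eval_zero]
  refine .of_injOn (f := ((↑) : κˣ → κ)) (t := {z | p.IsRoot z}) (fun z hz ↦ ?_)
    Units.val_injective.injOn (Polynomial.finite_setOfPred_isRoot hp0)
  change p.eval (z : κ) = 0
  rw [hp z, show _ = _ from hz, zero_mul]

/-- The one-parameter subgroup of the torus with character group `X` that is attached to a linear
form on `X`. -/
def curve (κ : Type*) [Field κ] (ψ : X →ₗ[ℤ] ℤ) (z : κˣ) : TorusPts X κ where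
  toFun x := z ^ ψ x.toAdd
  map_one' := by rw [toAdd_one, map_zero, zpow_zero]
  map_mul' x y := by rw [toAdd_mul, map_add, zpow_add]

lemma curve_apply (ψ : X →ₗ[ℤ] ℤ) (z : κˣ) (x : X) :
    curve κ ψ z (Multiplicative.ofAdd x) = z ^ ψ x := rfl

lemma curve_one (ψ : X →ₗ[ℤ] ℤ) : curve κ ψ 1 = 1 := MonoidHom.ext fun x ↦ one_zpow (ψ x.toAdd)

lemma infinite_units [Infinite κ] : Infinite κˣ := by
  have : Infinite ({0}ᶜ : Set κ) := (Set.finite_singleton 0).infinite_compl.to_subtype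
  refine .of_injective (fun x : ({0}ᶜ : Set κ) ↦ Units.mk0 (x : κ) x.2) fun x y h ↦ ?_
  exact Subtype.ext (congrArg Units.val h)

lemma isPreconnected_range_curve [Infinite κ] (ψ : X →ₗ[ℤ] ℤ) :
    @IsPreconnected _ (zariski X κ) (Set.range (curve κ ψ)) := by
  let _ := zariski X κ
  have cofinite (U : Set (TorusPts X κ)) (hU : IsOpen U) :
      (Set.range (curve κ ψ) ∩ U).Nonempty → {z | curve κ ψ z ∉ U}.Finite := by
    induction hU with
    | basic U h =>
      obtain ⟨f, rfl⟩ := h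
      rintro ⟨_, ⟨z₀, rfl⟩, h0⟩
      exact (finite_zeros_laurent f ψ h0).subset fun z hz ↦ not_not.mp hz
    | univ => simp
    | inter U V _ _ hU hV =>
      rintro ⟨x, hx, hxU, hxV⟩
      exact ((hU ⟨x, hx, hxU⟩).union (hV ⟨x, hx, hxV⟩)).subset fun z hz ↦ not_and_or.mp hz
    | sUnion S _ ih =>
      rintro ⟨x, hx, U, hU, hxU⟩
      exact (ih U hU ⟨x, hx, hxU⟩).subset fun z hz hzU ↦ hz ⟨U, hU, hzU⟩
  refine IsPreirreducible.isPreconnected fun U V hU hV hCU hCV ↦ ?_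
  have := infinite_units (κ := κ)
  obtain ⟨z, hz⟩ := ((cofinite U hU hCU).union (cofinite V hV hCV)).exists_notMem
  rw [Set.mem_union, not_or] at hz
  exact ⟨_, ⟨z, rfl⟩, not_not.mp hz.1, not_not.mp hz.2⟩

lemma exists_zpow_ne_one [Infinite κ] {d : ℤ} (hd : d ≠ 0) : ∃ z : κˣ, z ^ d ≠ 1 := by
  by_contra! h
  have : NeZero d.natAbs := ⟨Int.natAbs_ne_zero.mpr hd⟩
  have := infinite_units (κ := κ)
  refine not_finite_iff_infinite.mpr this (Finite.of_injective
    (fun z : κˣ ↦ (⟨z, pow_natAbs_eq_one.mpr (h z)⟩ : rootsOfUnity d.natAbs κ)) fun _ _ h ↦ ?_)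
  exact congrArg Subtype.val h

end Curves

section IdentityComponent

variable {ι X Y κ : Type*} [AddCommGroup X] [AddCommGroup Y] {P : RootPairing ι ℤ X Y} [Field κ]

lemma curve_mem_langPreimage {q : ℕ} {τ : X ≃ₗ[ℤ] X} {ψ : X →ₗ[ℤ] ℤ} {e : ℤ} {ν : Y}
    (hψ : ∀ x, q * ψ (τ x) - ψ x = e * P.toLinearMap x ν) (z : κˣ) :
    curve κ ψ z ∈ langPreimage P q τ ν := by
  refine ⟨z ^ e, fun x ↦ ?_⟩
  have hfrob : frob q τ (curve κ ψ z) (Multiplicative.ofAdd x) =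
    curve κ ψ z (Multiplicative.ofAdd (τ x)) ^ q := rfl
  rw [MonoidHom.mul_apply, MonoidHom.inv_apply, hfrob, curve_apply, curve_apply, ← zpow_mul, ← hψ,
    ← zpow_natCast, ← zpow_mul, ← zpow_neg, ← zpow_add]
  congr 1
  ring

lemma not_idComponent_subset_kerChar_of_form [Infinite κ] {q : ℕ} {τ : X ≃ₗ[ℤ] X}
    {ψ : X →ₗ[ℤ] ℤ} {e : ℤ} {ν : Y} (hψ : ∀ x, q * ψ (τ x) - ψ x = e * P.toLinearMap x ν) {x : X}
    (hx : ψ x ≠ 0) : ¬ idComponent (langPreimage (κ := κ) P q τ ν) ⊆ kerChar x := by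
  obtain ⟨z, hz⟩ := exists_zpow_ne_one (κ := κ) hx
  let _ := zariski X κ
  have hmem : curve κ ψ z ∈ idComponent (langPreimage P q τ ν) :=
    (isPreconnected_range_curve ψ).subset_connectedComponentIn ⟨1, curve_one ψ⟩
      (Set.range_subset_iff.mpr (curve_mem_langPreimage hψ)) ⟨z, rfl⟩
  exact fun hsub ↦ hz (hsub hmem)

variable [Finite ι] [Module.Finite ℤ X] {Δ : P.Base}

theorem not_idComponent_subset_kerChar [Infinite κ] {τ : P.Aut} {q : ℕ} {α : Δ.support} {ν : Y}
    (hν : IsCoweightLift Δ α ν) (hlt : ∀ i, |fundCoweight Δ α (spanRoot P i)| < q)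
    (hne : ∀ i, ∃ k : ℕ, fundCoweight Δ α (spanRoot P (τ ^ k • i)) ≠ 0) (j : ι) :
    ¬ idComponent (langPreimage (κ := κ) P q (Equiv.weightHom P τ) ν) ⊆ kerChar (P.root j) := by
  have : Module.IsReflexive ℤ X := .of_isPerfPair P.toLinearMap
  have : Module.IsTorsionFree ℤ X := inferInstance
  have : Module.Free ℤ X := inferInstance
  obtain ⟨k, hk⟩ := hne j
  have hq : 2 ≤ q := by
    have := hlt (τ ^ k • j)
    have := Int.one_le_abs hk
    lia
  obtain ⟨e, he, hform⟩ :=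
    exists_comp_eq_smul _ (ker_smul_sub_one_eq_bot hq (Equiv.weightHom P τ))
  obtain ⟨ψ, hψ⟩ := hform (P.toLinearMap.flip ν)
  have hψ' (x : X) : q * ψ (Equiv.weightHom P τ x) - ψ x = e * P.toLinearMap x ν := by
    rw [← LinearMap.flip_apply, ← hψ x, LinearMap.sub_apply, map_sub, LinearMap.smul_apply,
      ψ.map_smul]
    rfl
  refine not_idComponent_subset_kerChar_of_form hψ' fun h0 ↦ hk ?_
  obtain ⟨m, hm, hmν⟩ := hν
  refine eq_zero_of_periodic_recursion (b := fun k ↦ ψ (P.root (τ ^ k • j))) (q := q) (E := e * m)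
    (a := fun k ↦ fundCoweight Δ α (spanRoot P (τ ^ k • j)))
    (mul_ne_zero he hm) (rootOrder_pos τ) (fun k ↦ hlt _) (fun k ↦ ?_) (fun n ↦ ?_) k
  · rw [pow_succ', mul_smul, ← weightHom_root, hψ', mul_assoc, ← hmν]
  · have := pow_add_mul_smul τ 0 n j
    rw [zero_add, pow_zero, one_smul] at this
    rw [this, h0]

end IdentityComponent

/-! ### Automorphisms induced by the normalizer of the torus -/

section Transvections

variable {R M : Type*} [CommRing R] [AddCommGroup M] [Module R M]

lemma transvection_pow {f : Module.Dual R M} {v : M} (hfv : f v = 0) (n : ℕ) :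
    LinearMap.transvection f v ^ n = LinearMap.transvection f ((n : R) • v) := by
  induction n with
  | zero => rw [pow_zero, Nat.cast_zero, zero_smul, LinearMap.transvection.of_right_eq_zero]; rfl
  | succ n ih =>
    rw [pow_succ, ih, Module.End.mul_eq_comp, LinearMap.transvection.comp_of_left_eq hfv,
      Nat.cast_succ, add_smul, one_smul]

lemma eq_zero_of_isOfFinOrder_transvection [IsDomain R] [CharZero R] [Module.IsTorsionFree R M]
    {f : Module.Dual R M} {v : M} (hv : v ≠ 0) (hfv : f v = 0)
    (h : IsOfFinOrder (LinearMap.transvection f v)) : f = 0 := by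
  obtain ⟨n, hn, hpow⟩ := h.exists_pow_eq_one
  rw [transvection_pow hfv] at hpow
  refine LinearMap.ext fun x ↦ ?_
  have hx := LinearMap.congr_fun hpow x
  rw [LinearMap.transvection.apply, Module.End.one_apply, add_eq_left, smul_smul] at hx
  exact (mul_eq_zero.mp ((smul_eq_zero.mp hx).resolve_right hv)).resolve_right
    (Nat.cast_ne_zero.mpr hn.ne')

end Transvections

section Normalizers

variable {ι X Y : Type*} [AddCommGroup X] [AddCommGroup Y] {P : RootPairing ι ℤ X Y} [Finite ι]

lemma exists_perm_of_symm_mem_roots {τ : X ≃ₗ[ℤ] X}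
    (h : ∀ i, τ.symm (P.root i) ∈ Set.range P.root) :
    ∃ e : ι ≃ ι, ∀ i, τ (P.root i) = P.root (e i) := by
  choose f hf using h
  have hinj : Function.Injective f := fun i j hij ↦ by
    refine P.root.injective (τ.symm.injective ?_)
    rw [← hf, ← hf, hij]
  let e := Equiv.ofBijective f (Finite.injective_iff_bijective.mp hinj)
  refine ⟨e.symm, fun i ↦ ?_⟩
  obtain ⟨j, rfl⟩ := e.surjective i
  rw [Equiv.symm_apply_apply, Equiv.ofBijective_apply, hf, LinearEquiv.apply_symm_apply]

variable [P.IsReduced]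

lemma isOfFinOrder_of_mem_weyl (Δ : P.Base) {w : X ≃ₗ[ℤ] X} (hw : w ∈ weyl P) :
    IsOfFinOrder w := by
  rw [weyl, ← range_weylGroup_weightHom] at hw
  obtain ⟨⟨g, hg⟩, rfl⟩ := hw
  change IsOfFinOrder (Equiv.weightHom P g)
  refine (Equiv.weightHom P).isOfFinOrder
    (isOfFinOrder_iff_pow_eq_one.mpr ⟨rootOrder g, rootOrder_pos g, ?_⟩)
  refine eq_one_of_ncard_inversions_eq_zero (Δ := Δ) (pow_mem hg _) ?_
  rw [Set.ncard_eq_zero]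
  refine Set.eq_empty_of_forall_notMem fun i hi ↦ hi.2 ?_
  rw [pow_rootOrder_smul]
  exact hi.1

/-- The element `τ⁻¹ sᵢ τ sⱼ` of the Weyl group is the transvection along the root `j` with linear
form `coroot' j - coroot' i ∘ τ`; it has finite order only if this form is zero. -/
lemma coroot'_comp_eq_of_normalizes [Module.IsTorsionFree ℤ X] (Δ : P.Base) {τ : X ≃ₗ[ℤ] X}
    (hW : ∀ w ∈ weyl P, τ⁻¹ * w * τ ∈ weyl P) {i j : ι} (hij : τ (P.root j) = P.root i) :
    P.coroot' i ∘ₗ τ = P.coroot' j := by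
  set u : X ≃ₗ[ℤ] X := τ⁻¹ * P.reflection i * τ * P.reflection j
  set f : Module.Dual ℤ X := P.coroot' j - P.coroot' i ∘ₗ τ with hf
  have htwo (i : ι) : P.coroot' i (P.root i) = 2 := P.root_coroot_two i
  have hroot : τ.symm (P.root i) = P.root j := by rw [← hij, τ.symm_apply_apply]
  have hfj : f (P.root j) = 0 := by
    rw [hf, LinearMap.sub_apply, LinearMap.comp_apply, LinearEquiv.coe_coe, hij, htwo, htwo,
      sub_self]
  have hu : u ∈ weyl P :=
    mul_mem (hW _ (Subgroup.subset_closure ⟨i, rfl⟩)) (Subgroup.subset_closure ⟨j, rfl⟩)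
  have htrans : (u : X →ₗ[ℤ] X) = LinearMap.transvection f (P.root j) := by
    ext x
    change τ.symm (P.reflection i (τ (P.reflection j x))) =
      x + (P.coroot' j x - P.coroot' i (τ x)) • P.root j
    rw [reflection_apply, reflection_apply, map_sub, map_sub, map_sub, map_sub, τ.map_smul, hij,
      (P.coroot' i).map_smul, τ.symm.map_smul, τ.symm.map_smul, hroot, τ.symm_apply_apply, htwo]
    module
  have hfin : IsOfFinOrder (LinearMap.transvection f (P.root j)) :=
    htrans ▸ (LinearEquiv.automorphismGroup.toLinearMapMonoidHom (R := ℤ) (M := X)).isOfFinOrder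
      (isOfFinOrder_of_mem_weyl Δ hu)
  exact (sub_eq_zero.mp (eq_zero_of_isOfFinOrder_transvection (P.ne_zero j) hfj hfin)).symm

lemma exists_aut_of_normalizes [Module.IsTorsionFree ℤ X] (Δ : P.Base) {τ : X ≃ₗ[ℤ] X}
    (hroot : ∀ i, τ.symm (P.root i) ∈ Set.range P.root)
    (hW : ∀ w ∈ weyl P, τ⁻¹ * w * τ ∈ weyl P) : ∃ t : P.Aut, Equiv.weightHom P t = τ := by
  obtain ⟨e, he⟩ := exists_perm_of_symm_mem_roots hroot
  let D : Y ≃ₗ[ℤ] Y := P.flip.toPerfPair.trans (τ.dualMap.trans P.flip.toPerfPair.symm)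
  have hD (x : X) (y : Y) : P.toLinearMap x (D y) = P.toLinearMap (τ x) y :=
    LinearMap.apply_toPerfPair_flip P.toLinearMap _ x
  refine ⟨{ weightMap := τ
            coweightMap := D
            indexEquiv := e
            weight_coweight_transpose := LinearMap.ext fun y ↦ LinearMap.ext fun x ↦ (hD x y).symm
            root_weightMap := funext he
            coroot_coweightMap := funext fun i ↦ ?_
            bijective_weightMap := τ.bijective
            bijective_coweightMap := D.bijective }, LinearEquiv.ext fun _ ↦ rfl⟩
  refine P.flip.toPerfPair.injective (LinearMap.ext fun x ↦ (hD x _).trans ?_)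
  exact LinearMap.congr_fun
    (coroot'_comp_eq_of_normalizes Δ hW ((he _).trans (by rw [e.apply_symm_apply]))) x

end Normalizers

section Heights

variable {ι X Y : Type*} [AddCommGroup X] [AddCommGroup Y] {P : RootPairing ι ℤ X Y}
  {Δ : P.Base}

lemma abs_fundCoweight_le_maxMark [Finite ι] {i₀ : ι} (hi₀ : IsHighestRoot Δ i₀)
    (α : Δ.support) (i : ι) : |fundCoweight Δ α (spanRoot P i)| ≤ maxMark Δ i₀ := by
  have hle (j : ι) : fundCoweight Δ α (spanRoot P j) ≤ maxMark Δ i₀ := by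
    have hdiff := (mem_closure_root_iff Δ (x := spanRoot P i₀ - spanRoot P j)).mp (hi₀ j) α
    rw [map_sub] at hdiff
    exact (sub_nonneg.mp hdiff).trans
      (le_ciSup (f := fun α : Δ.support ↦ fundCoweight Δ α (P.rootSpanMem ℤ i₀))
        (Set.finite_range _).bddAbove α)
  have hneg := hle (Equiv.reflection P i • i)
  rw [spanRoot_reflection_self, map_neg] at hneg
  exact abs_le.mpr ⟨neg_le.mp hneg, hle i⟩

lemma mem_support_of_height_eq_one {i : ι} (hi : Δ.height i = 1) : i ∈ Δ.support := by
  classical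
  have hpos : Δ.IsPos i := by rw [Base.isPos_iff, hi]; exact one_pos
  have hnonneg (β : Δ.support) := fundCoweight_nonneg_of_isPos hpos β
  obtain ⟨α, hα⟩ := (isPos_iff_exists_fundCoweight_pos Δ).mp hpos
  rw [← heightForm_spanRoot, heightForm_apply, ← Finset.add_sum_erase _ _ (Finset.mem_univ α)] at hi
  have hrest := (Finset.sum_eq_zero_iff_of_nonneg fun β _ ↦ hnonneg β).mp <|
    le_antisymm (by linarith) (Finset.sum_nonneg fun β (_ : β ∈ Finset.univ.erase α) ↦ hnonneg β)
  rw [Finset.sum_eq_zero hrest, add_zero] at hi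
  have hiα : spanRoot P i = spanRoot P α := eq_of_fundCoweight Δ fun β ↦ by
    obtain rfl | hβ := eq_or_ne β α
    · rw [hi, fundCoweight_self]
    · rw [hrest β (Finset.mem_erase.mpr ⟨hβ, Finset.mem_univ β⟩), fundCoweight_ne Δ hβ]
  have : i = α := P.root.injective (congrArg Subtype.val hiα)
  exact this ▸ α.2

variable {σ : P.Aut} (hσ : ∀ i ∈ Δ.support, Δ.IsPos (σ • i))
include hσ

lemma height_le_height_smul {j : ι} (hj : Δ.IsPos j) : Δ.height j ≤ Δ.height (σ • j) := by
  have hle := apply_nonneg_of_isPos (φ := heightForm Δ ∘ₗ spanMap σ - heightForm Δ)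
    (fun i hi ↦ ?_) hj
  · rw [LinearMap.sub_apply, LinearMap.comp_apply, DistribSMul.toLinearMap_apply, ← spanRoot_smul,
      heightForm_spanRoot, heightForm_spanRoot] at hle
    exact sub_nonneg.mp hle
  · rw [LinearMap.sub_apply, LinearMap.comp_apply, DistribSMul.toLinearMap_apply, ← spanRoot_smul,
      heightForm_spanRoot, heightForm_spanRoot, Base.height_one_of_mem_support hi, sub_nonneg]
    exact (Base.isPos_iff Δ).mp (hσ i hi)

lemma mem_support_of_smul_mem_support {j : ι} (hj : σ • j ∈ Δ.support) : j ∈ Δ.support := by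
  have hpos : Δ.IsPos j := (isPos_smul_iff hσ).mp (Base.isPos_of_mem_support hj)
  have hle := height_le_height_smul hσ hpos
  rw [Base.height_one_of_mem_support hj] at hle
  exact mem_support_of_height_eq_one (le_antisymm hle ((Base.isPos_iff Δ).mp hpos))

lemma smul_mem_support_iff {i : ι} : σ • i ∈ Δ.support ↔ i ∈ Δ.support := by
  refine ⟨mem_support_of_smul_mem_support hσ, fun hi ↦ ?_⟩
  refine mem_support_of_smul_mem_support (σ := σ⁻¹) (fun j hj ↦ ?_) (by rwa [inv_smul_smul])
  rw [← isPos_smul_iff hσ, smul_inv_smul]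
  exact Base.isPos_of_mem_support hj

end Heights

section TwistedCoxeter

variable {ι X Y : Type*} [AddCommGroup X] [AddCommGroup Y] {P : RootPairing ι ℤ X Y}
  {Δ : P.Base}

/-- The definition of a Coxeter pair presents the twisted Coxeter element with the twist
`σ = τ w` on the right of `w`; here `τ = σ w⁻¹ = (σ w⁻¹ σ⁻¹) σ` is rewritten in the form `c σ`. -/
lemma exists_isCoxeterWord {τ : P.Aut} {w : X ≃ₗ[ℤ] X}
    (hw : IsTwistedCoxeter Δ (Equiv.weightHom P τ * w) w)
    (hpos : ∀ i j, Δ.IsPos i → (Equiv.weightHom P τ * w) (P.root j) = P.root i → Δ.IsPos j) :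
    ∃ (σ : P.Aut) (l : List ι), IsCoxeterWord Δ σ l ∧ wordProd P l * σ = τ := by
  obtain ⟨l, ⟨hl, rfl⟩, -, hnodup, htransversal⟩ := hw
  rw [← weightHom_wordProd, ← map_mul] at htransversal hpos
  simp only [weightHom_zpow_root_eq_iff] at htransversal
  set σ := τ * wordProd P l with hσ
  have hstable (i : ι) : σ • i ∈ Δ.support ↔ i ∈ Δ.support := by
    have hinv : ∀ i ∈ Δ.support, Δ.IsPos (σ⁻¹ • i) := fun i hi ↦
      hpos i _ (Base.isPos_of_mem_support hi) (by rw [weightHom_root, smul_inv_smul])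
    rw [← smul_mem_support_iff hinv, inv_smul_smul]
  refine ⟨σ, (l.map (σ • ·)).reverse, ⟨hstable, ?_, ?_, fun j hj ↦ ?_⟩, ?_⟩
  · intro i hi
    obtain ⟨a, ha, rfl⟩ := List.mem_map.mp (List.mem_reverse.mp hi)
    exact (hstable a).mpr (hl a ha)
  · exact List.nodup_reverse.mpr (hnodup.map (MulAction.injective σ))
  · obtain ⟨i, ⟨hi, m, hm⟩, huniq⟩ := htransversal j hj
    refine ⟨σ • i, ⟨List.mem_reverse.mpr (List.mem_map_of_mem hi), 1 + m, ?_⟩, ?_⟩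
    · rw [zpow_add, zpow_one, mul_smul, hm]
    rintro i' ⟨hi', m', hm'⟩
    obtain ⟨a, ha, rfl⟩ := List.mem_map.mp (List.mem_reverse.mp hi')
    rw [huniq a ⟨ha, -1 + m', by rw [zpow_add, mul_smul, hm', zpow_neg_one, inv_smul_smul]⟩]
  · rw [wordProd_reverse, wordProd_map_smul, hσ]
    group

end TwistedCoxeter

/-! ### Rational structures and weights -/

section DualNumbers

variable {m R S : Type*} [CommRing R] [CommRing S]

/-- The ring homomorphism `R[ε] → S[ε]` fixing `ε` that extends a ring homomorphism `R → S`. -/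
def dualMap (φ : R →+* S) : DualNumber R →+* DualNumber S where
  toFun x := TrivSqZeroExt.inl (φ x.fst) + TrivSqZeroExt.inr (φ x.snd)
  map_one' := by ext <;> simp
  map_zero' := by ext <;> simp
  map_mul' x y := by ext <;> simp
  map_add' x y := by ext <;> simp

lemma dualMap_comp_algebraMap (φ : R →+* S) :
    (dualMap φ).comp (algebraMap R (DualNumber R)) = (algebraMap S (DualNumber S)).comp φ := by
  ext x <;> simp [dualMap, TrivSqZeroExt.algebraMap_eq_inl]

variable [DecidableEq m]

/-- The matrix `1 + εN`, the point of `GL_n(R[ε])` that represents the tangent vector `N` at the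
identity. -/
def tangentPoint (N : Matrix m m R) : Matrix m m (DualNumber R) :=
  (1 : Matrix m m R).map (algebraMap R (DualNumber R)) + N.map TrivSqZeroExt.inr

lemma dualMap_tangentPoint (φ : R →+* S) (N : Matrix m m R) (i j : m) :
    dualMap φ (tangentPoint N i j) = tangentPoint (N.map φ) i j := by
  by_cases hij : i = j <;> ext <;>
    simp [dualMap, tangentPoint, hij, TrivSqZeroExt.algebraMap_eq_inl]

lemma conj_tangentPoint [Fintype m] (g : GL m R) (N : Matrix m m R) :
    g.val.map (algebraMap R (DualNumber R)) * tangentPoint N *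
      g⁻¹.val.map (algebraMap R (DualNumber R)) = tangentPoint (g.val * N * g⁻¹.val) := by
  rw [tangentPoint, tangentPoint, mul_add, add_mul, ← Matrix.map_mul, ← Matrix.map_mul, mul_one,
    Units.mul_inv]
  congr 1
  ext i j <;>
    simp [Matrix.mul_apply, TrivSqZeroExt.algebraMap_eq_inl, TrivSqZeroExt.snd_sum,
      TrivSqZeroExt.fst_sum, mul_comm]

end DualNumbers

section Conjugation

variable {n : ℕ} {Ω : Type*} [Field Ω]

lemma map_conj_inv {A : Type*} [Group A] (g : A) (H : Subgroup A) :
    (H.map (MulAut.conj g).toMonoidHom).map (MulAut.conj g⁻¹).toMonoidHom = H := by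
  rw [Subgroup.map_map]
  convert! Subgroup.map_id H
  ext x
  change g⁻¹ * (g * x * g⁻¹) * g⁻¹⁻¹ = x
  group

variable {H H' T T' : Subgroup (GL (Fin n) Ω)} {g : GL (Fin n) Ω}

/-- The polynomial map `f ↦ (x ↦ f (g x g⁻¹))` on polynomials in the matrix entries. -/
def conjPoly (g : GL (Fin n) Ω) :
    MvPolynomial (Fin n × Fin n) Ω →ₐ[Ω] MvPolynomial (Fin n × Fin n) Ω :=
  MvPolynomial.aeval fun p ↦ ∑ a, ∑ b,
    MvPolynomial.C (g.val p.1 a) * MvPolynomial.X (a, b) * MvPolynomial.C (g⁻¹.val b p.2)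

lemma aeval_conjPoly {A : Type*} [CommRing A] [Algebra Ω A] (g : GL (Fin n) Ω)
    (M : Matrix (Fin n) (Fin n) A) (f : MvPolynomial (Fin n × Fin n) Ω) :
    MvPolynomial.aeval (fun p ↦ M p.1 p.2) (conjPoly g f) = MvPolynomial.aeval (fun p ↦
      (g.val.map (algebraMap Ω A) * M * g⁻¹.val.map (algebraMap Ω A)) p.1 p.2) f := by
  rw [conjPoly, ← AlgHom.comp_apply]
  congr 1
  ext p
  rw [Matrix.mul_assoc]
  simp only [AlgHom.comp_apply, MvPolynomial.aeval_X, map_sum, map_mul, MvPolynomial.aeval_C,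
    Matrix.mul_apply, Matrix.map_apply, Finset.mul_sum, mul_assoc]

lemma conjPoly_mem_vanishing {f : MvPolynomial (Fin n × Fin n) Ω}
    (hf : f ∈ vanishing (H.map (MulAut.conj g).toMonoidHom)) : conjPoly g f ∈ vanishing H := by
  intro x hx
  have heval := aeval_conjPoly g x.val f
  simp only [MvPolynomial.aeval_eq_eval, Algebra.algebraMap_self] at heval
  exact heval.trans (hf (g * x * g⁻¹) ⟨x, hx, rfl⟩)

lemma mem_lieAlg_iff {N : Matrix (Fin n) (Fin n) Ω} :
    N ∈ lieAlg H ↔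
      ∀ f ∈ vanishing H, MvPolynomial.aeval (fun p ↦ tangentPoint N p.1 p.2) f = 0 :=
  Iff.rfl

lemma conj_mem_lieAlg {N : Matrix (Fin n) (Fin n) Ω} (hN : N ∈ lieAlg H) :
    g.val * N * g⁻¹.val ∈ lieAlg (H.map (MulAut.conj g).toMonoidHom) := by
  rw [mem_lieAlg_iff] at hN ⊢
  intro f hf
  rw [← conj_tangentPoint, ← aeval_conjPoly]
  exact hN _ (conjPoly_mem_vanishing hf)

lemma IsWeight.conj {χ : T →* Ωˣ} {χ' : T' →* Ωˣ} (hχ : IsWeight H χ)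
    (hH : H.map (MulAut.conj g).toMonoidHom = H') (hT : T.map (MulAut.conj g).toMonoidHom = T')
    (hχ' : ∀ (t : T) (t' : T'), (t' : GL (Fin n) Ω) = g * t * g⁻¹ → χ' t' = χ t) :
    IsWeight H' χ' := by
  obtain ⟨hne, N, hN, hN₀, hweight⟩ := hχ
  subst hH hT
  refine ⟨fun h ↦ hne ?_, g.val * N * g⁻¹.val, conj_mem_lieAlg hN, ?_, ?_⟩
  · ext t : 1
    rw [← hχ' t ⟨_, t, t.2, rfl⟩ rfl, h, MonoidHom.one_apply, MonoidHom.one_apply]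
  · rwa [Ne, Units.mul_left_eq_zero, Units.mul_right_eq_zero]
  · rintro ⟨_, t, ht, rfl⟩
    rw [hχ' ⟨t, ht⟩ _ rfl, ← Matrix.smul_mul, ← Matrix.mul_smul, ← hweight]
    change (g * t * g⁻¹).val * (g.val * N * g⁻¹.val) * (g * t * g⁻¹)⁻¹.val = _
    simp only [mul_inv_rev, inv_inv, Units.val_mul, Matrix.mul_assoc, Units.inv_mul_cancel_left]

end Conjugation

section RationalStructures

variable {n : ℕ} {k Ω : Type*} [Field k] [Field Ω] [Algebra k Ω]
  {H H₀ T T₀ : Subgroup (GL (Fin n) Ω)} {g : GL (Fin n) Ω}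

lemma IsDefinedOver.map_eq_zero {A : Type*} [CommRing A] (hH : IsDefinedOver k H)
    {φ : MvPolynomial (Fin n × Fin n) Ω →+* A}
    (hφ : ∀ p, MvPolynomial.map (algebraMap k Ω) p ∈ vanishing H →
      φ (MvPolynomial.map (algebraMap k Ω) p) = 0)
    {f : MvPolynomial (Fin n × Fin n) Ω} (hf : f ∈ vanishing H) : φ f = 0 := by
  have hle : vanishing H ≤ RingHom.ker φ := by
    rw [← hH.2, Ideal.map_le_iff_le_comap]
    exact hφ
  exact hle hf

lemma IsDefinedOver.frobGL_mem (hH : IsDefinedOver k H) (Fr : Ω ≃ₐ[k] Ω) (hg : g ∈ H) :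
    frobGL Fr g ∈ H := by
  refine hH.1 _ fun f hf ↦ hH.map_eq_zero (φ := MvPolynomial.eval _) (fun p hp ↦ ?_) hf
  have hFr : (Fr : Ω →+* Ω).comp (algebraMap k Ω) = algebraMap k Ω := Fr.toAlgHom.comp_algebraMap
  have hzero := congrArg (Fr : Ω →+* Ω) (hp g hg)
  rwa [MvPolynomial.eval_map, map_zero, MvPolynomial.hom_eval₂, hFr, ← MvPolynomial.eval_map]
    at hzero

lemma frobGL_symm_apply (Fr : Ω ≃ₐ[k] Ω) (g : GL (Fin n) Ω) :
    frobGL Fr (frobGL Fr.symm g) = g := by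
  ext i j
  exact Fr.apply_symm_apply _

lemma IsDefinedOver.map_frobGL (hH : IsDefinedOver k H) (Fr : Ω ≃ₐ[k] Ω) :
    H.map (frobGL Fr) = H := by
  refine le_antisymm (Subgroup.map_le_iff_le_comap.mpr fun g hg ↦ hH.frobGL_mem Fr hg) fun g hg ↦ ?_
  exact ⟨_, hH.frobGL_mem Fr.symm hg, frobGL_symm_apply Fr g⟩

lemma IsDefinedOver.map_conj_frobGL (hT : IsDefinedOver k T) (Fr : Ω ≃ₐ[k] Ω)
    (hg : T.map (MulAut.conj g).toMonoidHom = T) :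
    T.map (MulAut.conj (frobGL Fr g)).toMonoidHom = T := by
  have hcomp : (MulAut.conj (frobGL Fr g)).toMonoidHom.comp (frobGL Fr) =
      (frobGL Fr).comp (MulAut.conj g).toMonoidHom :=
    MonoidHom.ext fun x ↦ by simp
  conv_lhs => rw [← hT.map_frobGL Fr]
  rw [Subgroup.map_map, hcomp, ← Subgroup.map_map, hg, hT.map_frobGL]

lemma IsDefinedOver.map_mem_lieAlg (hH : IsDefinedOver k H) (Fr : Ω ≃ₐ[k] Ω)
    {N : Matrix (Fin n) (Fin n) Ω} (hN : N ∈ lieAlg H) : N.map Fr ∈ lieAlg H := by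
  rw [mem_lieAlg_iff] at hN ⊢
  intro f hf
  refine hH.map_eq_zero (φ := RingHomClass.toRingHom (MvPolynomial.aeval _)) (fun p hp ↦ ?_) hf
  have hFr : (Fr : Ω →+* Ω).comp (algebraMap k Ω) = algebraMap k Ω := Fr.toAlgHom.comp_algebraMap
  have hpoint : (fun p : Fin n × Fin n ↦ dualMap (Fr : Ω →+* Ω) (tangentPoint N p.1 p.2)) =
      fun p ↦ tangentPoint (N.map Fr) p.1 p.2 := funext fun p ↦ dualMap_tangentPoint _ N p.1 p.2
  have hzero := congrArg (dualMap (Fr : Ω →+* Ω)) (hN _ hp)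
  rwa [map_zero, MvPolynomial.aeval_def, MvPolynomial.eval₂_map, MvPolynomial.hom_eval₂,
    ← RingHom.comp_assoc, dualMap_comp_algebraMap, RingHom.comp_assoc, hFr, hpoint,
    ← MvPolynomial.eval₂_map] at hzero

lemma IsWeight.frob {χ χ' : T →* Ωˣ} (hχ : IsWeight H χ) (Fr : Ω ≃ₐ[k] Ω)
    (hH : IsDefinedOver k H) (hT : IsDefinedOver k T)
    (hχ' : ∀ t t' : T, (t' : GL (Fin n) Ω) = frobGL Fr t → (χ' t' : Ω) = Fr (χ t)) :
    IsWeight H χ' := by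
  obtain ⟨hne, N, hN, hN₀, hweight⟩ := hχ
  refine ⟨fun h ↦ hne ?_, N.map Fr, hH.map_mem_lieAlg Fr hN, fun h ↦ hN₀ ?_, fun t' ↦ ?_⟩
  · ext t
    have hone := hχ' t ⟨_, hT.frobGL_mem Fr t.2⟩ rfl
    rw [h, MonoidHom.one_apply, Units.val_one] at hone
    exact Fr.injective (hone.symm.trans (map_one Fr).symm)
  · exact Matrix.map_injective Fr.injective (h.trans (Matrix.map_zero Fr (map_zero Fr)).symm)
  · set t : T := ⟨frobGL Fr.symm t', hT.frobGL_mem Fr.symm t'.2⟩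
    have ht : (t' : GL (Fin n) Ω) = frobGL Fr t := (frobGL_symm_apply Fr _).symm
    have hmap := congrArg (Fr : Ω →+* Ω).mapMatrix (hweight t)
    rw [map_mul, map_mul] at hmap
    rw [hχ' t t' ht, ht, ← map_inv]
    refine hmap.trans (Matrix.ext fun i j ↦ ?_)
    exact map_mul Fr _ _

lemma IsWeight.of_frob {χ χ' : T →* Ωˣ} (hχ : IsWeight H χ) (Fr : Ω ≃ₐ[k] Ω)
    (hH₀ : IsDefinedOver k H₀) (hT₀ : IsDefinedOver k T₀)
    (hH : H₀.map (MulAut.conj g).toMonoidHom = H) (hT : T₀.map (MulAut.conj g).toMonoidHom = T)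
    (hχ' : ∀ t t' : T, (t' : GL (Fin n) Ω) = g * frobGL Fr (g⁻¹ * (t : GL (Fin n) Ω) * g) * g⁻¹ →
      (χ' t' : Ω) = Fr (χ t)) : IsWeight H χ' := by
  subst hH hT
  set c := (MulAut.conj g).toMonoidHom.subgroupMap T₀
  have hχ₀ : IsWeight H₀ (χ.comp c) :=
    hχ.conj (map_conj_inv g H₀) (map_conj_inv g T₀) fun t t' ht ↦ congrArg χ <| Subtype.ext <| by
      change g * (t' : GL (Fin n) Ω) * g⁻¹ = t
      rw [ht]
      group
  have hχ₀' : IsWeight H₀ (χ'.comp c) := hχ₀.frob Fr hH₀ hT₀ fun t t' ht ↦ hχ' (c t) (c t') <| by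
    change g * (t' : GL (Fin n) Ω) * g⁻¹ =
      g * frobGL Fr (g⁻¹ * (g * (t : GL (Fin n) Ω) * g⁻¹) * g) * g⁻¹
    rw [ht, mul_assoc g (t : GL (Fin n) Ω), inv_mul_cancel_left, inv_mul_cancel_right]
  exact hχ₀'.conj rfl rfl fun t t' ht ↦ congrArg χ' (Subtype.ext ht)

end RationalStructures

section FrobeniusAction

variable {n : ℕ} {k Ω : Type*} [Field k] [Field Ω] [Algebra k Ω] {Fr : Ω ≃ₐ[k] Ω}
  {G T B : Subgroup (GL (Fin n) Ω)} {ι X Y : Type*} [AddCommGroup X] [AddCommGroup Y]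
  {P : RootPairing ι ℤ X Y} {ch : Multiplicative X →* (T →* Ωˣ)}

/-- Conjugation by `g` and by `F(g)` give elements `w`, `w'` of the Weyl group that satisfy
`τ w' = w τ`. -/
lemma inv_mul_mul_mem_weyl (hG : IsDefinedOver k G) (hT : IsDefinedOver k T)
    (hP : IsRootDatumOf G T P ch) {τ : X ≃ₗ[ℤ] X} (hτ : IsFrobAction Fr ch τ) {w : X ≃ₗ[ℤ] X}
    (hw : w ∈ weyl P) : τ⁻¹ * w * τ ∈ weyl P := by
  obtain ⟨g, hg, hgT, hact⟩ := hP.normalizer_of_weyl w hw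
  obtain ⟨w', hw', hact'⟩ :=
    hP.weyl_of_normalizer _ (hG.frobGL_mem Fr hg) (hT.map_conj_frobGL Fr hgT)
  suffices hcomm : w * τ = τ * w' by rwa [mul_assoc, hcomm, inv_mul_cancel_left]
  refine LinearEquiv.ext fun x ↦ Multiplicative.ofAdd.injective (hP.injective ?_)
  ext t : 2
  obtain ⟨s, hs, hst⟩ : (t : GL (Fin n) Ω) ∈ T.map (MulAut.conj g).toMonoidHom := hgT.symm ▸ t.2
  have hs' : s = g⁻¹ * (t : GL (Fin n) Ω) * g := by
    rw [← hst]
    change s = g⁻¹ * (g * s * g⁻¹) * g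
    group
  refine Fr.injective ?_
  rw [LinearEquiv.mul_apply, LinearEquiv.mul_apply, hact (τ x) t ⟨s, hs⟩ hs',
    ← hτ x ⟨s, hs⟩ ⟨_, hT.frobGL_mem Fr hs⟩ rfl, ← hτ (w' x) t ⟨_, hT.frobGL_mem Fr t.2⟩ rfl,
    hact' x _ ⟨_, hT.frobGL_mem Fr hs⟩ (by simp only [hs', map_mul, map_inv])]

lemma exists_aut_of_isFrobAction [Finite ι] (hG : IsDefinedOver k G) (hT : IsDefinedOver k T)
    (hP : IsRootDatumOf G T P ch) (Δ : P.Base) {τ : X ≃ₗ[ℤ] X} (hτ : IsFrobAction Fr ch τ) :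
    ∃ t : P.Aut, Equiv.weightHom P t = τ := by
  have := hP.reduced
  have : Module.IsReflexive ℤ X := .of_isPerfPair P.toLinearMap
  refine exists_aut_of_normalizes Δ (fun i ↦ ?_) fun w ↦ inv_mul_mul_mem_weyl hG hT hP hτ
  refine (hP.roots _).mpr (((hP.roots _).mp ⟨i, rfl⟩).frob Fr hG hT fun t t' ht ↦ ?_)
  rw [hτ _ t t' ht, LinearEquiv.apply_symm_apply]

lemma exists_isCoxeterWord_of_isCoxeterPair {K : Type*} [Field K] [Algebra K Ω]
    (hT : IsDefinedOver k T) (hP : IsRootDatumOf G T P ch) {t : P.Aut}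
    (hτ : IsFrobAction Fr ch (Equiv.weightHom P t)) {Δ : P.Base} (hΔ : IsBaseOf B ch Δ)
    (hCox : IsCoxeterPair k K Fr G T B ch (Equiv.weightHom P t) Δ) :
    ∃ (σ : P.Aut) (l : List ι), IsCoxeterWord Δ σ l ∧ wordProd P l * σ = t := by
  have := hP.reduced
  obtain ⟨T₀, B₀, -, g, w, -, hT₀, -, hB₀, -, -, -, hTg, hBg, hact, hw⟩ := hCox
  refine exists_isCoxeterWord hw fun i j hi hij ↦ ?_
  rw [hΔ] at hi ⊢
  refine hi.of_frob Fr hB₀ hT₀ hBg hTg fun s s' hs ↦ ?_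
  rw [← hij, LinearEquiv.mul_apply, ← hτ _ s ⟨_, hT.frobGL_mem Fr s.2⟩ rfl,
    hact _ _ s' (by rw [hs]; simp only [map_mul, map_inv, mul_inv_rev, inv_inv, mul_assoc])]

end FrobeniusAction

end CoxeterTorus

end

open CoxeterTorus RootPairing in
theorem proposition6p2_general {k K Ω : Type*} [Field k] [Field K] [Field Ω] [Algebra k Ω]
    [Algebra K Ω] (Fr : Ω ≃ₐ[k] Ω) {n : ℕ} (G T B : Subgroup (GL (Fin n) Ω))
    (hGk : IsDefinedOver k G) (hTk : IsDefinedOver k T) {ι X Y : Type*} [Finite ι]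
    [AddCommGroup X] [AddCommGroup Y] [Module.Finite ℤ X] (P : RootPairing ι ℤ X Y)
    (ch : Multiplicative X →* (T →* Ωˣ)) (hP : IsRootDatumOf G T P ch)
    (τ : X ≃ₗ[ℤ] X) (hτ : IsFrobAction Fr ch τ) (Δ₀ : P.Base) (hΔ₀ : IsBaseOf B ch Δ₀)
    (hCox : IsCoxeterPair k K Fr G T B ch τ Δ₀) (hconn : IsConnectedDynkin Δ₀)
    (i₀ : ι) (hi₀ : IsHighestRoot Δ₀ i₀) (q : ℕ) (hM : maxMark Δ₀ i₀ < (q : ℤ))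
    (κ : Type*) [Field κ] [Infinite κ] :
    ∃ Δ : P.Base,
      (∃ c ∈ weyl P, ∃ σ : X ≃ₗ[ℤ] X, τ = c * σ ∧
        (∀ (t : TorusPts X κ) (x : X),
          frob q τ t (Multiplicative.ofAdd x) = t (Multiplicative.ofAdd (q • c (σ x)))) ∧
        σ '' (P.root '' Δ.support) = P.root '' Δ.support ∧
        IsTwistedCoxeter Δ σ c ∧
        ∀ i : ℕ, 2 * i ≤ orderOnRoots P (c * σ) → len Δ (partialProd σ c i) = i * len Δ c) ∧
      (∀ (α : Δ.support) (ν : Y), IsCoweightLift Δ α ν → ∀ j : ι,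
        ¬ idComponent (langPreimage (κ := κ) P q τ ν) ⊆ kerChar (P.root j)) := by
  have := hP.reduced
  obtain ⟨t, rfl⟩ := exists_aut_of_isFrobAction hGk hTk hP Δ₀ hτ
  obtain ⟨σ₀, l₀, H₀, rfl⟩ := exists_isCoxeterWord_of_isCoxeterPair hTk hP hτ hΔ₀ hCox
  obtain ⟨u, σ, l, H, hprod, hlen⟩ := H₀.exists_reduced_partialProd hconn
  rw [← hprod] at hlen ⊢
  rw [map_mul] at hlen
  refine ⟨smulBase u Δ₀, ⟨Equiv.weightHom P (wordProd P l), weightHom_mem_weyl (wordProd_mem l),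
    Equiv.weightHom P σ, map_mul _ _ _, fun s x ↦ ?_, H.image_support, H.isTwistedCoxeter, hlen⟩,
    fun α ν hν ↦ not_idComponent_subset_kerChar hν (fun i ↦ ?_) fun i ↦
      H.exists_fundCoweight_ne_zero (isConnectedDynkin_smulBase u Δ₀ hconn) i α⟩
  · rw [ofAdd_nsmul, map_pow, map_mul]
    rfl
  · rw [fundCoweight_smulBase, ← spanRoot_smul]
    exact (abs_fundCoweight_le_maxMark hi₀ _ _).trans_lt hM

open CoxeterTorus IsLocalRing in
theorem proposition6p2
    -- `k` is a non-archimedean local field with ring of integers `𝒪`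
    {𝒪 : Type*} [CommRing 𝒪] [IsDomain 𝒪] [IsDiscreteValuationRing 𝒪]
    [IsAdicComplete (maximalIdeal 𝒪) 𝒪] [Finite (ResidueField 𝒪)]
    {k : Type*} [Field k] [Algebra 𝒪 k] [IsFractionRing 𝒪 k]
    -- `K` is the completion of a maximal unramified extension of `k`, with ring of integers `R`
    {R : Type*} [CommRing R] [IsDomain R] [IsDiscreteValuationRing R]
    [IsAdicComplete (maximalIdeal R) R] [Algebra 𝒪 R] [IsLocalHom (algebraMap 𝒪 R)]
    (hunram : (maximalIdeal 𝒪).map (algebraMap 𝒪 R) = maximalIdeal R)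
    [IsAlgClosure (ResidueField 𝒪) (ResidueField R)]
    {K : Type*} [Field K] [Algebra R K] [IsFractionRing R K] [Algebra k K] [Algebra 𝒪 K]
    [IsScalarTower 𝒪 k K] [IsScalarTower 𝒪 R K]
    -- `Ω` is an algebraic closure of `K`, and `Fr` extends the Frobenius of `K/k` to `Ω`
    {Ω : Type*} [Field Ω] [Algebra K Ω] [IsAlgClosure K Ω] [Algebra k Ω] [IsScalarTower k K Ω]
    (q : ℕ) (hq : q = Nat.card (ResidueField 𝒪))
    (Fr : Ω ≃ₐ[k] Ω)
    (hFr : ∀ x : R, ∃ y ∈ maximalIdeal R,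
      Fr (algebraMap K Ω (algebraMap R K x)) = algebraMap K Ω (algebraMap R K (x ^ q + y)))
    -- `G` is a reductive group over `k`, `T` a `k`-rational maximal torus split over `K`, and `B` a
    -- Borel subgroup containing `T`
    {n : ℕ} (G T B : Subgroup (GL (Fin n) Ω))
    (hG : IsReductive G) (hGk : IsDefinedOver k G)
    (hT : IsMaximalTorus T G) (hTk : IsDefinedOver k T) (hTK : IsSplitOver K T)
    (hB : IsBorel B G) (hTB : T ≤ B)
    -- `P` is the root datum of `(G, T)`, and `τ` the action of the Frobenius on `X = X^*(T)`
    {ι X Y : Type*} [Finite ι] [AddCommGroup X] [AddCommGroup Y] [Module.Finite ℤ X]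
    [Module.Finite ℤ Y] (P : RootPairing ι ℤ X Y) (ch : Multiplicative X →* (T →* Ωˣ))
    (hP : IsRootDatumOf G T P ch)
    (τ : X ≃ₗ[ℤ] X) (hτ : IsFrobAction Fr ch τ)
    -- `Δ₀` is the set of simple roots of `B`; `(T, B)` is a Coxeter pair; the Dynkin diagram is
    -- connected
    (Δ₀ : P.Base) (hΔ₀ : IsBaseOf B ch Δ₀)
    (hCox : IsCoxeterPair k K Fr G T B ch τ Δ₀)
    (hconn : IsConnectedDynkin Δ₀)
    -- `q > M`
    (i₀ : ι) (hi₀ : IsHighestRoot Δ₀ i₀) (hM : maxMark Δ₀ i₀ < (q : ℤ)) :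
    ∃ Δ : P.Base,
      (∃ c ∈ weyl P, ∃ σ : X ≃ₗ[ℤ] X,
        -- `F` acts on `X^*(T)` as `q c σ`
        τ = c * σ ∧
        (∀ (t : TorusPts X (ResidueField R)) (x : X),
          frob q τ t (Multiplicative.ofAdd x) = t (Multiplicative.ofAdd (q • c (σ x)))) ∧
        σ '' (P.root '' Δ.support) = P.root '' Δ.support ∧
        IsTwistedCoxeter Δ σ c ∧
        ∀ i : ℕ, 2 * i ≤ orderOnRoots P (c * σ) → len Δ (partialProd σ c i) = i * len Δ c) ∧
      (∀ (α : Δ.support) (ν : Y), IsCoweightLift Δ α ν → ∀ j : ι,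
        ¬ idComponent (langPreimage (κ := ResidueField R) P q τ ν) ⊆ kerChar (P.root j)) := by
  have : IsAlgClosed (ResidueField R) := IsAlgClosure.isAlgClosed (ResidueField 𝒪)
  exact proposition6p2_general Fr G T B hGk hTk P ch hP τ hτ Δ₀ hΔ₀ hCox hconn i₀ hi₀ q hM _
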